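/- **Notation.** For $z\in\mathbb C$ let $\sqrt z=|z|^{1/2}e^{i\arg z/2}$ with $\arg z\in[0,2\pi)$. For $\kappa\in\mathbb R$ put $\nu_\kappa(\lambda)=\sqrt{-\lambda^2-2\kappa^2}$, $S_\kappa=\{\lambda\in\mathbb C:\Re\lambda=0,\ |\Im\lambda|\ge\sqrt2\,|\kappa|\}$ and $D_\kappa^+=\{\lambda\in\mathbb C:\Re(\kappa^2+\lambda^2)^2<0,\ \Im\lambda>0\}$; the boundary $\partial D_\kappa^+$ is oriented so that $D_\kappa^+$ lies to its left. Let $$\widehat{u_0}(\kappa,\lambda)=\int_{-\infty}^\infty\int_0^\infty e^{-ix\kappa-iy\lambda}u_0(x,y)\,dy\,dx\quad(\Im\lambda\le0),$$ $$\widetilde{g_j}(\kappa,\eta,t)=\int_0^te^{\eta\tau}\int_{-\infty}^\infty e^{-ix\kappa}g_j(x,\tau)\,dx\,d\tau,\qquad E(\kappa,\lambda;x,y,t)=e^{-(\kappa^2+\lambda^2)^2t+i\kappa x+i\lambda y}.$$ **(a)** For every $\kappa\in\mathbb R$, $\nu_\kappa$ is analytic on $\mathbb C\setminus S_\kappa$.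 If $\kappa\ne0$, then $S_\kappa$ has positive distance from $\overline{D_\kappa^+}$, so $\nu_\kappa$ is analytic in a neighbourhood of every point of $\overline{D_\kappa^+}$; for $\kappa=0$ the same holds at every point of $\overline{D_0^+}\setminus\{0\}$. **(b)** Let $m>3$ and let $u:\mathbb R\times[0,\infty)\times[0,T]\to\mathbb C$ be such that $u(\cdot,\cdot,t)$ is $C^4$ on $\mathbb R\times[0,\infty)$ for every $t\in[0,T]$, and that for all $i+j\le4$ the derivative $\partial_x^i\partial_y^ju$ is continuous on $\mathbb R\times[0,\infty)\times[0,T]$ and bounded there by $C(1+|x|+|y|)^{-m}$ for some constant $C$. Suppose that $$u_t+\Delta^2u=0\quad\text{on }\mathbb R\times(0,\infty)\times(0,T),\qquad \Delta^2=\partial_x^4+2\partial_x^2\partial_y^2+\partial_y^4,$$ that $u(x,0,t)=g_0(x,t)$ and $u_y(x,0,t)=g_1(x,t)$ for $x\in\mathbb R$, $0<t<T$, and that $u(x,y,0)=u_0(x,y)$ for $x\in\mathbb R$, $y>0$. Then for all $x\in\mathbb R$, $y>0$, $0<t<T$, $$u(x,y,t)=\frac1{(2\pi)^2}\int_{-\infty}^\infty\int_{-\infty}^\infty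 E(\kappa,\lambda;x,y,t)\,\widehat{u_0}(\kappa,\lambda)\,d\lambda\,d\kappa+\frac1{(2\pi)^2}\int_{-\infty}^\infty\int_{\partial D_\kappa^+}E(\kappa,\lambda;x,y,t)\,G(\kappa,\lambda;t)\,d\lambda\,d\kappa,$$ where both double integrals converge absolutely and $$G(\kappa,\lambda;t)=-\frac{\nu_\kappa(\lambda)+\lambda}{\nu_\kappa(\lambda)-\lambda}\,\widehat{u_0}(\kappa,-\lambda)+\frac{2\lambda}{\nu_\kappa(\lambda)-\lambda}\,\widehat{u_0}(\kappa,-\nu_\kappa(\lambda))-2\lambda[\lambda+\nu_\kappa(\lambda)]\,\widetilde{g_1}(\kappa,(\kappa^2+\lambda^2)^2,t)+2i\lambda\nu_\kappa(\lambda)[\nu_\kappa(\lambda)+\lambda]\,\widetilde{g_0}(\kappa,(\kappa^2+\lambda^2)^2,t).$$ -/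

import Mathlib

open MeasureTheory Set

noncomputable section

namespace HalfSpaceHeat

/-! ### Partial derivatives and the initial boundary value problem -/

/-- Partial derivative in `x`. -/
def dx (v : ℝ → ℝ → ℝ → ℂ) : ℝ → ℝ → ℝ → ℂ :=
  fun x y t => deriv (fun s => v s y t) x

/-- Partial derivative in `y` on the closed half line `y ≥ 0` (one-sided at `y = 0`). -/
def dy (v : ℝ → ℝ → ℝ → ℂ) : ℝ → ℝ → ℝ → ℂ :=
  fun x y t => derivWithin (fun s => v x s t) (Ici 0) y

/-- `Δ² u = ∂ₓ⁴ u + 2 ∂ₓ² ∂_y² u + ∂_y⁴ u`. -/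
def bilaplacian (u : ℝ → ℝ → ℝ → ℂ) (x y t : ℝ) : ℂ :=
  dx^[4] u x y t + 2 * dx^[2] (dy^[2] u) x y t + dy^[4] u x y t

/-- Smoothness up to the boundary of `ℝ × (0,∞) × (0,T)` and decay as `|(x,y)| → ∞`: for every
time `u` is `C⁴` in `(x,y)` on the closed half plane, all spatial derivatives of order at most
four are continuous on `ℝ × [0,∞) × [0,T]`, and they are `O((1 + |x| + |y|)^(-m))` uniformly
in time. -/
structure SmoothDecaying (T m : ℝ) (u : ℝ → ℝ → ℝ → ℂ) : Prop where
  contDiffOn : ∀ t ∈ Icc 0 T,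
    ContDiffOn ℝ 4 (fun q : ℝ × ℝ => u q.1 q.2 t) (univ ×ˢ Ici 0)
  continuousOn : ∀ i j : ℕ, i + j ≤ 4 →
    ContinuousOn (fun p : ℝ × ℝ × ℝ => dx^[i] (dy^[j] u) p.1 p.2.1 p.2.2)
      (univ ×ˢ Ici 0 ×ˢ Icc 0 T)
  decay : ∃ C : ℝ, ∀ i j : ℕ, i + j ≤ 4 → ∀ x : ℝ, ∀ y ∈ Ici (0 : ℝ), ∀ t ∈ Icc 0 T,
    ‖dx^[i] (dy^[j] u) x y t‖ ≤ C * (1 + |x| + |y|) ^ (-m)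

/-- `u_t + Δ² u = 0` on `ℝ × (0,∞) × (0,T)` with Dirichlet datum `g₀`, Neumann datum `g₁` and
initial datum `u₀`. -/
structure SolvesIBVP (T : ℝ) (u : ℝ → ℝ → ℝ → ℂ) (u₀ g₀ g₁ : ℝ → ℝ → ℂ) : Prop where
  pde : ∀ x : ℝ, ∀ y ∈ Ioi (0 : ℝ), ∀ t ∈ Ioo 0 T,
    HasDerivAt (fun s => u x y s) (-bilaplacian u x y t) t
  dirichlet : ∀ x : ℝ, ∀ t ∈ Ioo 0 T, u x 0 t = g₀ x t
  neumann : ∀ x : ℝ, ∀ t ∈ Ioo 0 T, dy u x 0 t = g₁ x t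
  initial : ∀ x : ℝ, ∀ y ∈ Ioi (0 : ℝ), u x y 0 = u₀ x y

/-! ### Transforms -/

/-- Half space Fourier transform; meaningful for `Im l ≤ 0`. -/
def halfFourier (f : ℝ → ℝ → ℂ) (κ : ℝ) (l : ℂ) : ℂ :=
  ∫ x : ℝ, ∫ y in Ioi (0 : ℝ), Complex.exp (-Complex.I * x * κ - Complex.I * y * l) * f x y

/-- Fourier transform in the variable `x`. -/
def fourierX (g : ℝ → ℝ → ℂ) (κ t : ℝ) : ℂ :=
  ∫ x : ℝ, Complex.exp (-Complex.I * x * κ) * g x t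

/-- The `t`-transform of a boundary datum. -/
def tTransform (g : ℝ → ℝ → ℂ) (κ : ℝ) (η : ℂ) (t : ℝ) : ℂ :=
  ∫ τ in (0 : ℝ)..t, Complex.exp (η * τ) * fourierX g κ τ

/-! ### The branch of the square root and the invariance map -/

/-- The argument in `[0, 2π)`. -/
def argPos (z : ℂ) : ℝ := if 0 ≤ z.arg then z.arg else z.arg + 2 * Real.pi

/-- The square root with argument of `z` taken in `[0, 2π)`. -/
def sqrtPos (z : ℂ) : ℂ := (Real.sqrt ‖z‖ : ℂ) * Complex.exp (Complex.I * (argPos z / 2 : ℝ))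

/-- `ν_κ(l) = √(-l² - 2κ²)`. -/
def nu (κ : ℝ) (l : ℂ) : ℂ := sqrtPos (-l ^ 2 - 2 * (κ : ℂ) ^ 2)

/-- The branch cut `S_κ` of `ν_κ`. -/
def cut (κ : ℝ) : Set ℂ := {l | l.re = 0 ∧ Real.sqrt 2 * |κ| ≤ |l.im|}

/-! ### The region `D_κ⁺` and integration along its boundary -/

/-- `D_κ`. -/
def D (κ : ℝ) : Set ℂ := {l | (((κ : ℂ) ^ 2 + l ^ 2) ^ 2).re < 0}

/-- `D_κ⁺`, the part of `D_κ` in the open upper half plane. -/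
def Dplus (κ : ℝ) : Set ℂ := D κ ∩ {l | 0 < l.im}

/-- The four arcs of `∂D_κ⁺`, each starting at `i|κ|` for `a = 0` and going to infinity:
right (`σ = 1`) or left (`σ = -1`), upper (`τ = 1`) or lower (`τ = -1`). -/
def arc (κ σ τ a : ℝ) : ℂ := ⟨σ * a, Real.sqrt (κ ^ 2 + 2 * a ^ 2) + τ * a⟩

/-- Integral along one arc, from `i|κ|` to infinity. -/
def arcIntegral (κ σ τ : ℝ) (F : ℂ → ℂ) : ℂ :=
  ∫ a in Ioi (0 : ℝ), F (arc κ σ τ a) * deriv (arc κ σ τ) a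

/-- Integral over `∂D_κ⁺`, oriented with `D_κ⁺` on the left: the right component is bounded by
its upper arc run inwards and its lower arc run outwards, the left component by its lower arc run
inwards and its upper arc run outwards. -/
def boundaryIntegral (κ : ℝ) (F : ℂ → ℂ) : ℂ :=
  (-arcIntegral κ 1 1 F + arcIntegral κ 1 (-1) F) +
    (-arcIntegral κ (-1) (-1) F + arcIntegral κ (-1) 1 F)

/-- Absolute convergence of `∫_ℝ ∫_{∂D_κ⁺} F(κ, l) dl dκ`. -/
def BoundaryIntegrable (F : ℝ → ℂ → ℂ) : Prop :=
  ∀ σ ∈ ({1, -1} : Set ℝ), ∀ τ ∈ ({1, -1} : Set ℝ),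
    IntegrableOn (fun p : ℝ × ℝ => F p.1 (arc p.1 σ τ p.2) * deriv (arc p.1 σ τ) p.2)
      (univ ×ˢ Ioi 0)

/-! ### The integrands -/

/-- `E(κ, l; x, y, t) = exp(-(κ² + l²)² t + iκx + ily)`. -/
def E (κ : ℝ) (l : ℂ) (x y t : ℝ) : ℂ :=
  Complex.exp (-((κ : ℂ) ^ 2 + l ^ 2) ^ 2 * t + Complex.I * κ * x + Complex.I * l * y)

/-- `G(κ, l; t)`. -/
def G (u₀ g₀ g₁ : ℝ → ℝ → ℂ) (κ : ℝ) (l : ℂ) (t : ℝ) : ℂ :=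
  -((nu κ l + l) / (nu κ l - l)) * halfFourier u₀ κ (-l)
    + 2 * l / (nu κ l - l) * halfFourier u₀ κ (-nu κ l)
    - 2 * l * (l + nu κ l) * tTransform g₁ κ (((κ : ℂ) ^ 2 + l ^ 2) ^ 2) t
    + 2 * Complex.I * l * nu κ l * (nu κ l + l)
        * tTransform g₀ κ (((κ : ℂ) ^ 2 + l ^ 2) ^ 2) t

/-! ### The arcs do trace the boundary of `D_κ⁺` -/

theorem mem_Dplus_iff (κ : ℝ) (l : ℂ) :
    l ∈ Dplus κ ↔ |l.im - Real.sqrt (κ ^ 2 + 2 * l.re ^ 2)| - |l.re| < 0 := by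
  obtain ⟨a, b⟩ := l
  set s := Real.sqrt (κ ^ 2 + 2 * a ^ 2) with hs
  have hs0 : 0 ≤ s := Real.sqrt_nonneg _
  have hs2 : s ^ 2 = κ ^ 2 + 2 * a ^ 2 := Real.sq_sqrt (by positivity)
  have ha2 : |a| ^ 2 = a ^ 2 := sq_abs a
  have ha0 : 0 ≤ |a| := abs_nonneg a
  have has : |a| ≤ s := abs_le_of_sq_le_sq' (by nlinarith [sq_nonneg κ]) hs0 |>.2
  have hre : ((((κ : ℂ) ^ 2 + (⟨a, b⟩ : ℂ) ^ 2) ^ 2).re)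
      = ((b - s) ^ 2 - a ^ 2) * ((b + s) ^ 2 - a ^ 2) := by
    simp only [pow_two, Complex.mul_re, Complex.add_re, Complex.add_im, Complex.mul_im,
      Complex.ofReal_re, Complex.ofReal_im]
    have h4 : κ ^ 2 = s ^ 2 - 2 * a ^ 2 := by linarith
    have h5 : κ * κ = s ^ 2 - 2 * a ^ 2 := by nlinarith
    simp only [mul_zero, sub_zero, zero_mul, add_zero, zero_add, h5]
    ring
  simp only [Dplus, D, mem_inter_iff, mem_ofPred_eq, hre, sub_neg]
  rw [abs_lt]
  have hfac : ∀ c : ℝ, c ^ 2 - a ^ 2 = (c - |a|) * (c + |a|) := by intro c; nlinarith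
  constructor
  · rintro ⟨h, hb⟩
    have h1 : 0 < (b + s) ^ 2 - a ^ 2 := by rw [hfac]; apply mul_pos <;> linarith
    have h2 : (b - s) ^ 2 - a ^ 2 < 0 := by
      by_contra hc
      push Not at hc
      nlinarith [mul_nonneg hc h1.le]
    have h3 : (b - s) ^ 2 < |a| ^ 2 := by linarith
    exact abs_lt_of_sq_lt_sq' h3 ha0
  · rintro ⟨h1, h2⟩
    have hb : 0 < b := by linarith
    refine ⟨?_, hb⟩
    apply mul_neg_of_neg_of_pos
    · rw [hfac]; apply mul_neg_of_neg_of_pos <;> linarith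
    · rw [hfac]; apply mul_pos <;> linarith

theorem frontier_Dplus (κ : ℝ) :
    frontier (Dplus κ) = ⋃ σ ∈ ({1, -1} : Set ℝ), ⋃ τ ∈ ({1, -1} : Set ℝ),
      arc κ σ τ '' Ici 0 := by
  have hset : Dplus κ = {l : ℂ | |l.im - Real.sqrt (κ ^ 2 + 2 * l.re ^ 2)| - |l.re| < 0} := by
    ext l; exact mem_Dplus_iff κ l
  have hcont : Continuous
      (fun l : ℂ => |l.im - Real.sqrt (κ ^ 2 + 2 * l.re ^ 2)| - |l.re|) := by fun_prop
  have hopen : IsOpen (Dplus κ) := by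
    rw [hset]; exact isOpen_lt hcont continuous_const
  ext l
  simp only [mem_iUnion, exists_prop]
  constructor
  · intro h
    rw [hset] at h
    have h0 : |l.im - Real.sqrt (κ ^ 2 + 2 * l.re ^ 2)| - |l.re| = 0 :=
      frontier_lt_subset_eq hcont continuous_const h
    have key : ∃ σ ∈ ({1, -1} : Set ℝ), l.re = σ * |l.re| := by
      rcases le_total 0 l.re with h | h
      · exact ⟨1, by simp, by rw [abs_of_nonneg h]; ring⟩
      · exact ⟨-1, by simp, by rw [abs_of_nonpos h]; ring⟩
    have key2 : ∃ τ ∈ ({1, -1} : Set ℝ),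
        l.im = Real.sqrt (κ ^ 2 + 2 * l.re ^ 2) + τ * |l.re| := by
      rcases le_total 0 (l.im - Real.sqrt (κ ^ 2 + 2 * l.re ^ 2)) with h | h
      · rw [abs_of_nonneg h] at h0; exact ⟨1, by simp, by linarith⟩
      · rw [abs_of_nonpos h] at h0; exact ⟨-1, by simp, by linarith⟩
    obtain ⟨σ, hσ, h1⟩ := key
    obtain ⟨τ, hτ, h2⟩ := key2
    refine ⟨σ, hσ, τ, hτ, |l.re|, mem_Ici.2 (abs_nonneg _), ?_⟩
    apply Complex.ext
    · simp [arc, ← h1]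
    · simp [arc, ← h2]
  · rintro ⟨σ, hσ, τ, hτ, a, ha, rfl⟩
    have ha' : 0 ≤ a := ha
    have hσ1 : |σ| = 1 := by rcases hσ with rfl | rfl <;> simp
    have hτ1 : |τ| = 1 := by rcases hτ with rfl | rfl <;> simp
    have hσ2 : σ ^ 2 = 1 := by rw [← sq_abs, hσ1]; norm_num
    rw [hopen.frontier_eq]
    constructor
    · have hc : Continuous (fun e : ℝ => (⟨σ * (a + e),
          Real.sqrt (κ ^ 2 + 2 * (a + e) ^ 2) + τ * ((1 - e) * (a + e))⟩ : ℂ)) := by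
        have : (fun e : ℝ => (⟨σ * (a + e),
          Real.sqrt (κ ^ 2 + 2 * (a + e) ^ 2) + τ * ((1 - e) * (a + e))⟩ : ℂ))
          = fun e : ℝ => ((σ * (a + e) : ℝ) : ℂ) + ((Real.sqrt (κ ^ 2 + 2 * (a + e) ^ 2)
            + τ * ((1 - e) * (a + e)) : ℝ) : ℂ) * Complex.I := by
          ext e
          exact Complex.mk_eq_add_mul_I _ _
        rw [this]
        fun_prop
      have hlim := (hc.tendsto 0).mono_left (nhdsWithin_le_nhds (s := Ioi (0 : ℝ)))
      have h0 : (⟨σ * (a + 0),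
          Real.sqrt (κ ^ 2 + 2 * (a + 0) ^ 2) + τ * ((1 - 0) * (a + 0))⟩ : ℂ)
          = arc κ σ τ a := by simp [arc]
      rw [h0] at hlim
      refine mem_closure_of_tendsto hlim ?_
      filter_upwards [Ioo_mem_nhdsGT (show (0 : ℝ) < 1 by norm_num)] with e he
      rw [mem_Dplus_iff]
      have hpos : 0 < a + e := by linarith [he.1]
      have : (σ * (a + e)) ^ 2 = (a + e) ^ 2 := by rw [mul_pow, hσ2, one_mul]
      simp only [this, add_sub_cancel_left, abs_mul, hσ1, hτ1, one_mul, abs_of_pos hpos]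
      rw [abs_of_pos (by linarith [he.2] : (0 : ℝ) < 1 - e)]
      nlinarith [he.1]
    · rw [mem_Dplus_iff]
      have : (σ * a) ^ 2 = a ^ 2 := by rw [mul_pow, hσ2, one_mul]
      simp [arc, this, abs_mul, hσ1, hτ1]

end HalfSpaceHeat

end

open HalfSpaceHeat

open Filter Topology

noncomputable section

namespace HalfSpaceHeat

/-! ### The branch of the square root -/

/-! The proof is the unified transform (Fokas method) for a fixed tangential frequency `κ`, followed
by Fourier inversion in `x`. Write `η = (κ² + l²)²`. Pairing the equation with `exp(ητ - iκx - ily)`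
over the half plane and `0 < τ < t` gives, for `Im l ≤ 0`, the identity `global_relation`: `exp(ηt)`
times the transform of the solution at time `t` is the transform of the initial value plus
`boundaryTerm`, which involves the four traces `∂_y^j u`, `j ≤ 3`.

On the real line this is the normal Fourier transform of the solution extended by zero. The
extension may jump at `y = 0`, so inversion is done with a Gaussian factor that is removed in the
limit (`tendsto_gaussian_inversion`). The function `boundaryTerm` is entire in `l`, and `E *
boundaryTerm` is at most a polynomial times `exp(-y Im l)` wherever `Re η ≥ 0`. This holds between
the real line and the lower arcs and also above the upper arcs. Hence the real line may be pushed up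
to the lower arcs (`integral_eq_arcIntegral_lower`), while the upper arcs contribute nothing
(`arcIntegral_upper_eq`). Together they give an integral over `∂D_κ⁺`.

The second and third normal derivatives are not data. Since `η` is invariant under `l ↦ -l` and `l ↦
-ν_κ(l)`, and both images lie in the closed lower half plane when `Im l ≥ 0`, the global relation at
these two points is a linear system for the two unknown transforms. Solving it yields `boundaryTerm
= G + exp(ηt) * remainder` (`boundaryTerm_eq`). In `E * exp(ηt)` the time exponential cancels,
`remainder` is holomorphic in each open quadrant of the upper half plane, and by
`exists_norm_remainder_le` it grows polynomially. So its integrals over the upper and lower arc of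
one component of `D_κ⁺` agree, and it drops out of the boundary integral (`boundaryIntegral_eq`).

On the arcs `Re η = 0` and `Im l` is at least `(|κ| + a)/10`, so every integrand decays
exponentially in `κ` and in the arc parameter `a`. This gives absolute convergence, and also the
integrability in `κ` needed for inversion in `x`.

Analyticity of `ν_κ` comes from writing the branch as `i` times the principal root of `l² + 2κ²`,
which avoids the negative real axis off the cut. -/

theorem argPos_mem (z : ℂ) : 0 ≤ argPos z ∧ argPos z < 2 * Real.pi := by
  unfold argPos
  have h1 := Complex.neg_pi_lt_arg z
  have h2 := Complex.arg_le_pi z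
  have h3 := Real.pi_pos
  split_ifs with h <;> constructor <;> linarith

theorem sqrtPos_sq (z : ℂ) : sqrtPos z ^ 2 = z := by
  have hexp : Complex.exp (Complex.I * (argPos z / 2 : ℝ)) ^ 2
      = Complex.exp (z.arg * Complex.I) := by
    rw [← Complex.exp_nat_mul]
    unfold argPos
    split_ifs with h
    · congr 1; push_cast; ring
    · have : ((2 : ℕ) : ℂ) * (Complex.I * (((z.arg + 2 * Real.pi) / 2 : ℝ) : ℂ))
          = z.arg * Complex.I + 2 * Real.pi * Complex.I := by push_cast; ring
      rw [this, Complex.exp_add, Complex.exp_two_pi_mul_I, mul_one]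
  unfold sqrtPos
  rw [mul_pow, hexp, ← Complex.ofReal_pow, Real.sq_sqrt (norm_nonneg z)]
  exact Complex.norm_mul_exp_arg_mul_I z

theorem sqrtPos_im (z : ℂ) :
    (sqrtPos z).im = Real.sqrt ‖z‖ * Real.sin (argPos z / 2) := by
  unfold sqrtPos
  rw [Complex.im_ofReal_mul, mul_comm Complex.I, Complex.exp_ofReal_mul_I_im]

theorem sqrtPos_im_nonneg (z : ℂ) : 0 ≤ (sqrtPos z).im := by
  rw [sqrtPos_im]
  obtain ⟨h1, h2⟩ := argPos_mem z
  exact mul_nonneg (Real.sqrt_nonneg _)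
    (Real.sin_nonneg_of_nonneg_of_le_pi (by linarith) (by linarith))

/-- Off the positive real axis `sqrtPos` is a rotated principal square root. -/
theorem sqrtPos_eq_cpow {z : ℂ} (hz : -z ∈ Complex.slitPlane) :
    sqrtPos z = Complex.I * (-z) ^ (1 / 2 : ℂ) := by
  have hz0 : -z ≠ 0 := Complex.slitPlane_ne_zero hz
  have hz0' : z ≠ 0 := fun h => hz0 (by simp [h])
  have harg : (-z).arg ≠ Real.pi := Complex.slitPlane_arg_ne_pi hz
  -- two square roots of `z` in the upper half plane
  have hsq : (Complex.I * (-z) ^ (1 / 2 : ℂ)) ^ 2 = z := by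
    rw [mul_pow, Complex.I_sq, ← Complex.cpow_nat_mul]
    norm_num
  have him : 0 < (Complex.I * (-z) ^ (1 / 2 : ℂ)).im := by
    rw [Complex.I_mul_im, Complex.cpow_def_of_ne_zero hz0, Complex.exp_re]
    apply mul_pos (Real.exp_pos _)
    have : (Complex.log (-z) * (1 / 2)).im = (-z).arg / 2 := by
      rw [show (1 / 2 : ℂ) = ((1 / 2 : ℝ) : ℂ) by push_cast; rfl, Complex.im_mul_ofReal,
        Complex.log_im]
      ring
    rw [this]
    have h1 := Complex.neg_pi_lt_arg (-z)
    have h2 := lt_of_le_of_ne (Complex.arg_le_pi (-z)) harg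
    exact Real.cos_pos_of_mem_Ioo ⟨by linarith, by linarith⟩
  rcases sq_eq_sq_iff_eq_or_eq_neg.1 ((sqrtPos_sq z).trans hsq.symm) with h | h
  · exact h
  · have := sqrtPos_im_nonneg z
    rw [h, Complex.neg_im] at this
    linarith

theorem measurable_sqrtPos : Measurable sqrtPos := by
  have h : Measurable argPos :=
    Measurable.ite (measurableSet_le measurable_const Complex.measurable_arg)
      Complex.measurable_arg (Complex.measurable_arg.add_const _)
  unfold sqrtPos
  fun_prop

/-! ### The invariance map -/

theorem nu_sq (κ : ℝ) (l : ℂ) : nu κ l ^ 2 = -l ^ 2 - 2 * (κ : ℂ) ^ 2 := sqrtPos_sq _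

theorem nu_im_nonneg (κ : ℝ) (l : ℂ) : 0 ≤ (nu κ l).im := sqrtPos_im_nonneg _

/-- Equality would give `l² = -κ²`, which is impossible off the imaginary axis. Thus the
denominators `ν - l` vanish on the arcs at most at the common starting point `i|κ|`. -/
theorem nu_ne_self {κ : ℝ} {l : ℂ} (hl : l.re ≠ 0) : nu κ l ≠ l := by
  intro h
  have h2 := nu_sq κ l
  rw [h] at h2
  have him := congrArg Complex.im h2
  have hre := congrArg Complex.re h2
  simp [pow_two] at him hre
  have h3 : l.im = 0 := by
    have : l.re * l.im = 0 := by linarith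
    rcases mul_eq_zero.1 this with h | h
    · exact absurd h hl
    · exact h
  rw [h3] at hre
  have : 0 < l.re * l.re := mul_self_pos.2 hl
  nlinarith [mul_self_nonneg κ]

/-- The number in question is `l² + 2κ²`. If it is real and nonpositive, then `Re l · Im l = 0`.
Vanishing of `Im l` forces `l = 0`, and vanishing of `Re l` gives `(Im l)² ≥ 2κ²`, so `l` lies on
the cut in either case. -/
theorem mem_slitPlane_of_notMem_cut {κ : ℝ} {l : ℂ} (hl : l ∉ cut κ) :
    -(-l ^ 2 - 2 * (κ : ℂ) ^ 2) ∈ Complex.slitPlane := by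
  by_contra hc
  apply hl
  rw [Complex.mem_slitPlane_iff] at hc
  push Not at hc
  obtain ⟨h1, h2⟩ := hc
  simp [pow_two] at h1 h2
  have h3 : l.re * l.im = 0 := by linarith
  have hre : l.re = 0 := by
    rcases mul_eq_zero.1 h3 with h | h
    · exact h
    · rw [h] at h1
      nlinarith [mul_self_nonneg κ, mul_self_nonneg l.re]
  refine ⟨hre, ?_⟩
  rw [hre] at h1
  apply abs_le_of_sq_le_sq' _ (abs_nonneg _) |>.2
  rw [mul_pow, Real.sq_sqrt (by norm_num), sq_abs, sq_abs]
  nlinarith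

theorem analyticOnNhd_nu (κ : ℝ) : AnalyticOnNhd ℂ (nu κ) (cut κ)ᶜ := by
  have hopen : IsOpen (cut κ)ᶜ := by
    rw [isOpen_compl_iff]
    exact (isClosed_eq Complex.continuous_re continuous_const).inter
      (isClosed_le continuous_const (continuous_abs.comp Complex.continuous_im))
  refine DifferentiableOn.analyticOnNhd (fun l hl => ?_) hopen
  have h1 : DifferentiableWithinAt ℂ
      (fun l : ℂ => Complex.I * (-(-l ^ 2 - 2 * (κ : ℂ) ^ 2)) ^ (1 / 2 : ℂ)) (cut κ)ᶜ l := by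
    refine DifferentiableWithinAt.const_mul ?_ _
    refine DifferentiableWithinAt.cpow_const ?_ (mem_slitPlane_of_notMem_cut hl)
    fun_prop
  refine h1.congr (fun z hz => ?_) ?_
  · exact sqrtPos_eq_cpow (mem_slitPlane_of_notMem_cut hz)
  · exact sqrtPos_eq_cpow (mem_slitPlane_of_notMem_cut hl)

/-- Strict positivity puts `-ν` in the open lower half plane, where the half space transform is
holomorphic. -/
theorem nu_im_pos {κ : ℝ} {l : ℂ} (hl : l ∉ cut κ) : 0 < (nu κ l).im := by
  have h := mem_slitPlane_of_notMem_cut hl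
  refine lt_of_le_of_ne (nu_im_nonneg κ l) fun h0 => ?_
  have h2 := nu_sq κ l
  rw [← h2, Complex.mem_slitPlane_iff] at h
  simp [pow_two, ← h0] at h
  nlinarith [mul_self_nonneg (nu κ l).re]

theorem measurable_nu : Measurable (fun p : ℝ × ℂ => nu p.1 p.2) := by
  unfold nu
  exact measurable_sqrtPos.comp (by fun_prop)

/-! ### Geometry of the region -/

theorem closure_Dplus_subset (κ : ℝ) :
    closure (Dplus κ) ⊆ {l | |l.im - Real.sqrt (κ ^ 2 + 2 * l.re ^ 2)| ≤ |l.re|} := by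
  refine closure_minimal (fun l hl => ?_) (isClosed_le (by fun_prop) (by fun_prop))
  have := (mem_Dplus_iff κ l).1 hl
  simp only [mem_ofPred_eq]
  linarith

theorem sqrt_le_abs_add (κ a : ℝ) : Real.sqrt (κ ^ 2 + 2 * a ^ 2) ≤ |κ| + 3 / 2 * |a| := by
  apply Real.sqrt_le_iff.2
  constructor
  · positivity
  · rw [← sq_abs κ, ← sq_abs a]
    nlinarith [abs_nonneg κ, abs_nonneg a, mul_nonneg (abs_nonneg κ) (abs_nonneg a)]

/-- A point of the closed region within `|κ|/20` of the imaginary axis has height at most `|κ| +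
(5/2)|κ|/20`. Moving it by another `|κ|/20` keeps the height below `1.4 |κ|`, hence below the tip
`√2 |κ|` of the cut. -/
theorem disjoint_thickening_cut {κ : ℝ} (hκ : κ ≠ 0) :
    Disjoint (Metric.thickening (|κ| / 20) (closure (Dplus κ))) (cut κ) := by
  have hk : 0 < |κ| := abs_pos.2 hκ
  rw [Set.disjoint_left]
  rintro z hz ⟨hz1, hz2⟩
  obtain ⟨l, hl, hd⟩ := Metric.mem_thickening_iff.1 hz
  have hl2 := closure_Dplus_subset κ hl
  simp only [mem_ofPred_eq] at hl2
  rw [dist_eq_norm] at hd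
  have h1 : |l.re| < |κ| / 20 := by
    have := (Complex.abs_re_le_norm (z - l)).trans_lt hd
    simpa [hz1] using this
  have h2 : |z.im - l.im| < |κ| / 20 := by
    simpa using (Complex.abs_im_le_norm (z - l)).trans_lt hd
  have h3 := sqrt_le_abs_add κ l.re
  have h4 : 0 ≤ Real.sqrt (κ ^ 2 + 2 * l.re ^ 2) := Real.sqrt_nonneg _
  have h5 : (1.4 : ℝ) ≤ Real.sqrt 2 := Real.le_sqrt_of_sq_le (by norm_num)
  have h6 := abs_le.1 hl2
  have h7 := abs_lt.1 h2
  have h8 : |z.im| < 1.4 * |κ| := by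
    rw [abs_lt]
    constructor <;> linarith [h6.1, h6.2, h7.1, h7.2]
  nlinarith

theorem closure_Dplus_diff_subset_compl_cut :
    closure (Dplus 0) \ {0} ⊆ (cut 0)ᶜ := by
  rintro l ⟨hl, hl0⟩ ⟨h1, -⟩
  have h2 := closure_Dplus_subset 0 hl
  simp only [mem_ofPred_eq, h1] at h2
  simp at h2
  exact hl0 (Complex.ext (by simpa using h1) (by simpa using h2))

/-- With `s² = κ² + 2a²` the quartic factors completely. In the upper half plane the second factor
is nonnegative because `s ≥ |a|`, so the sign is decided by the distance of `Im l` from `s`. -/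
theorem re_symbol (κ : ℝ) (l : ℂ) :
    (((κ : ℂ) ^ 2 + l ^ 2) ^ 2).re
      = ((l.im - Real.sqrt (κ ^ 2 + 2 * l.re ^ 2)) ^ 2 - l.re ^ 2)
        * ((l.im + Real.sqrt (κ ^ 2 + 2 * l.re ^ 2)) ^ 2 - l.re ^ 2) := by
  obtain ⟨a, b⟩ := l
  dsimp only
  set s := Real.sqrt (κ ^ 2 + 2 * a ^ 2) with hs
  have hs2 : s ^ 2 = κ ^ 2 + 2 * a ^ 2 := Real.sq_sqrt (by positivity)
  have h5 : κ * κ = s ^ 2 - 2 * a ^ 2 := by nlinarith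
  simp only [pow_two, Complex.mul_re, Complex.add_re, Complex.add_im, Complex.mul_im,
    Complex.ofReal_re, Complex.ofReal_im]
  simp only [mul_zero, sub_zero, zero_mul, add_zero, zero_add, h5]
  ring

theorem abs_le_sqrt (κ a : ℝ) : |a| ≤ Real.sqrt (κ ^ 2 + 2 * a ^ 2) :=
  Real.le_sqrt_of_sq_le (by rw [sq_abs]; nlinarith [sq_nonneg κ, sq_nonneg a])

theorem re_symbol_nonneg {κ : ℝ} {l : ℂ} (h0 : 0 ≤ l.im)
    (h : |l.re| ≤ |l.im - Real.sqrt (κ ^ 2 + 2 * l.re ^ 2)|) :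
    0 ≤ (((κ : ℂ) ^ 2 + l ^ 2) ^ 2).re := by
  rw [re_symbol]
  have h1 := abs_le_sqrt κ l.re
  apply mul_nonneg
  · have := sq_le_sq.2 h
    linarith
  · have : l.re ^ 2 ≤ (l.im + Real.sqrt (κ ^ 2 + 2 * l.re ^ 2)) ^ 2 :=
      sq_le_sq.2 (h1.trans (by rw [abs_of_nonneg (by positivity)]; linarith))
    linarith

/-! ### Geometry of the arcs -/

@[simp] theorem arc_re (κ σ τ a : ℝ) : (arc κ σ τ a).re = σ * a := rfl

@[simp] theorem arc_im (κ σ τ a : ℝ) :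
    (arc κ σ τ a).im = Real.sqrt (κ ^ 2 + 2 * a ^ 2) + τ * a := rfl

theorem sq_eq_one_of_mem {σ : ℝ} (hσ : σ ∈ ({1, -1} : Set ℝ)) : σ ^ 2 = 1 := by
  rcases hσ with rfl | rfl <;> norm_num

theorem abs_eq_one_of_mem {σ : ℝ} (hσ : σ ∈ ({1, -1} : Set ℝ)) : |σ| = 1 := by
  rcases hσ with rfl | rfl <;> norm_num

theorem re_symbol_arc {κ σ τ : ℝ} (hσ : σ ∈ ({1, -1} : Set ℝ)) (hτ : τ ∈ ({1, -1} : Set ℝ))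
    (a : ℝ) : (((κ : ℂ) ^ 2 + arc κ σ τ a ^ 2) ^ 2).re = 0 := by
  rw [re_symbol]
  simp only [arc_re, arc_im, mul_pow, sq_eq_one_of_mem hσ, one_mul]
  rw [add_sub_cancel_left, mul_pow, sq_eq_one_of_mem hτ]
  ring

/-- Even the lower arc rises linearly in `|κ| + a`. This is the source of all exponential decay of
`exp(-y Im l)` along the contours, jointly in `κ` and `a`. -/
theorem le_sqrt_sub (κ a : ℝ) :
    (|κ| + a) / 10 ≤ Real.sqrt (κ ^ 2 + 2 * a ^ 2) - a := by
  have : (|κ| + a) / 10 + a ≤ Real.sqrt (κ ^ 2 + 2 * a ^ 2) := by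
    apply Real.le_sqrt_of_sq_le
    have h := sq_abs κ
    nlinarith [sq_nonneg (|κ| - a)]
  linarith

theorem le_arc_im {κ σ τ a : ℝ} (hτ : τ ∈ ({1, -1} : Set ℝ)) (ha : 0 ≤ a) :
    (|κ| + a) / 10 ≤ (arc κ σ τ a).im := by
  have h := le_sqrt_sub κ a
  rw [arc_im]
  rcases hτ with rfl | rfl <;> linarith

theorem arc_im_le {κ σ τ a : ℝ} (hτ : τ ∈ ({1, -1} : Set ℝ)) (ha : 0 ≤ a) :
    (arc κ σ τ a).im ≤ |κ| + 3 * a := by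
  have h := sqrt_le_abs_add κ a
  rw [abs_of_nonneg ha] at h
  rw [arc_im]
  rcases hτ with rfl | rfl <;> linarith

theorem hasDerivAt_arc {κ σ τ a : ℝ} (h : κ ≠ 0 ∨ a ≠ 0) :
    HasDerivAt (arc κ σ τ) ⟨σ, 2 * a / Real.sqrt (κ ^ 2 + 2 * a ^ 2) + τ⟩ a := by
  have hpos : 0 < κ ^ 2 + 2 * a ^ 2 := by
    rcases h with h | h <;> positivity
  have h1 : HasDerivAt (fun a : ℝ => Real.sqrt (κ ^ 2 + 2 * a ^ 2) + τ * a)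
      (2 * a / Real.sqrt (κ ^ 2 + 2 * a ^ 2) + τ) a := by
    have h2 : HasDerivAt (fun a : ℝ => κ ^ 2 + 2 * a ^ 2) (2 * (2 * a)) a := by
      have := ((hasDerivAt_pow 2 a).const_mul 2).const_add (κ ^ 2)
      simpa using this
    have h3 := (h2.sqrt hpos.ne').add ((hasDerivAt_id a).const_mul τ)
    convert! h3 using 1
    field_simp
  have h4 : HasDerivAt (fun a : ℝ => σ * a) σ a := by
    simpa using (hasDerivAt_id a).const_mul σ
  have h5 := h4.ofReal_comp.add (h1.ofReal_comp.mul_const Complex.I)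
  have e : (⟨σ, 2 * a / Real.sqrt (κ ^ 2 + 2 * a ^ 2) + τ⟩ : ℂ)
      = (σ : ℂ) + ((2 * a / Real.sqrt (κ ^ 2 + 2 * a ^ 2) + τ : ℝ) : ℂ) * Complex.I :=
    Complex.mk_eq_add_mul_I _ _
  rw [e]
  refine h5.congr_of_eventuallyEq (Eventually.of_forall fun b => ?_)
  exact Complex.mk_eq_add_mul_I _ _

theorem continuous_arc (κ σ τ : ℝ) : Continuous (arc κ σ τ) := by
  have : arc κ σ τ = fun a => ((σ * a : ℝ) : ℂ)
      + ((Real.sqrt (κ ^ 2 + 2 * a ^ 2) + τ * a : ℝ) : ℂ) * Complex.I := by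
    ext a; exact Complex.mk_eq_add_mul_I _ _
  rw [this]
  fun_prop

theorem norm_deriv_arc_le {κ σ τ a : ℝ} (hσ : σ ∈ ({1, -1} : Set ℝ))
    (hτ : τ ∈ ({1, -1} : Set ℝ)) (ha : 0 < a) : ‖deriv (arc κ σ τ) a‖ ≤ 4 := by
  rw [(hasDerivAt_arc (Or.inr ha.ne')).deriv]
  refine (Complex.norm_le_abs_re_add_abs_im _).trans ?_
  simp only
  rw [abs_eq_one_of_mem hσ]
  have h1 : |2 * a / Real.sqrt (κ ^ 2 + 2 * a ^ 2)| ≤ 2 := by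
    have h2 := abs_le_sqrt κ a
    rw [abs_of_pos ha] at h2
    rw [abs_of_nonneg (by positivity), div_le_iff₀ (by linarith)]
    linarith
  have := abs_add_le (2 * a / Real.sqrt (κ ^ 2 + 2 * a ^ 2)) τ
  rw [abs_eq_one_of_mem hτ] at this
  linarith

theorem measurable_arc (σ τ : ℝ) : Measurable (fun p : ℝ × ℝ => arc p.1 σ τ p.2) := by
  have : (fun p : ℝ × ℝ => arc p.1 σ τ p.2) = fun p => ((σ * p.2 : ℝ) : ℂ)
      + ((Real.sqrt (p.1 ^ 2 + 2 * p.2 ^ 2) + τ * p.2 : ℝ) : ℂ) * Complex.I := by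
    ext p; exact Complex.mk_eq_add_mul_I _ _
  rw [this]
  fun_prop

theorem aestronglyMeasurable_deriv_arc (σ τ : ℝ) :
    AEStronglyMeasurable (fun p : ℝ × ℝ => deriv (arc p.1 σ τ) p.2)
      (volume.restrict (univ ×ˢ Ioi 0)) := by
  have h : Measurable (fun p : ℝ × ℝ => ((σ : ℂ)
      + ((2 * p.2 / Real.sqrt (p.1 ^ 2 + 2 * p.2 ^ 2) + τ : ℝ) : ℂ) * Complex.I)) := by
    fun_prop
  refine h.aestronglyMeasurable.congr ?_
  filter_upwards [ae_restrict_mem (MeasurableSet.univ.prod measurableSet_Ioi)] with p hp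
  rw [(hasDerivAt_arc (Or.inr (ne_of_gt hp.2))).deriv]
  exact (Complex.mk_eq_add_mul_I _ _).symm

/-! ### Partial derivatives of functions on the closed half plane -/

theorem uniqueDiffOn_halfPlane : UniqueDiffOn ℝ ((univ : Set ℝ) ×ˢ Ici (0 : ℝ)) :=
  uniqueDiffOn_univ.prod (uniqueDiffOn_Ici 0)

/-- Partial derivatives are read off from the derivative within the closed half plane, so that the
one-sided `dy` at `y = 0` and the two-sided `dx` can be iterated in the same framework. -/
theorem hasDerivAt_dx_of_differentiableOn {v : ℝ → ℝ → ℝ → ℂ} {t : ℝ}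
    (hv : DifferentiableOn ℝ (fun q : ℝ × ℝ => v q.1 q.2 t) (univ ×ˢ Ici 0))
    (x : ℝ) {y : ℝ} (hy : 0 ≤ y) :
    HasDerivAt (fun s => v s y t)
      (fderivWithin ℝ (fun q : ℝ × ℝ => v q.1 q.2 t) (univ ×ˢ Ici 0) (x, y) (1, 0)) x := by
  have h1 := (hv (x, y) ⟨mem_univ _, hy⟩).hasFDerivWithinAt
  have h2 : HasDerivWithinAt (fun s : ℝ => (s, y)) ((1 : ℝ), (0 : ℝ)) univ x :=
    (((hasDerivAt_id x).prodMk (hasDerivAt_const x y))).hasDerivWithinAt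
  have h3 := h1.comp_hasDerivWithinAt (f := fun s : ℝ => (s, y)) x h2
    (fun s _ => ⟨mem_univ _, hy⟩)
  exact hasDerivWithinAt_univ.1 h3

theorem hasDerivWithinAt_dy_of_differentiableOn {v : ℝ → ℝ → ℝ → ℂ} {t : ℝ}
    (hv : DifferentiableOn ℝ (fun q : ℝ × ℝ => v q.1 q.2 t) (univ ×ˢ Ici 0))
    (x : ℝ) {y : ℝ} (hy : 0 ≤ y) :
    HasDerivWithinAt (fun s => v x s t)
      (fderivWithin ℝ (fun q : ℝ × ℝ => v q.1 q.2 t) (univ ×ˢ Ici 0) (x, y) (0, 1)) (Ici 0) y := by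
  have h1 := (hv (x, y) ⟨mem_univ _, hy⟩).hasFDerivWithinAt
  have h2 : HasDerivWithinAt (fun s : ℝ => (x, s)) ((0 : ℝ), (1 : ℝ)) (Ici 0) y :=
    (((hasDerivAt_const y x).prodMk (hasDerivAt_id y))).hasDerivWithinAt
  exact h1.comp_hasDerivWithinAt (f := fun s : ℝ => (x, s)) y h2
    (fun s hs => ⟨mem_univ _, hs⟩)

theorem contDiffOn_dx {v : ℝ → ℝ → ℝ → ℂ} {t : ℝ} {n : ℕ}
    (hv : ContDiffOn ℝ (n + 1 : ℕ) (fun q : ℝ × ℝ => v q.1 q.2 t) (univ ×ˢ Ici 0)) :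
    ContDiffOn ℝ n (fun q : ℝ × ℝ => dx v q.1 q.2 t) (univ ×ˢ Ici 0) := by
  have h1 := (hv.fderivWithin (m := (n : WithTop ℕ∞)) uniqueDiffOn_halfPlane
    (by norm_cast)).clm_apply (contDiffOn_const (c := ((1 : ℝ), (0 : ℝ))))
  refine h1.congr fun q hq => ?_
  exact (hasDerivAt_dx_of_differentiableOn
    (hv.differentiableOn (by norm_cast)) q.1 (y := q.2) hq.2).deriv

theorem contDiffOn_dy {v : ℝ → ℝ → ℝ → ℂ} {t : ℝ} {n : ℕ}
    (hv : ContDiffOn ℝ (n + 1 : ℕ) (fun q : ℝ × ℝ => v q.1 q.2 t) (univ ×ˢ Ici 0)) :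
    ContDiffOn ℝ n (fun q : ℝ × ℝ => dy v q.1 q.2 t) (univ ×ˢ Ici 0) := by
  have h1 := (hv.fderivWithin (m := (n : WithTop ℕ∞)) uniqueDiffOn_halfPlane
    (by norm_cast)).clm_apply (contDiffOn_const (c := ((0 : ℝ), (1 : ℝ))))
  refine h1.congr fun q hq => ?_
  exact (hasDerivWithinAt_dy_of_differentiableOn
    (hv.differentiableOn (by norm_cast)) q.1 (y := q.2) hq.2).derivWithin
      (uniqueDiffOn_Ici 0 _ hq.2)

theorem contDiffOn_iterate_dx {v : ℝ → ℝ → ℝ → ℂ} {t : ℝ} (i : ℕ) {n : ℕ}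
    (hv : ContDiffOn ℝ (n + i : ℕ) (fun q : ℝ × ℝ => v q.1 q.2 t) (univ ×ˢ Ici 0)) :
    ContDiffOn ℝ n (fun q : ℝ × ℝ => dx^[i] v q.1 q.2 t) (univ ×ˢ Ici 0) := by
  induction i generalizing n with
  | zero => simpa using hv
  | succ i ih =>
    simp only [Function.iterate_succ_apply']
    exact contDiffOn_dx (ih (n := n + 1) (by convert! hv using 2; ring))

theorem contDiffOn_iterate_dy {v : ℝ → ℝ → ℝ → ℂ} {t : ℝ} (j : ℕ) {n : ℕ}
    (hv : ContDiffOn ℝ (n + j : ℕ) (fun q : ℝ × ℝ => v q.1 q.2 t) (univ ×ˢ Ici 0)) :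
    ContDiffOn ℝ n (fun q : ℝ × ℝ => dy^[j] v q.1 q.2 t) (univ ×ˢ Ici 0) := by
  induction j generalizing n with
  | zero => simpa using hv
  | succ j ih =>
    simp only [Function.iterate_succ_apply']
    exact contDiffOn_dy (ih (n := n + 1) (by convert! hv using 2; ring))

theorem SmoothDecaying.differentiableOn {T m : ℝ} {u : ℝ → ℝ → ℝ → ℂ}
    (hu : SmoothDecaying T m u) {i j : ℕ} (hij : i + j < 4) {t : ℝ} (ht : t ∈ Icc 0 T) :
    DifferentiableOn ℝ (fun q : ℝ × ℝ => dx^[i] (dy^[j] u) q.1 q.2 t) (univ ×ˢ Ici 0) := by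
  have h : ContDiffOn ℝ (1 : ℕ) (fun q : ℝ × ℝ => dx^[i] (dy^[j] u) q.1 q.2 t)
      (univ ×ˢ Ici 0) := by
    refine contDiffOn_iterate_dx i (contDiffOn_iterate_dy j ((hu.contDiffOn t ht).of_le ?_))
    norm_cast
    omega
  exact h.differentiableOn (by norm_num)

theorem SmoothDecaying.hasDerivAt_x {T m : ℝ} {u : ℝ → ℝ → ℝ → ℂ}
    (hu : SmoothDecaying T m u) {i j : ℕ} (hij : i + j < 4) {t : ℝ} (ht : t ∈ Icc 0 T)
    (x : ℝ) {y : ℝ} (hy : 0 ≤ y) :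
    HasDerivAt (fun s => dx^[i] (dy^[j] u) s y t) (dx^[i + 1] (dy^[j] u) x y t) x := by
  have h := hasDerivAt_dx_of_differentiableOn (hu.differentiableOn hij ht) x hy
  rw [Function.iterate_succ_apply']
  exact h.differentiableAt.hasDerivAt

theorem SmoothDecaying.hasDerivWithinAt_y {T m : ℝ} {u : ℝ → ℝ → ℝ → ℂ}
    (hu : SmoothDecaying T m u) {j : ℕ} (hj : j < 4) {t : ℝ} (ht : t ∈ Icc 0 T)
    (x : ℝ) {y : ℝ} (hy : 0 ≤ y) :
    HasDerivWithinAt (fun s => dy^[j] u x s t) (dy^[j + 1] u x y t) (Ici 0) y := by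
  have h := hasDerivWithinAt_dy_of_differentiableOn
    (hu.differentiableOn (i := 0) (j := j) (by simpa using hj) ht) x hy
  rw [Function.iterate_succ_apply']
  exact h.differentiableWithinAt.hasDerivWithinAt

/-! ### Decaying continuous functions on the closed half plane -/

/-- Continuity on the closed half plane and decay of order `m`. -/
structure IsDecaying (C m : ℝ) (w : ℝ → ℝ → ℂ) : Prop where
  continuousOn : ContinuousOn (fun q : ℝ × ℝ => w q.1 q.2) (univ ×ˢ Ici 0)
  bound : ∀ x : ℝ, ∀ y : ℝ, 0 ≤ y → ‖w x y‖ ≤ C * (1 + |x| + |y|) ^ (-m)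

theorem SmoothDecaying.exists_isDecaying {T m : ℝ} {u : ℝ → ℝ → ℝ → ℂ}
    (hu : SmoothDecaying T m u) :
    ∃ C : ℝ, 0 ≤ C ∧ ∀ i j : ℕ, i + j ≤ 4 → ∀ t ∈ Icc 0 T,
      IsDecaying C m (fun x y => dx^[i] (dy^[j] u) x y t) := by
  obtain ⟨C, hC⟩ := hu.decay
  refine ⟨max C 0, le_max_right _ _, fun i j hij t ht => ⟨?_, fun x y hy => ?_⟩⟩
  · have := hu.continuousOn i j hij
    exact this.comp (f := fun q : ℝ × ℝ => (q.1, q.2, t)) (by fun_prop)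
      (fun q hq => ⟨mem_univ _, hq.2, ht⟩)
  · refine (hC i j hij x y hy t ht).trans ?_
    gcongr
    exact le_max_left _ _

/-! ### Integrability of the decay weights. -/

theorem volume_restrict_halfPlane :
    (volume : Measure (ℝ × ℝ)).restrict (univ ×ˢ Ioi 0)
      = (volume : Measure ℝ).prod (volume.restrict (Ioi 0)) := by
  rw [Measure.volume_eq_prod, ← Measure.prod_restrict, Measure.restrict_univ]

theorem rpow_neg_le_norm {m : ℝ} (hm : 0 ≤ m) (q : ℝ × ℝ) :
    (1 + |q.1| + |q.2|) ^ (-m) ≤ (1 + ‖q‖) ^ (-m) := by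
  apply Real.rpow_le_rpow_of_nonpos (by positivity) _ (by linarith)
  have : ‖q‖ ≤ |q.1| + |q.2| := by
    rw [Prod.norm_def]
    simp only [Real.norm_eq_abs]
    exact max_le (by linarith [abs_nonneg q.2]) (by linarith [abs_nonneg q.1])
  linarith

theorem integrable_decay {m : ℝ} (hm : 2 < m) :
    Integrable (fun q : ℝ × ℝ => (1 + |q.1| + |q.2|) ^ (-m)) := by
  have h : Integrable (fun q : ℝ × ℝ => (1 + ‖q‖) ^ (-m)) :=
    integrable_one_add_norm (by simpa using hm)
  refine h.mono' (Measurable.aestronglyMeasurable (by fun_prop)) (Eventually.of_forall fun q => ?_)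
  rw [Real.norm_of_nonneg (by positivity)]
  exact rpow_neg_le_norm (by linarith) q

/-- The factor `|y|` costs one order of decay in the plane, whence the threshold `3`. It is what
makes the half space transform differentiable and Lipschitz in `l`. -/
theorem integrable_decay_weight {m : ℝ} (hm : 3 < m) :
    Integrable (fun q : ℝ × ℝ => |q.2| * (1 + |q.1| + |q.2|) ^ (-m)) := by
  have h := integrable_decay (m := m - 1) (by linarith)
  refine h.mono' (Measurable.aestronglyMeasurable (by fun_prop)) (Eventually.of_forall fun q => ?_)
  rw [Real.norm_of_nonneg (by positivity)]
  have hp : 0 < 1 + |q.1| + |q.2| := by positivity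
  rw [show -(m - 1) = 1 + -m by ring, Real.rpow_add hp, Real.rpow_one]
  gcongr
  linarith [abs_nonneg q.1]

theorem integrable_decay_line {m : ℝ} (hm : 1 < m) :
    Integrable (fun x : ℝ => (1 + |x|) ^ (-m)) := by
  simpa using integrable_one_add_norm (E := ℝ) (μ := volume) (r := m) (by simpa using hm)

section Decaying

variable {C m : ℝ} {w : ℝ → ℝ → ℂ}

theorem IsDecaying.aestronglyMeasurable (hw : IsDecaying C m w) :
    AEStronglyMeasurable (fun q : ℝ × ℝ => w q.1 q.2) (volume.restrict (univ ×ˢ Ioi 0)) :=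
  (hw.continuousOn.mono (prod_mono le_rfl Ioi_subset_Ici_self)).aestronglyMeasurable
    (MeasurableSet.univ.prod measurableSet_Ioi)

theorem IsDecaying.nonneg (hw : IsDecaying C m w) : 0 ≤ C := by
  have := (norm_nonneg _).trans (hw.bound 0 0 le_rfl)
  simpa using this

theorem IsDecaying.bound_x (hw : IsDecaying C m w) (hm : 0 ≤ m) (x : ℝ) {y : ℝ} (hy : 0 ≤ y) :
    ‖w x y‖ ≤ C * (1 + |x|) ^ (-m) := by
  refine (hw.bound x y hy).trans ?_
  have := hw.nonneg
  gcongr ?_ * ?_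
  apply Real.rpow_le_rpow_of_nonpos (by positivity) _ (by linarith)
  linarith [abs_nonneg y]

theorem IsDecaying.bound_y (hw : IsDecaying C m w) (hm : 0 ≤ m) (x : ℝ) {y : ℝ} (hy : 0 ≤ y) :
    ‖w x y‖ ≤ C * (1 + |y|) ^ (-m) := by
  refine (hw.bound x y hy).trans ?_
  have := hw.nonneg
  gcongr ?_ * ?_
  apply Real.rpow_le_rpow_of_nonpos (by positivity) _ (by linarith)
  linarith [abs_nonneg x]

theorem IsDecaying.continuous_x (hw : IsDecaying C m w) {y : ℝ} (hy : 0 ≤ y) :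
    Continuous (fun x => w x y) := by
  rw [← continuousOn_univ]
  exact hw.continuousOn.comp (f := fun x : ℝ => (x, y)) (by fun_prop) (fun x _ => ⟨mem_univ _, hy⟩)

theorem IsDecaying.continuousOn_y (hw : IsDecaying C m w) (x : ℝ) :
    ContinuousOn (fun y => w x y) (Ici 0) :=
  hw.continuousOn.comp (f := fun y : ℝ => (x, y)) (by fun_prop) (fun y hy => ⟨mem_univ _, hy⟩)

/-! ### Bounds, continuity and holomorphy of the half space transform. -/

theorem norm_exp_halfFourier_le (κ x : ℝ) {y : ℝ} (hy : 0 ≤ y) {l : ℂ} (hl : l.im ≤ 0) :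
    ‖Complex.exp (-Complex.I * x * κ - Complex.I * y * l)‖ ≤ 1 := by
  rw [Complex.norm_exp]
  simp
  nlinarith

theorem norm_exp_fourierX (κ x : ℝ) : ‖Complex.exp (-Complex.I * x * κ)‖ = 1 := by
  rw [Complex.norm_exp]
  simp

theorem IsDecaying.integrable_x (hw : IsDecaying C m w) (hm : 1 < m) (κ : ℝ) {y : ℝ}
    (hy : 0 ≤ y) : Integrable (fun x : ℝ => Complex.exp (-Complex.I * x * κ) * w x y) := by
  have := hw.continuous_x hy
  refine ((integrable_decay_line hm).const_mul C).mono'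
    (Continuous.aestronglyMeasurable (by fun_prop)) (Eventually.of_forall fun x => ?_)
  rw [norm_mul, norm_exp_fourierX, one_mul]
  exact hw.bound_x (by linarith) x hy

theorem IsDecaying.integrable_y (hw : IsDecaying C m w) (hm : 1 < m) (x : ℝ) {l : ℂ}
    (hl : l.im ≤ 0) :
    IntegrableOn (fun y : ℝ => Complex.exp (-Complex.I * y * l) * w x y) (Ioi 0) := by
  have h := (hw.continuousOn_y x).mono Ioi_subset_Ici_self
  refine ((integrable_decay_line hm).const_mul C).integrableOn.mono'
    (ContinuousOn.aestronglyMeasurable (by fun_prop) measurableSet_Ioi) ?_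
  filter_upwards [ae_restrict_mem measurableSet_Ioi] with y hy
  have h1 := norm_exp_halfFourier_le 0 0 hy.le hl
  simp only [Complex.ofReal_zero, mul_zero, zero_sub] at h1
  rw [norm_mul, ← one_mul (C * _)]
  have := hw.bound_y (by linarith) x hy.le
  refine mul_le_mul ?_ this (norm_nonneg _) zero_le_one
  simpa using h1

theorem IsDecaying.integrable_prod (hw : IsDecaying C m w) (hm : 2 < m) (κ : ℝ) {l : ℂ}
    (hl : l.im ≤ 0) :
    Integrable (fun q : ℝ × ℝ =>
      Complex.exp (-Complex.I * q.1 * κ - Complex.I * q.2 * l) * w q.1 q.2)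
      (volume.restrict (univ ×ˢ Ioi 0)) := by
  refine ((integrable_decay hm).const_mul C).integrableOn.mono'
    ((Continuous.aestronglyMeasurable (by fun_prop)).mul hw.aestronglyMeasurable) ?_
  filter_upwards [ae_restrict_mem (MeasurableSet.univ.prod measurableSet_Ioi)] with q hq
  have hq2 : 0 ≤ q.2 := le_of_lt hq.2
  rw [norm_mul, ← one_mul (C * _)]
  exact mul_le_mul (norm_exp_halfFourier_le κ q.1 hq2 hl) (hw.bound _ _ hq2) (norm_nonneg _)
    zero_le_one

theorem IsDecaying.halfFourier_eq (hw : IsDecaying C m w) (hm : 2 < m) (κ : ℝ) {l : ℂ}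
    (hl : l.im ≤ 0) :
    halfFourier w κ l = ∫ q in (univ : Set ℝ) ×ˢ Ioi (0 : ℝ),
      Complex.exp (-Complex.I * q.1 * κ - Complex.I * q.2 * l) * w q.1 q.2 := by
  have h := hw.integrable_prod hm κ hl
  rw [volume_restrict_halfPlane] at h ⊢
  rw [integral_prod _ h]
  rfl

theorem IsDecaying.halfFourier_eq_swap (hw : IsDecaying C m w) (hm : 2 < m) (κ : ℝ) {l : ℂ}
    (hl : l.im ≤ 0) :
    halfFourier w κ l = ∫ y in Ioi (0 : ℝ), ∫ x : ℝ,
      Complex.exp (-Complex.I * x * κ - Complex.I * y * l) * w x y := by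
  have h := hw.integrable_prod hm κ hl
  rw [volume_restrict_halfPlane] at h
  exact integral_integral_swap h

theorem IsDecaying.norm_halfFourier_le (hw : IsDecaying C m w) (hm : 2 < m) (κ : ℝ) {l : ℂ}
    (hl : l.im ≤ 0) :
    ‖halfFourier w κ l‖ ≤ C * ∫ q : ℝ × ℝ, (1 + |q.1| + |q.2|) ^ (-m) := by
  rw [hw.halfFourier_eq hm κ hl, ← integral_const_mul]
  have h1 := (integrable_decay hm).const_mul C
  refine (norm_integral_le_of_norm_le h1.integrableOn ?_).trans
    (setIntegral_le_integral h1 (Eventually.of_forall fun q => ?_))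
  · filter_upwards [ae_restrict_mem (MeasurableSet.univ.prod measurableSet_Ioi)] with q hq
    have hq2 : 0 ≤ q.2 := le_of_lt hq.2
    rw [norm_mul, ← one_mul (C * _)]
    exact mul_le_mul (norm_exp_halfFourier_le κ q.1 hq2 hl) (hw.bound _ _ hq2) (norm_nonneg _)
      zero_le_one
  · have := hw.nonneg
    simp only [Pi.zero_apply]
    positivity

/-- On the convex left half plane the derivative of `exp` has modulus at most one, so the mean value
inequality applies. -/
theorem norm_exp_sub_exp_le {a b : ℂ} (ha : a.re ≤ 0) (hb : b.re ≤ 0) :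
    ‖Complex.exp a - Complex.exp b‖ ≤ ‖a - b‖ := by
  have h : Convex ℝ {z : ℂ | z.re ≤ 0} := convex_halfSpace_re_le 0
  have := h.norm_image_sub_le_of_norm_hasDerivWithin_le (C := 1) (f := Complex.exp)
    (f' := Complex.exp) (x := b) (y := a)
    (fun z _ => (Complex.hasDerivAt_exp z).hasDerivWithinAt)
    (fun z hz => by rw [Complex.norm_exp]; exact Real.exp_le_one_iff.2 hz) hb ha
  simpa using this

/-- The Lipschitz bound holds up to the real axis. It later absorbs the denominator `ν - l` in
`remainder`. -/
theorem IsDecaying.norm_halfFourier_sub_le (hw : IsDecaying C m w) (hm : 3 < m) (κ : ℝ) {l l' : ℂ}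
    (hl : l.im ≤ 0) (hl' : l'.im ≤ 0) :
    ‖halfFourier w κ l - halfFourier w κ l'‖
      ≤ (C * ∫ q : ℝ × ℝ, |q.2| * (1 + |q.1| + |q.2|) ^ (-m)) * ‖l - l'‖ := by
  rw [hw.halfFourier_eq (by linarith) κ hl, hw.halfFourier_eq (by linarith) κ hl',
    ← integral_sub (hw.integrable_prod (by linarith) κ hl)
      (hw.integrable_prod (by linarith) κ hl'), ← integral_const_mul, ← integral_mul_const]
  have h1 := ((integrable_decay_weight hm).const_mul C).mul_const ‖l - l'‖
  refine (norm_integral_le_of_norm_le h1.integrableOn ?_).trans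
    (setIntegral_le_integral h1 (Eventually.of_forall fun q => ?_))
  · filter_upwards [ae_restrict_mem (MeasurableSet.univ.prod measurableSet_Ioi)] with q hq
    have hq2 : 0 ≤ q.2 := le_of_lt hq.2
    rw [← sub_mul, norm_mul]
    have h2 : ‖Complex.exp (-Complex.I * q.1 * κ - Complex.I * q.2 * l)
        - Complex.exp (-Complex.I * q.1 * κ - Complex.I * q.2 * l')‖ ≤ |q.2| * ‖l - l'‖ := by
      refine (norm_exp_sub_exp_le ?_ ?_).trans ?_
      · simp; nlinarith
      · simp; nlinarith
      · rw [show (-Complex.I * q.1 * κ - Complex.I * q.2 * l)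
          - (-Complex.I * q.1 * κ - Complex.I * q.2 * l') = -Complex.I * q.2 * (l - l') by ring]
        simp
    calc _ ≤ (|q.2| * ‖l - l'‖) * (C * (1 + |q.1| + |q.2|) ^ (-m)) :=
          mul_le_mul h2 (hw.bound _ _ hq2) (norm_nonneg _) (by positivity)
      _ = _ := by ring
  · have := hw.nonneg
    simp only [Pi.zero_apply]
    positivity

theorem IsDecaying.differentiableAt_halfFourier (hw : IsDecaying C m w) (hm : 3 < m) (κ : ℝ)
    {l : ℂ} (hl : l.im < 0) : DifferentiableAt ℂ (halfFourier w κ) l := by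
  have hs : {z : ℂ | z.im < 0} ∈ 𝓝 l :=
    (isOpen_lt Complex.continuous_im continuous_const).mem_nhds hl
  have key := hasDerivAt_integral_of_dominated_loc_of_deriv_le
    (μ := (volume : Measure (ℝ × ℝ)).restrict (univ ×ˢ Ioi 0))
    (F := fun (z : ℂ) (q : ℝ × ℝ) =>
      Complex.exp (-Complex.I * q.1 * κ - Complex.I * q.2 * z) * w q.1 q.2)
    (F' := fun (z : ℂ) (q : ℝ × ℝ) =>
      Complex.exp (-Complex.I * q.1 * κ - Complex.I * q.2 * z) * (-(Complex.I * q.2)) * w q.1 q.2)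
    (bound := fun q => C * (|q.2| * (1 + |q.1| + |q.2|) ^ (-m)))
    (x₀ := l) hs
    (Eventually.of_forall fun z =>
      (Continuous.aestronglyMeasurable (by fun_prop)).mul hw.aestronglyMeasurable)
    (hw.integrable_prod (by linarith) κ hl.le)
    ((Continuous.aestronglyMeasurable (by fun_prop)).mul hw.aestronglyMeasurable)
    (by
      filter_upwards [ae_restrict_mem (MeasurableSet.univ.prod measurableSet_Ioi)] with q hq z hz
      have hq2 : 0 ≤ q.2 := le_of_lt hq.2
      have h1 := norm_exp_halfFourier_le κ q.1 hq2 (le_of_lt hz)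
      rw [norm_mul, norm_mul]
      have h2 : ‖-(Complex.I * (q.2 : ℂ))‖ = |q.2| := by simp
      rw [h2]
      calc _ ≤ 1 * |q.2| * (C * (1 + |q.1| + |q.2|) ^ (-m)) := by
            gcongr
            exact hw.bound _ _ hq2
        _ = _ := by ring)
    ((integrable_decay_weight hm).const_mul C).integrableOn
    (by
      refine Eventually.of_forall fun q z _ => ?_
      refine HasDerivAt.mul_const ?_ _
      refine HasDerivAt.cexp ?_
      simpa using ((hasDerivAt_id z).const_mul (Complex.I * (q.2 : ℂ))).const_sub
        (-Complex.I * q.1 * κ))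
  refine (key.2.congr_of_eventuallyEq ?_).differentiableAt
  filter_upwards [hs] with z hz
  exact hw.halfFourier_eq (by linarith) κ (le_of_lt hz)

/-! ### Transforms of derivatives -/

theorem fourier_deriv_line {f f' : ℝ → ℂ} (κ : ℝ) (hf : ∀ x, HasDerivAt f (f' x) x)
    (h : Integrable (fun x : ℝ => Complex.exp (-Complex.I * x * κ) * f x))
    (h' : Integrable (fun x : ℝ => Complex.exp (-Complex.I * x * κ) * f' x)) :
    ∫ x : ℝ, Complex.exp (-Complex.I * x * κ) * f' x
      = Complex.I * κ * ∫ x : ℝ, Complex.exp (-Complex.I * x * κ) * f x := by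
  have hE : ∀ x : ℝ, HasDerivAt (fun x : ℝ => Complex.exp (-Complex.I * x * κ))
      (-(Complex.I * κ) * Complex.exp (-Complex.I * x * κ)) x := fun x => by
    have h1 : HasDerivAt (fun x : ℝ => -Complex.I * (x : ℂ) * κ) (-(Complex.I * κ)) x := by
      have := ((hasDerivAt_id x).ofReal_comp.const_mul (-Complex.I)).mul_const (κ : ℂ)
      simpa using this
    have := h1.cexp
    rwa [mul_comm] at this
  have h2 := h.const_mul (-(Complex.I * κ))
  have key := integral_eq_zero_of_hasDerivAt_of_integrable
    (fun x => (hE x).mul (hf x))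
    (by
      refine (h2.add h').congr (Eventually.of_forall fun x => ?_)
      simp only [Pi.add_apply]; ring) h
  have h3 : ∫ x : ℝ, (-(Complex.I * κ) * Complex.exp (-Complex.I * x * κ) * f x
      + Complex.exp (-Complex.I * x * κ) * f' x)
      = -(Complex.I * κ) * (∫ x : ℝ, Complex.exp (-Complex.I * x * κ) * f x)
        + ∫ x : ℝ, Complex.exp (-Complex.I * x * κ) * f' x := by
    rw [← integral_const_mul, ← integral_add h2 h']
    congr 1 with x
    ring
  rw [h3] at key
  linear_combination key

theorem IsDecaying.halfFourier_dx {C' : ℝ} {w' : ℝ → ℝ → ℂ} (hw : IsDecaying C m w)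
    (hw' : IsDecaying C' m w') (hm : 2 < m)
    (hd : ∀ x y : ℝ, 0 ≤ y → HasDerivAt (fun s => w s y) (w' x y) x) (κ : ℝ) {l : ℂ}
    (hl : l.im ≤ 0) : halfFourier w' κ l = Complex.I * κ * halfFourier w κ l := by
  rw [hw.halfFourier_eq_swap hm κ hl, hw'.halfFourier_eq_swap hm κ hl, ← integral_const_mul]
  refine setIntegral_congr_fun measurableSet_Ioi fun y hy => ?_
  have hy' : 0 ≤ y := le_of_lt hy
  have e : ∀ v : ℝ → ℝ → ℂ,
      ∫ x : ℝ, Complex.exp (-Complex.I * x * κ - Complex.I * y * l) * v x y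
      = Complex.exp (-Complex.I * y * l) *
        ∫ x : ℝ, Complex.exp (-Complex.I * x * κ) * v x y := fun v => by
    rw [← integral_const_mul]
    congr 1 with x
    rw [← mul_assoc, ← Complex.exp_add]
    congr 2
    ring
  simp only [e]
  rw [fourier_deriv_line κ (fun x => hd x y hy') (hw.integrable_x (by linarith) κ hy')
    (hw'.integrable_x (by linarith) κ hy')]
  ring

/-- Integration by parts. The value at infinity vanishes because the product and its derivative are
both integrable on the half line. -/
theorem fourier_deriv_halfLine {f f' : ℝ → ℂ} (l : ℂ) (hc : ContinuousOn f (Ici 0))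
    (hf : ∀ y ∈ Ioi (0 : ℝ), HasDerivAt f (f' y) y)
    (h : IntegrableOn (fun y : ℝ => Complex.exp (-Complex.I * y * l) * f y) (Ioi 0))
    (h' : IntegrableOn (fun y : ℝ => Complex.exp (-Complex.I * y * l) * f' y) (Ioi 0)) :
    ∫ y in Ioi (0 : ℝ), Complex.exp (-Complex.I * y * l) * f' y
      = -f 0 + Complex.I * l * ∫ y in Ioi (0 : ℝ), Complex.exp (-Complex.I * y * l) * f y := by
  have hE : ∀ x : ℝ, HasDerivAt (fun x : ℝ => Complex.exp (-Complex.I * x * l))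
      (-(Complex.I * l) * Complex.exp (-Complex.I * x * l)) x := fun x => by
    have h1 : HasDerivAt (fun x : ℝ => -Complex.I * (x : ℂ) * l) (-(Complex.I * l)) x := by
      have := ((hasDerivAt_id x).ofReal_comp.const_mul (-Complex.I)).mul_const l
      simpa using this
    have := h1.cexp
    rwa [mul_comm] at this
  have h2 := h.const_mul (-(Complex.I * l))
  have hsum : IntegrableOn (fun y : ℝ => -(Complex.I * l) * Complex.exp (-Complex.I * y * l) * f y
      + Complex.exp (-Complex.I * y * l) * f' y) (Ioi 0) := by
    refine (h2.add h').congr (Eventually.of_forall fun x => ?_)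
    simp only [Pi.add_apply]; ring
  have hcont : ContinuousWithinAt (fun y : ℝ => Complex.exp (-Complex.I * y * l) * f y)
      (Ici 0) 0 :=
    ContinuousWithinAt.mul (hE 0).continuousAt.continuousWithinAt (hc 0 self_mem_Ici)
  have hlim := tendsto_zero_of_hasDerivAt_of_integrableOn_Ioi
    (fun x hx => (hE x).mul (hf x hx)) hsum h
  have key := integral_Ioi_of_hasDerivAt_of_tendsto hcont
    (fun x hx => (hE x).mul (hf x hx)) hsum hlim
  have h3 : ∫ x in Ioi (0 : ℝ), (-(Complex.I * l) * Complex.exp (-Complex.I * x * l) * f x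
      + Complex.exp (-Complex.I * x * l) * f' x)
      = -(Complex.I * l) * (∫ x in Ioi (0 : ℝ), Complex.exp (-Complex.I * x * l) * f x)
        + ∫ x in Ioi (0 : ℝ), Complex.exp (-Complex.I * x * l) * f' x := by
    rw [← integral_const_mul, ← integral_add h2 h']
    congr 1 with x
    ring
  rw [h3] at key
  simp only [Complex.ofReal_zero, mul_zero, zero_mul, Complex.exp_zero, one_mul, zero_sub] at key
  linear_combination key

theorem IsDecaying.halfFourier_dy {C' : ℝ} {w' : ℝ → ℝ → ℂ} (hw : IsDecaying C m w)
    (hw' : IsDecaying C' m w') (hm : 2 < m)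
    (hd : ∀ x y : ℝ, 0 ≤ y → HasDerivWithinAt (fun s => w x s) (w' x y) (Ici 0) y) (κ : ℝ) {l : ℂ}
    (hl : l.im ≤ 0) :
    halfFourier w' κ l = -(∫ x : ℝ, Complex.exp (-Complex.I * x * κ) * w x 0)
      + Complex.I * l * halfFourier w κ l := by
  have e : ∀ (v : ℝ → ℝ → ℂ) (x : ℝ),
      ∫ y in Ioi (0 : ℝ), Complex.exp (-Complex.I * x * κ - Complex.I * y * l) * v x y
      = Complex.exp (-Complex.I * x * κ) *
        ∫ y in Ioi (0 : ℝ), Complex.exp (-Complex.I * y * l) * v x y := fun v x => by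
    rw [← integral_const_mul]
    congr 1 with y
    rw [← mul_assoc, ← Complex.exp_add]
    congr 2
    ring
  have hint := hw.integrable_prod hm κ hl
  rw [volume_restrict_halfPlane] at hint
  have hint2 : Integrable (fun x : ℝ => ∫ y in Ioi (0 : ℝ),
      Complex.exp (-Complex.I * x * κ - Complex.I * y * l) * w x y) := hint.integral_prod_left
  have hint3 : Integrable (fun x : ℝ => -(Complex.exp (-Complex.I * x * κ) * w x 0)) :=
    (hw.integrable_x (by linarith) κ le_rfl).neg
  unfold halfFourier
  rw [← integral_const_mul, ← integral_neg, ← integral_add hint3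
    (hint2.const_mul _)]
  congr 1 with x
  rw [e, e, fourier_deriv_halfLine l (hw.continuousOn_y x)
    (fun y hy => (hd x y (le_of_lt hy)).hasDerivAt (Ici_mem_nhds hy))
    (hw.integrable_y (by linarith) x hl) (hw'.integrable_y (by linarith) x hl)]
  ring

end Decaying

/-! ### The global relation -/

theorem IsDecaying.add {C₁ C₂ m : ℝ} {w₁ w₂ : ℝ → ℝ → ℂ} (h₁ : IsDecaying C₁ m w₁)
    (h₂ : IsDecaying C₂ m w₂) : IsDecaying (C₁ + C₂) m (fun x y => w₁ x y + w₂ x y) where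
  continuousOn := h₁.continuousOn.add h₂.continuousOn
  bound x y hy := by
    rw [add_mul]
    exact (norm_add_le _ _).trans (add_le_add (h₁.bound x y hy) (h₂.bound x y hy))

theorem IsDecaying.const_mul {C m : ℝ} {w : ℝ → ℝ → ℂ} (h : IsDecaying C m w) (c : ℂ) :
    IsDecaying (‖c‖ * C) m (fun x y => c * w x y) where
  continuousOn := h.continuousOn.const_mul c
  bound x y hy := by
    rw [norm_mul, mul_assoc]
    exact mul_le_mul_of_nonneg_left (h.bound x y hy) (norm_nonneg c)

theorem IsDecaying.halfFourier_add {C₁ C₂ m : ℝ} {w₁ w₂ : ℝ → ℝ → ℂ} (h₁ : IsDecaying C₁ m w₁)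
    (h₂ : IsDecaying C₂ m w₂) (hm : 2 < m) (κ : ℝ) {l : ℂ} (hl : l.im ≤ 0) :
    halfFourier (fun x y => w₁ x y + w₂ x y) κ l = halfFourier w₁ κ l + halfFourier w₂ κ l := by
  rw [(h₁.add h₂).halfFourier_eq hm κ hl, h₁.halfFourier_eq hm κ hl, h₂.halfFourier_eq hm κ hl,
    ← integral_add (h₁.integrable_prod hm κ hl) (h₂.integrable_prod hm κ hl)]
  congr 1 with q
  ring

theorem halfFourier_const_mul (w : ℝ → ℝ → ℂ) (c : ℂ) (κ : ℝ) (l : ℂ) :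
    halfFourier (fun x y => c * w x y) κ l = c * halfFourier w κ l := by
  unfold halfFourier
  rw [← integral_const_mul]
  congr 1 with x
  rw [← integral_const_mul]
  congr 1 with y
  ring

/-- The trace of `∂_y^j u` on the boundary line. -/
def trace (u : ℝ → ℝ → ℝ → ℂ) (j : ℕ) : ℝ → ℝ → ℂ := fun x t => dy^[j] u x 0 t

/-- The contribution of the boundary values to the global relation. -/
def boundaryTerm (u : ℝ → ℝ → ℝ → ℂ) (κ : ℝ) (l : ℂ) (t : ℝ) : ℂ :=
  tTransform (trace u 3) κ (((κ : ℂ) ^ 2 + l ^ 2) ^ 2) t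
    + Complex.I * l * tTransform (trace u 2) κ (((κ : ℂ) ^ 2 + l ^ 2) ^ 2) t
    - (l ^ 2 + 2 * (κ : ℂ) ^ 2) * (tTransform (trace u 1) κ (((κ : ℂ) ^ 2 + l ^ 2) ^ 2) t
      + Complex.I * l * tTransform (trace u 0) κ (((κ : ℂ) ^ 2 + l ^ 2) ^ 2) t)

section

variable {T m : ℝ} {u : ℝ → ℝ → ℝ → ℂ}

theorem SmoothDecaying.exists_bilaplacian_isDecaying (hu : SmoothDecaying T m u) :
    ∃ C : ℝ, ∀ t ∈ Icc 0 T, IsDecaying C m (fun x y => bilaplacian u x y t) := by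
  obtain ⟨C, -, hC⟩ := hu.exists_isDecaying
  exact ⟨_, fun t ht => ((hC 4 0 (by norm_num) t ht).add
    ((hC 2 2 (by norm_num) t ht).const_mul 2)).add (hC 0 4 (by norm_num) t ht)⟩

theorem SmoothDecaying.halfFourier_bilaplacian (hu : SmoothDecaying T m u) (hm : 2 < m)
    {t : ℝ} (ht : t ∈ Icc 0 T) (κ : ℝ) {l : ℂ} (hl : l.im ≤ 0) :
    halfFourier (fun x y => bilaplacian u x y t) κ l
      = ((κ : ℂ) ^ 2 + l ^ 2) ^ 2 * halfFourier (fun x y => u x y t) κ l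
        - (fourierX (trace u 3) κ t + Complex.I * l * fourierX (trace u 2) κ t
          - (l ^ 2 + 2 * (κ : ℂ) ^ 2) * (fourierX (trace u 1) κ t
            + Complex.I * l * fourierX (trace u 0) κ t)) := by
  obtain ⟨C, -, hC⟩ := hu.exists_isDecaying
  have hX : ∀ i j : ℕ, i + j < 4 →
      halfFourier (fun x y => dx^[i + 1] (dy^[j] u) x y t) κ l
        = Complex.I * κ * halfFourier (fun x y => dx^[i] (dy^[j] u) x y t) κ l := fun i j hij =>
    (hC i j hij.le t ht).halfFourier_dx (hC (i + 1) j (by omega) t ht) hm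
      (fun x y hy => hu.hasDerivAt_x hij ht x hy) κ hl
  have hY : ∀ j : ℕ, j < 4 →
      halfFourier (fun x y => dy^[j + 1] u x y t) κ l
        = -fourierX (trace u j) κ t
          + Complex.I * l * halfFourier (fun x y => dy^[j] u x y t) κ l := fun j hj =>
    (hC 0 j (by omega) t ht).halfFourier_dy (hC 0 (j + 1) (by omega) t ht) hm
      (fun x y hy => hu.hasDerivWithinAt_y hj ht x hy) κ hl
  have h4 := ((hC 4 0 (by norm_num) t ht).add ((hC 2 2 (by norm_num) t ht).const_mul 2))
  have e : halfFourier (fun x y => bilaplacian u x y t) κ l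
      = halfFourier (fun x y => dx^[4] (dy^[0] u) x y t) κ l
        + 2 * halfFourier (fun x y => dx^[2] (dy^[2] u) x y t) κ l
        + halfFourier (fun x y => dy^[4] u x y t) κ l := by
    have h5 := h4.halfFourier_add (hC 0 4 (by norm_num) t ht) hm κ hl
    rw [(hC 4 0 (by norm_num) t ht).halfFourier_add ((hC 2 2 (by norm_num) t ht).const_mul 2)
      hm κ hl, halfFourier_const_mul] at h5
    exact h5
  have x1 := hX 0 0 (by norm_num)
  have x2 := hX 1 0 (by norm_num)
  have x3 := hX 2 0 (by norm_num)
  have x4 := hX 3 0 (by norm_num)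
  have z1 := hX 0 2 (by norm_num)
  have z2 := hX 1 2 (by norm_num)
  have y1 := hY 0 (by norm_num)
  have y2 := hY 1 (by norm_num)
  have y3 := hY 2 (by norm_num)
  have y4 := hY 3 (by norm_num)
  simp only [zero_add, Nat.reduceAdd] at x1 x2 x3 x4 z1 z2 y1 y2 y3 y4
  -- The tangential derivatives are removed before the normal ones, so that the mixed term is
  -- reduced to pure `y`-derivatives, whose integrations by parts produce the traces.
  rw [e, x4, x3, x2, x1, z2, z1]
  simp only [Function.iterate_zero, id_eq] at y1 ⊢
  rw [y4, y3, y2, y1]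
  have hI : Complex.I ^ 2 = -1 := Complex.I_sq
  have hI3 : Complex.I ^ 3 = -Complex.I := by rw [pow_succ, hI]; ring
  have hI4 : Complex.I ^ 4 = 1 := Complex.I_pow_four
  ring_nf
  simp only [hI, hI3, hI4]
  ring

theorem SmoothDecaying.continuousOn_bilaplacian (hu : SmoothDecaying T m u) :
    ContinuousOn (fun p : ℝ × ℝ × ℝ => bilaplacian u p.1 p.2.1 p.2.2)
      (univ ×ˢ Ici 0 ×ˢ Icc 0 T) :=
  ((hu.continuousOn 4 0 (by norm_num)).add
    ((hu.continuousOn 2 2 (by norm_num)).const_mul 2)).add (hu.continuousOn 0 4 (by norm_num))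

/-- By the equation, the integrand is the time derivative of `exp(ητ) u`. The equation holds only
for `τ` in the open interval, and continuity up to `τ = 0` supplies the initial value. -/
theorem exp_mul_sub_eq_integral {u₀ g₀ g₁ : ℝ → ℝ → ℂ} (hu : SmoothDecaying T m u)
    (hs : SolvesIBVP T u u₀ g₀ g₁) (η : ℂ) (x : ℝ) {y : ℝ} (hy : 0 < y) {t : ℝ}
    (ht : t ∈ Ioo 0 T) :
    Complex.exp (η * t) * u x y t - u x y 0
      = ∫ τ in (0 : ℝ)..t, Complex.exp (η * τ) * (η * u x y τ - bilaplacian u x y τ) := by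
  have hsub : Icc 0 t ⊆ Icc 0 T := Icc_subset_Icc_right ht.2.le
  have hcu : ContinuousOn (fun τ => u x y τ) (Icc 0 t) :=
    (hu.continuousOn 0 0 (by norm_num)).comp (f := fun τ : ℝ => (x, y, τ)) (by fun_prop)
      (fun τ hτ => ⟨mem_univ _, hy.le, hsub hτ⟩)
  have hcb : ContinuousOn (fun τ => bilaplacian u x y τ) (Icc 0 t) :=
    hu.continuousOn_bilaplacian.comp (f := fun τ : ℝ => (x, y, τ)) (by fun_prop)
      (fun τ hτ => ⟨mem_univ _, hy.le, hsub hτ⟩)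
  have hE : ∀ τ : ℝ, HasDerivAt (fun τ : ℝ => Complex.exp (η * τ)) (Complex.exp (η * τ) * η) τ :=
    fun τ => by
      have h1 : HasDerivAt (fun τ : ℝ => η * (τ : ℂ)) η τ := by
        simpa using (hasDerivAt_id τ).ofReal_comp.const_mul η
      exact h1.cexp
  have key := intervalIntegral.integral_eq_sub_of_hasDerivAt_of_le
    (f := fun τ : ℝ => Complex.exp (η * τ) * u x y τ)
    (f' := fun τ : ℝ => Complex.exp (η * τ) * (η * u x y τ - bilaplacian u x y τ)) ht.1.le
    (ContinuousOn.mul (by fun_prop) hcu)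
    (fun τ hτ => by
      have := (hE τ).mul (hs.pde x y hy τ ⟨hτ.1, hτ.2.trans ht.2⟩)
      convert! this using 1
      ring)
    (by
      apply ContinuousOn.intervalIntegrable
      rw [uIcc_of_le ht.1.le]
      exact ContinuousOn.mul (by fun_prop) ((hcu.const_mul η).sub hcb))
  rw [key]
  simp

theorem SmoothDecaying.continuousOn_fourierX_trace (hu : SmoothDecaying T m u) (hm : 1 < m)
    {j : ℕ} (hj : j ≤ 4) (κ : ℝ) : ContinuousOn (fourierX (trace u j) κ) (Icc 0 T) := by
  obtain ⟨C, -, hC⟩ := hu.exists_isDecaying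
  refine continuousOn_of_dominated (bound := fun x => C * (1 + |x|) ^ (-m)) ?_ ?_
    ((integrable_decay_line hm).const_mul C) ?_
  · intro t ht
    exact ((hC 0 j (by omega) t ht).integrable_x hm κ le_rfl).aestronglyMeasurable
  · refine fun t ht => Eventually.of_forall fun x => ?_
    rw [norm_mul, norm_exp_fourierX, one_mul]
    exact (hC 0 j (by omega) t ht).bound_x (by linarith) x le_rfl
  · refine Eventually.of_forall fun x => ?_
    refine ContinuousOn.mul continuousOn_const ?_
    exact (hu.continuousOn 0 j (by omega)).comp (f := fun τ : ℝ => (x, 0, τ)) (by fun_prop)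
      (fun τ hτ => ⟨mem_univ _, self_mem_Ici, hτ⟩)

theorem SmoothDecaying.exists_norm_fourierX_trace_le (hu : SmoothDecaying T m u) (hm : 1 < m) :
    ∃ M : ℝ, 0 ≤ M ∧ ∀ j ≤ 4, ∀ κ : ℝ, ∀ t ∈ Icc 0 T, ‖fourierX (trace u j) κ t‖ ≤ M := by
  obtain ⟨C, hC0, hC⟩ := hu.exists_isDecaying
  refine ⟨∫ x : ℝ, C * (1 + |x|) ^ (-m),
    integral_nonneg fun x => by simp only [Pi.zero_apply]; positivity, fun j hj κ t ht => ?_⟩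
  refine norm_integral_le_of_norm_le ((integrable_decay_line hm).const_mul C)
    (Eventually.of_forall fun x => ?_)
  rw [norm_mul, norm_exp_fourierX, one_mul]
  exact (hC 0 j (by omega) t ht).bound_x (by linarith) x le_rfl

/-- Decay uniform in time dominates the integrand on the half plane times `(0, t]`, which justifies
Fubini in the global relation. -/
theorem SmoothDecaying.integrable_swap (hu : SmoothDecaying T m u) (hm : 2 < m) {t : ℝ}
    (ht : t ∈ Ioo 0 T) (η : ℂ) (κ : ℝ) {l : ℂ} (hl : l.im ≤ 0) :
    Integrable (Function.uncurry fun (q : ℝ × ℝ) (τ : ℝ) =>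
      Complex.exp (-Complex.I * q.1 * κ - Complex.I * q.2 * l) *
        (Complex.exp (η * τ) * (η * u q.1 q.2 τ - bilaplacian u q.1 q.2 τ)))
      ((volume.restrict (univ ×ˢ Ioi 0)).prod (volume.restrict (Ioc 0 t))) := by
  obtain ⟨C, hC0, hC⟩ := hu.exists_isDecaying
  obtain ⟨C', hC'⟩ := hu.exists_bilaplacian_isDecaying
  have hmem : ∀ τ ∈ Ioc 0 t, τ ∈ Icc 0 T := fun τ hτ => ⟨hτ.1.le, hτ.2.trans ht.2.le⟩
  set K := Real.exp (‖η‖ * t) * (‖η‖ * C + C') with hK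
  have hdom : Integrable (fun z : (ℝ × ℝ) × ℝ => (1 + |z.1.1| + |z.1.2|) ^ (-m) * K)
      ((volume.restrict (univ ×ˢ Ioi 0)).prod (volume.restrict (Ioc 0 t))) :=
    Integrable.mul_prod (f := fun q : ℝ × ℝ => (1 + |q.1| + |q.2|) ^ (-m))
      (g := fun _ : ℝ => K) (integrable_decay hm).integrableOn (integrable_const _)
  refine hdom.mono' ?_ ?_
  · rw [Measure.prod_restrict]
    refine ContinuousOn.aestronglyMeasurable ?_
      ((MeasurableSet.univ.prod measurableSet_Ioi).prod measurableSet_Ioc)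
    have hmaps : MapsTo (fun z : (ℝ × ℝ) × ℝ => (z.1.1, z.1.2, z.2))
        (((univ : Set ℝ) ×ˢ Ioi (0 : ℝ)) ×ˢ Ioc 0 t) (univ ×ˢ Ici 0 ×ˢ Icc 0 T) :=
      fun z hz => ⟨mem_univ _, Ioi_subset_Ici_self hz.1.2, hmem _ hz.2⟩
    have c1 := (hu.continuousOn 0 0 (by norm_num)).comp
      (f := fun z : (ℝ × ℝ) × ℝ => (z.1.1, z.1.2, z.2)) (by fun_prop) hmaps
    have c2 := hu.continuousOn_bilaplacian.comp
      (f := fun z : (ℝ × ℝ) × ℝ => (z.1.1, z.1.2, z.2)) (by fun_prop) hmaps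
    exact ContinuousOn.mul (by fun_prop) (ContinuousOn.mul (by fun_prop) ((c1.const_mul η).sub c2))
  · rw [Measure.prod_restrict]
    filter_upwards [ae_restrict_mem
      ((MeasurableSet.univ.prod measurableSet_Ioi).prod measurableSet_Ioc)] with z hz
    obtain ⟨⟨x, y⟩, τ⟩ := z
    have hy : 0 ≤ y := le_of_lt hz.1.2
    have hτ : τ ∈ Ioc 0 t := hz.2
    simp only [Function.uncurry]
    rw [norm_mul, norm_mul]
    have b1 := norm_exp_halfFourier_le κ x hy hl
    have b2 : ‖Complex.exp (η * τ)‖ ≤ Real.exp (‖η‖ * t) := by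
      rw [Complex.norm_exp]
      apply Real.exp_le_exp.2
      refine (Complex.re_le_norm _).trans ?_
      rw [norm_mul, Complex.norm_real, Real.norm_of_nonneg hτ.1.le]
      exact mul_le_mul_of_nonneg_left hτ.2 (norm_nonneg _)
    have b3 : ‖η * u x y τ - bilaplacian u x y τ‖
        ≤ (‖η‖ * C + C') * (1 + |x| + |y|) ^ (-m) := by
      refine (norm_sub_le _ _).trans ?_
      rw [norm_mul, add_mul, mul_assoc]
      exact add_le_add (mul_le_mul_of_nonneg_left
        ((hC 0 0 (by norm_num) τ (hmem τ hτ)).bound x y hy) (norm_nonneg _))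
        ((hC' τ (hmem τ hτ)).bound x y hy)
    calc _ ≤ 1 * (Real.exp (‖η‖ * t) * ((‖η‖ * C + C') * (1 + |x| + |y|) ^ (-m))) := by
          gcongr
      _ = _ := by rw [hK]; ring

theorem SmoothDecaying.intervalIntegrable_tTransform (hu : SmoothDecaying T m u) (hm : 1 < m)
    {j : ℕ} (hj : j ≤ 4) (κ : ℝ) (η : ℂ) {t : ℝ} (ht : t ∈ Ioo 0 T) :
    IntervalIntegrable (fun τ : ℝ => Complex.exp (η * τ) * fourierX (trace u j) κ τ)
      volume 0 t := by
  apply ContinuousOn.intervalIntegrable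
  rw [uIcc_of_le ht.1.le]
  exact ContinuousOn.mul (by fun_prop)
    ((hu.continuousOn_fourierX_trace hm hj κ).mono (Icc_subset_Icc_right ht.2.le))

/-- The global relation. -/
theorem global_relation {u₀ g₀ g₁ : ℝ → ℝ → ℂ} (hu : SmoothDecaying T m u) (hm : 2 < m)
    (hs : SolvesIBVP T u u₀ g₀ g₁) {t : ℝ} (ht : t ∈ Ioo 0 T) (κ : ℝ) {l : ℂ} (hl : l.im ≤ 0) :
    Complex.exp (((κ : ℂ) ^ 2 + l ^ 2) ^ 2 * t) * halfFourier (fun x y => u x y t) κ l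
      = halfFourier (fun x y => u x y 0) κ l + boundaryTerm u κ l t := by
  set η : ℂ := ((κ : ℂ) ^ 2 + l ^ 2) ^ 2 with hη
  obtain ⟨C, -, hC⟩ := hu.exists_isDecaying
  obtain ⟨C', hC'⟩ := hu.exists_bilaplacian_isDecaying
  have hT : 0 < T := ht.1.trans ht.2
  have h0 : (0 : ℝ) ∈ Icc 0 T := ⟨le_rfl, hT.le⟩
  have ht' : t ∈ Icc 0 T := ⟨ht.1.le, ht.2.le⟩
  have hu0 : ∀ τ ∈ Icc 0 T, IsDecaying C m (fun x y => u x y τ) := hC 0 0 (by norm_num)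
  have step1 : Complex.exp (η * t) * halfFourier (fun x y => u x y t) κ l
      - halfFourier (fun x y => u x y 0) κ l
      = ∫ q in (univ : Set ℝ) ×ˢ Ioi (0 : ℝ), ∫ τ in Ioc 0 t,
        Complex.exp (-Complex.I * q.1 * κ - Complex.I * q.2 * l) *
        (Complex.exp (η * τ) * (η * u q.1 q.2 τ - bilaplacian u q.1 q.2 τ)) := by
    rw [(hu0 t ht').halfFourier_eq hm κ hl, (hu0 0 h0).halfFourier_eq hm κ hl,
      ← integral_const_mul, ← integral_sub (((hu0 t ht').integrable_prod hm κ hl).const_mul _)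
        ((hu0 0 h0).integrable_prod hm κ hl)]
    refine setIntegral_congr_fun (MeasurableSet.univ.prod measurableSet_Ioi) fun q hq => ?_
    have h := exp_mul_sub_eq_integral hu hs η q.1 hq.2 ht
    rw [intervalIntegral.integral_of_le ht.1.le] at h
    rw [integral_const_mul, ← h]
    ring
  have step2 : ∀ τ ∈ Ioc 0 t, ∫ q in (univ : Set ℝ) ×ˢ Ioi (0 : ℝ),
      Complex.exp (-Complex.I * q.1 * κ - Complex.I * q.2 * l) *
        (Complex.exp (η * τ) * (η * u q.1 q.2 τ - bilaplacian u q.1 q.2 τ))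
      = Complex.exp (η * τ) * (fourierX (trace u 3) κ τ + Complex.I * l * fourierX (trace u 2) κ τ
          - (l ^ 2 + 2 * (κ : ℂ) ^ 2) * (fourierX (trace u 1) κ τ
            + Complex.I * l * fourierX (trace u 0) κ τ)) := by
    intro τ hτ
    have hτ' : τ ∈ Icc 0 T := ⟨hτ.1.le, hτ.2.trans ht.2.le⟩
    have hb := hu.halfFourier_bilaplacian hm hτ' κ hl
    rw [← hη] at hb
    have e : ∫ q in (univ : Set ℝ) ×ˢ Ioi (0 : ℝ),
        Complex.exp (-Complex.I * q.1 * κ - Complex.I * q.2 * l) *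
          (Complex.exp (η * τ) * (η * u q.1 q.2 τ - bilaplacian u q.1 q.2 τ))
        = Complex.exp (η * τ) * (η * halfFourier (fun x y => u x y τ) κ l
          - halfFourier (fun x y => bilaplacian u x y τ) κ l) := by
      rw [(hu0 τ hτ').halfFourier_eq hm κ hl, (hC' τ hτ').halfFourier_eq hm κ hl,
        ← integral_const_mul, ← integral_sub (((hu0 τ hτ').integrable_prod hm κ hl).const_mul _)
          ((hC' τ hτ').integrable_prod hm κ hl), ← integral_const_mul]
      congr 1 with q
      ring
    rw [e, hb]
    ring
  have i3 := hu.intervalIntegrable_tTransform (by linarith) (j := 3) (by norm_num) κ η ht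
  have i2 := (hu.intervalIntegrable_tTransform (by linarith) (j := 2) (by norm_num) κ η
    ht).const_mul (Complex.I * l)
  have i1 := hu.intervalIntegrable_tTransform (by linarith) (j := 1) (by norm_num) κ η ht
  have i0 := (hu.intervalIntegrable_tTransform (by linarith) (j := 0) (by norm_num) κ η
    ht).const_mul (Complex.I * l)
  have step3 : ∫ τ in (0 : ℝ)..t, Complex.exp (η * τ) * (fourierX (trace u 3) κ τ
        + Complex.I * l * fourierX (trace u 2) κ τ
          - (l ^ 2 + 2 * (κ : ℂ) ^ 2) * (fourierX (trace u 1) κ τ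
            + Complex.I * l * fourierX (trace u 0) κ τ)) = boundaryTerm u κ l t := by
    unfold boundaryTerm tTransform
    rw [← hη, ← intervalIntegral.integral_const_mul, ← intervalIntegral.integral_const_mul,
      ← intervalIntegral.integral_add i3 i2, ← intervalIntegral.integral_add i1 i0,
      ← intervalIntegral.integral_const_mul,
      ← intervalIntegral.integral_sub (i3.add i2) ((i1.add i0).const_mul _)]
    congr 1 with τ
    ring
  rw [← sub_eq_iff_eq_add', step1, integral_integral_swap
    (hu.integrable_swap hm ht η κ hl), setIntegral_congr_fun measurableSet_Ioc step2,
    ← intervalIntegral.integral_of_le ht.1.le, step3]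

end

/-! ### Exponential bounds -/

theorem pow_four_le_exp {c : ℝ} (hc : 0 < c) {r : ℝ} (hr : 0 ≤ r) :
    (1 + r) ^ 4 ≤ 24 / c ^ 4 * Real.exp c * Real.exp (c * r) := by
  have h := Real.pow_div_factorial_le_exp (c * (1 + r)) (by positivity) 4
  rw [mul_add, mul_one, Real.exp_add] at h
  rw [← mul_one_add, mul_pow] at h
  have h4 : ((Nat.factorial 4 : ℕ) : ℝ) = 24 := by norm_num [Nat.factorial]
  rw [h4, div_le_iff₀ (by norm_num)] at h
  rw [div_mul_eq_mul_div, div_mul_eq_mul_div, le_div_iff₀ (by positivity)]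
  linarith

/-- Half of the decay `exp(-y(|κ| + r)/10)` is spent on the polynomial, since `(y/100) · 5 = y/20`.
The constant is uniform in `κ`, as the final integration in `κ` requires. -/
theorem exists_poly_mul_exp_le {y : ℝ} (hy : 0 < y) :
    ∃ C : ℝ, 0 ≤ C ∧ ∀ (κ r : ℝ) (l : ℂ), 0 ≤ r → |l.re| ≤ r → (|κ| + r) / 10 ≤ l.im →
      l.im ≤ |κ| + 3 * r →
      (1 + ‖l‖ + |κ|) ^ 4 * Real.exp (-(y * l.im)) ≤ C * Real.exp (-(y / 20 * (|κ| + r))) := by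
  refine ⟨24 / (y / 100) ^ 4 * Real.exp (y / 100), by positivity, fun κ r l hr h1 h2 h3 => ?_⟩
  have hk := abs_nonneg κ
  have hn : ‖l‖ ≤ |κ| + 4 * r := by
    refine (Complex.norm_le_abs_re_add_abs_im l).trans ?_
    rw [abs_of_nonneg (show 0 ≤ l.im by linarith)]
    linarith
  have h4 : (1 + ‖l‖ + |κ|) ^ 4 ≤ (1 + 5 * (|κ| + r)) ^ 4 :=
    pow_le_pow_left₀ (by positivity) (by linarith) 4
  have h5 := pow_four_le_exp (c := y / 100) (by positivity) (r := 5 * (|κ| + r)) (by positivity)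
  have h6 : Real.exp (-(y * l.im)) ≤ Real.exp (-(y * ((|κ| + r) / 10))) := by gcongr
  calc _ ≤ (24 / (y / 100) ^ 4 * Real.exp (y / 100) * Real.exp (y / 100 * (5 * (|κ| + r))))
        * Real.exp (-(y * ((|κ| + r) / 10))) := by
          gcongr
          exact h4.trans h5
    _ = 24 / (y / 100) ^ 4 * Real.exp (y / 100) * Real.exp (-(y / 20 * (|κ| + r))) := by
          rw [mul_assoc _ (Real.exp (y / 100 * (5 * (|κ| + r)))), ← Real.exp_add]
          congr 2
          ring

/-! ### Deformation of contours -/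

theorem measurable_deriv_arc (κ σ τ : ℝ) : Measurable (deriv (arc κ σ τ)) := measurable_deriv _

theorem integrableOn_arc {κ σ τ K c : ℝ} (hσ : σ ∈ ({1, -1} : Set ℝ))
    (hτ : τ ∈ ({1, -1} : Set ℝ)) (hc : 0 < c) {F : ℂ → ℂ}
    (hF : ContinuousOn (fun a => F (arc κ σ τ a)) (Ioi 0))
    (hb : ∀ r > 0, ‖F (arc κ σ τ r)‖ ≤ K * Real.exp (-(c * r))) :
    IntegrableOn (fun a => F (arc κ σ τ a) * deriv (arc κ σ τ) a) (Ioi 0) := by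
  have h : IntegrableOn (fun r : ℝ => K * Real.exp (-c * r) * 4) (Ioi 0) :=
    ((exp_neg_integrableOn_Ioi 0 hc).const_mul K).mul_const 4
  refine h.mono' ((hF.aestronglyMeasurable measurableSet_Ioi).mul
    (measurable_deriv_arc κ σ τ).aestronglyMeasurable) ?_
  filter_upwards [ae_restrict_mem measurableSet_Ioi] with r hr
  rw [norm_mul, neg_mul]
  exact mul_le_mul (hb r hr) (norm_deriv_arc_le hσ hτ hr) (norm_nonneg _)
    ((norm_nonneg _).trans (hb r hr))

theorem arc_zero (κ σ τ : ℝ) : arc κ σ τ 0 = ⟨0, |κ|⟩ := by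
  simp [arc, Real.sqrt_sq_eq_abs]

/-- Two arcs give the same integral if the integrand is holomorphic between them and
decays there. -/
theorem arcIntegral_eq {κ σ₁ τ₁ σ₂ τ₂ K c : ℝ} (hσ₁ : σ₁ ∈ ({1, -1} : Set ℝ))
    (hτ₁ : τ₁ ∈ ({1, -1} : Set ℝ)) (hσ₂ : σ₂ ∈ ({1, -1} : Set ℝ))
    (hτ₂ : τ₂ ∈ ({1, -1} : Set ℝ)) (hc : 0 < c) {V : Set ℂ} (hVo : IsOpen V)
    (hVc : Convex ℝ V) {F : ℂ → ℂ} (hF : DifferentiableOn ℂ F V)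
    (h₁ : ∀ r > 0, arc κ σ₁ τ₁ r ∈ V) (h₂ : ∀ r > 0, arc κ σ₂ τ₂ r ∈ V)
    (hd : ∀ r > 0, ‖arc κ σ₂ τ₂ r - arc κ σ₁ τ₁ r‖ ≤ 2 * r)
    (hb : ∀ r > 0, ∀ l ∈ segment ℝ (arc κ σ₁ τ₁ r) (arc κ σ₂ τ₂ r),
      ‖F l‖ ≤ K * Real.exp (-(c * r))) :
    arcIntegral κ σ₁ τ₁ F = arcIntegral κ σ₂ τ₂ F := by
  -- A primitive on the convex set `V` replaces Cauchy's theorem: the difference of the two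
  -- integrands is the derivative of `B`, and it remains to see that `B` tends to zero at both ends.
  obtain ⟨Φ, hΦ'⟩ := hVc.exists_forall_hasDerivWithinAt hF
  have hΦ : ∀ z ∈ V, HasDerivAt Φ (F z) z := fun z hz => (hΦ' z hz).hasDerivAt (hVo.mem_nhds hz)
  have hcont : ∀ {σ τ : ℝ}, (∀ r > 0, arc κ σ τ r ∈ V) →
      ContinuousOn (fun a => F (arc κ σ τ a)) (Ioi 0) := fun h =>
    hF.continuousOn.comp (continuous_arc _ _ _).continuousOn h
  have i₁ := integrableOn_arc hσ₁ hτ₁ hc (hcont h₁)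
    (fun r hr => hb r hr _ (left_mem_segment ℝ _ _))
  have i₂ := integrableOn_arc hσ₂ hτ₂ hc (hcont h₂)
    (fun r hr => hb r hr _ (right_mem_segment ℝ _ _))
  set B : ℝ → ℂ := fun r => Φ (arc κ σ₂ τ₂ r) - Φ (arc κ σ₁ τ₁ r) with hB
  have hB0 : B 0 = 0 := by simp [hB, arc_zero]
  have hderiv : ∀ {σ τ : ℝ}, (∀ r > 0, arc κ σ τ r ∈ V) → ∀ r ∈ Ioi (0 : ℝ),
      HasDerivAt (fun r => Φ (arc κ σ τ r)) (F (arc κ σ τ r) * deriv (arc κ σ τ) r) r := by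
    intro σ τ h r hr
    have h1 := (hasDerivAt_arc (κ := κ) (σ := σ) (τ := τ) (Or.inr (ne_of_gt hr)))
    have := (hΦ _ (h r hr)).comp_of_eq r h1.differentiableAt.hasDerivAt rfl
    exact this
  have hBle : ∀ r > 0, ‖B r‖ ≤ K * Real.exp (-(c * r)) * (2 * r) := fun r hr => by
    have hsub : segment ℝ (arc κ σ₁ τ₁ r) (arc κ σ₂ τ₂ r) ⊆ V :=
      hVc.segment_subset (h₁ r hr) (h₂ r hr)
    have := (convex_segment (𝕜 := ℝ) (arc κ σ₁ τ₁ r)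
      (arc κ σ₂ τ₂ r)).norm_image_sub_le_of_norm_hasDerivWithin_le (f := Φ) (f' := F)
      (fun z hz => (hΦ z (hsub hz)).hasDerivWithinAt) (hb r hr) (left_mem_segment ℝ _ _)
      (right_mem_segment ℝ _ _)
    refine this.trans (mul_le_mul_of_nonneg_left (hd r hr) ?_)
    exact (norm_nonneg _).trans (hb r hr _ (left_mem_segment ℝ _ _))
  -- The common starting point `i|κ|` need not lie in `V`, so continuity at zero comes from the mean
  -- value bound on the segment, whose length tends to zero.
  have hlim0 : ContinuousWithinAt B (Ici 0) 0 := by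
    have hc0 : Tendsto (fun r : ℝ => K * Real.exp (-(c * r)) * (2 * r)) (𝓝[≥] 0) (𝓝 0) := by
      have : Continuous (fun r : ℝ => K * Real.exp (-(c * r)) * (2 * r)) := by fun_prop
      have := (this.tendsto 0).mono_left (nhdsWithin_le_nhds (s := Ici (0 : ℝ)))
      simpa using this
    rw [ContinuousWithinAt, hB0]
    refine squeeze_zero_norm' ?_ hc0
    filter_upwards [self_mem_nhdsWithin] with r hr
    rcases eq_or_lt_of_le (show 0 ≤ r from hr) with h | h
    · simp [← h, hB0]
    · exact hBle r h
  have hlimTop : Tendsto B atTop (𝓝 0) := by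
    have h1 : Tendsto (fun r : ℝ => K * Real.exp (-(c * r)) * (2 * r)) atTop (𝓝 0) := by
      have h2 := (Real.tendsto_pow_mul_exp_neg_atTop_nhds_zero 1).comp
        (tendsto_id.const_mul_atTop hc)
      have h3 := h2.const_mul (2 * K / c)
      rw [mul_zero] at h3
      refine h3.congr fun r => ?_
      simp only [Function.comp_apply, id_eq, pow_one]
      field_simp
    refine squeeze_zero_norm' ?_ h1
    filter_upwards [eventually_gt_atTop 0] with r hr using hBle r hr
  have key := integral_Ioi_of_hasDerivAt_of_tendsto hlim0
    (fun r hr => (hderiv h₂ r hr).sub (hderiv h₁ r hr)) (i₂.sub i₁) hlimTop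
  rw [integral_sub i₂ i₁, hB0, sub_zero] at key
  exact (sub_eq_zero.1 key).symm

/-- The two upper arcs give the same integral. -/
theorem arcIntegral_upper_eq {κ y K : ℝ} (hy : 0 < y) (hK : 0 ≤ K) {F : ℂ → ℂ}
    (hF : Differentiable ℂ F)
    (hb : ∀ l : ℂ, Real.sqrt (κ ^ 2 + 2 * l.re ^ 2) + |l.re| ≤ l.im →
      ‖F l‖ ≤ K * (1 + ‖l‖ + |κ|) ^ 4 * Real.exp (-(y * l.im))) :
    arcIntegral κ 1 1 F = arcIntegral κ (-1) 1 F := by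
  obtain ⟨C, hC0, hC⟩ := exists_poly_mul_exp_le hy
  refine arcIntegral_eq (K := K * C) (c := y / 20) (by simp) (by simp) (by simp) (by simp)
    (by positivity) isOpen_univ convex_univ hF.differentiableOn (fun _ _ => mem_univ _)
    (fun _ _ => mem_univ _) (fun r hr => ?_) (fun r hr l hl => ?_)
  · have : arc κ (-1) 1 r - arc κ 1 1 r = ((-(2 * r) : ℝ) : ℂ) := by
      apply Complex.ext <;> simp
      ring
    rw [this, Complex.norm_real, norm_neg, Real.norm_of_nonneg (by positivity)]
  -- The segment is horizontal at the height of the upper arcs and has `|Re l| ≤ r`, so it lies in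
  -- the region above these arcs.
  · have him : l.im = Real.sqrt (κ ^ 2 + 2 * r ^ 2) + r := by
      obtain ⟨a, b, ha, hb, hab, rfl⟩ := hl
      simp
      linear_combination (Real.sqrt (κ ^ 2 + 2 * r ^ 2) + r) * hab
    have hre : |l.re| ≤ r := by
      obtain ⟨a, b, ha, hb, hab, rfl⟩ := hl
      simp
      rw [abs_le]
      constructor <;> nlinarith
    have hmono : Real.sqrt (κ ^ 2 + 2 * l.re ^ 2) ≤ Real.sqrt (κ ^ 2 + 2 * r ^ 2) := by
      apply Real.sqrt_le_sqrt
      have : l.re ^ 2 ≤ r ^ 2 := sq_le_sq.2 (by rwa [abs_of_pos hr])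
      linarith
    have h1 := hb l (by linarith)
    have h2 := le_arc_im (κ := κ) (σ := 1) (τ := 1) (by simp) hr.le
    have h3 := arc_im_le (κ := κ) (σ := 1) (τ := 1) (by simp) hr.le
    rw [arc_im, one_mul, ← him] at h2 h3
    have h4 := hC κ r l hr.le hre h2 h3
    refine h1.trans ?_
    rw [mul_assoc, mul_assoc]
    refine mul_le_mul_of_nonneg_left (h4.trans ?_) hK
    gcongr
    linarith [abs_nonneg κ]

/-- The upper and the lower arc of one component of `D_κ⁺` give the same integral. -/
theorem arcIntegral_component_eq {κ σ y K : ℝ} (hσ : σ ∈ ({1, -1} : Set ℝ)) (hy : 0 < y)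
    (hK : 0 ≤ K) {F : ℂ → ℂ} (hF : DifferentiableOn ℂ F {l | 0 < σ * l.re ∧ 0 < l.im})
    (hb : ∀ l : ℂ, 0 < σ * l.re → 0 < l.im →
      ‖F l‖ ≤ K * (1 + ‖l‖ + |κ|) ^ 4 * Real.exp (-(y * l.im))) :
    arcIntegral κ σ 1 F = arcIntegral κ σ (-1) F := by
  obtain ⟨C, hC0, hC⟩ := exists_poly_mul_exp_le hy
  have hσ2 := sq_eq_one_of_mem hσ
  have hmem : ∀ {τ : ℝ}, τ ∈ ({1, -1} : Set ℝ) → ∀ r > 0,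
      arc κ σ τ r ∈ {l : ℂ | 0 < σ * l.re ∧ 0 < l.im} := fun hτ r hr => by
    refine ⟨?_, ?_⟩
    · rw [arc_re, ← mul_assoc, ← pow_two, hσ2, one_mul]
      exact hr
    · refine lt_of_lt_of_le ?_ (le_arc_im hτ hr.le)
      have := abs_nonneg κ
      linarith
  have hopen : IsOpen {l : ℂ | 0 < σ * l.re ∧ 0 < l.im} :=
    (isOpen_lt continuous_const (continuous_const.mul Complex.continuous_re)).inter
      (isOpen_lt continuous_const Complex.continuous_im)
  have hconv : Convex ℝ {l : ℂ | 0 < σ * l.re ∧ 0 < l.im} := by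
    have h : Convex ℝ {l : ℂ | 0 < σ * l.re} := by
      rcases hσ with rfl | rfl
      · simpa using convex_halfSpace_re_gt 0
      · simpa using convex_halfSpace_re_lt 0
    exact h.inter (convex_halfSpace_im_gt 0)
  refine arcIntegral_eq (K := K * C) (c := y / 20) hσ (by simp) hσ (by simp)
    (by positivity) hopen hconv hF (hmem (by simp)) (hmem (by simp))
    (fun r hr => ?_) (fun r hr l hl => ?_)
  -- At equal parameter the two arcs have the same real part, so the connecting segment is vertical,
  -- of length `2r`, inside one open quadrant.
  · have : arc κ σ (-1) r - arc κ σ 1 r = ((-(2 * r) : ℝ) : ℂ) * Complex.I := by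
      apply Complex.ext <;> simp
      ring
    rw [this, norm_mul, Complex.norm_I, mul_one, Complex.norm_real, norm_neg,
      Real.norm_of_nonneg (by positivity)]
  · have hV := hconv.segment_subset (hmem (τ := 1) (by simp) r hr)
      (hmem (τ := -1) (by simp) r hr) hl
    have hre : |l.re| ≤ r := by
      obtain ⟨a, b, ha, hb, hab, rfl⟩ := hl
      have e : (a • arc κ σ 1 r + b • arc κ σ (-1) r).re = σ * r := by
        simp
        linear_combination (σ * r) * hab
      rw [e, abs_mul, abs_eq_one_of_mem hσ, one_mul, abs_of_pos hr]
    have h2 := le_sqrt_sub κ r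
    have h3 := arc_im_le (κ := κ) (σ := 1) (τ := 1) (by simp) hr.le
    rw [arc_im, one_mul] at h3
    have him : Real.sqrt (κ ^ 2 + 2 * r ^ 2) - r ≤ l.im ∧
        l.im ≤ Real.sqrt (κ ^ 2 + 2 * r ^ 2) + r := by
      obtain ⟨a, b, ha, hb, hab, rfl⟩ := hl
      have e : (a • arc κ σ 1 r + b • arc κ σ (-1) r).im
          = Real.sqrt (κ ^ 2 + 2 * r ^ 2) + (a - b) * r := by
        simp
        linear_combination (Real.sqrt (κ ^ 2 + 2 * r ^ 2)) * hab
      rw [e]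
      constructor <;> nlinarith
    have h1 := hb l hV.1 hV.2
    have h4 := hC κ r l hr.le hre (by linarith [him.1]) (by linarith [him.2])
    refine h1.trans ?_
    rw [mul_assoc, mul_assoc]
    refine mul_le_mul_of_nonneg_left (h4.trans ?_) hK
    gcongr
    linarith [abs_nonneg κ]

/-- With `s = √(κ² + 2r²)` the right side equals `-κ² + 2r(s - r)`. Hence the Gaussian factor stays
bounded on the lower arc. -/
theorem arc_lower_sq_sub {κ σ r : ℝ} (hσ : σ ∈ ({1, -1} : Set ℝ)) (hr : 0 ≤ r) :
    -κ ^ 2 ≤ (arc κ σ (-1) r).re ^ 2 - (arc κ σ (-1) r).im ^ 2 := by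
  have h1 := abs_le_sqrt κ r
  rw [abs_of_nonneg hr] at h1
  have h2 : Real.sqrt (κ ^ 2 + 2 * r ^ 2) ^ 2 = κ ^ 2 + 2 * r ^ 2 := Real.sq_sqrt (by positivity)
  simp only [arc_re, arc_im, mul_pow, sq_eq_one_of_mem hσ]
  nlinarith

/-- Deformation of the half line `σ ℝ₊` to a lower arc. -/
theorem arcIntegral_lower_sub {κ σ y ε K : ℝ} (hσ : σ ∈ ({1, -1} : Set ℝ)) (hy : 0 < y)
    (hε : 0 < ε) (hK : 0 ≤ K) {F Φ : ℂ → ℂ} (hF : Continuous F) (hΦ : ∀ z, HasDerivAt Φ (F z) z)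
    (hb : ∀ l : ℂ, 0 ≤ l.im → l.im ≤ Real.sqrt (κ ^ 2 + 2 * l.re ^ 2) - |l.re| →
      ‖F l‖ ≤ K * (1 + ‖l‖ + |κ|) ^ 4 * Real.exp (-(y * l.im))
        * Real.exp (-(ε * (l.re ^ 2 - l.im ^ 2))))
    (hR : IntegrableOn (fun r : ℝ => F ((σ * r : ℝ) : ℂ)) (Ioi 0)) :
    arcIntegral κ σ (-1) F - σ * ∫ r in Ioi (0 : ℝ), F ((σ * r : ℝ) : ℂ)
      = Φ 0 - Φ ⟨0, |κ|⟩ := by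
  obtain ⟨C, hC0, hC⟩ := exists_poly_mul_exp_le hy
  have hσ1 := abs_eq_one_of_mem hσ
  have hσ2 := sq_eq_one_of_mem hσ
  have i₁ : IntegrableOn (fun a => F (arc κ σ (-1) a) * deriv (arc κ σ (-1)) a) (Ioi 0) := by
    refine integrableOn_arc (K := K * C * Real.exp (ε * κ ^ 2)) (c := y / 20) hσ (by simp)
      (by positivity) (hF.comp (continuous_arc _ _ _)).continuousOn (fun r hr => ?_)
    have him := le_arc_im (κ := κ) (σ := σ) (τ := -1) (by simp) hr.le
    have h1 := hb (arc κ σ (-1) r) (by linarith [abs_nonneg κ]) (by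
      simp only [arc_re, arc_im, abs_mul, hσ1, mul_pow, hσ2, abs_of_pos hr, one_mul]
      linarith)
    have h2 := hC κ r (arc κ σ (-1) r) hr.le (by simp [abs_mul, hσ1, abs_of_pos hr]) him
      (arc_im_le (by simp) hr.le)
    have h3 := arc_lower_sq_sub (κ := κ) hσ hr.le
    calc _ ≤ K * ((1 + ‖arc κ σ (-1) r‖ + |κ|) ^ 4 * Real.exp (-(y * (arc κ σ (-1) r).im)))
          * Real.exp (-(ε * ((arc κ σ (-1) r).re ^ 2 - (arc κ σ (-1) r).im ^ 2))) := by
            rw [← mul_assoc]; exact h1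
      _ ≤ K * (C * Real.exp (-(y / 20 * r))) * Real.exp (ε * κ ^ 2) := by
          have h4 : Real.exp (-(y / 20 * (|κ| + r))) ≤ Real.exp (-(y / 20 * r)) := by
            gcongr
            linarith [abs_nonneg κ]
          refine mul_le_mul (mul_le_mul_of_nonneg_left
            (h2.trans (mul_le_mul_of_nonneg_left h4 hC0)) hK) (Real.exp_le_exp.2 ?_)
            (Real.exp_pos _).le (by positivity)
          nlinarith
      _ = _ := by ring
  have i₂ : IntegrableOn (fun r : ℝ => F ((σ * r : ℝ) : ℂ) * σ) (Ioi 0) := hR.mul_const _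
  have hd₂ : ∀ r : ℝ,
      HasDerivAt (fun r : ℝ => Φ ((σ * r : ℝ) : ℂ)) (F ((σ * r : ℝ) : ℂ) * σ) r := by
    intro r
    have h1 : HasDerivAt (fun r : ℝ => ((σ * r : ℝ) : ℂ)) (σ : ℂ) r := by
      have := ((hasDerivAt_id r).const_mul σ).ofReal_comp
      simpa using this
    exact (hΦ _).comp_of_eq r h1 rfl
  have hd₁ : ∀ r ∈ Ioi (0 : ℝ), HasDerivAt (fun r : ℝ => Φ (arc κ σ (-1) r))
      (F (arc κ σ (-1) r) * deriv (arc κ σ (-1)) r) r := by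
    intro r hr
    have h1 := (hasDerivAt_arc (κ := κ) (σ := σ) (τ := -1) (Or.inr (ne_of_gt hr)))
    exact (hΦ _).comp_of_eq r h1.differentiableAt.hasDerivAt rfl
  have hΦc : Continuous Φ := continuous_iff_continuousAt.2 fun z => (hΦ z).continuousAt
  -- Here the two paths start at different points, `0` and `i|κ|`, and the result is a difference of
  -- primitive values independent of `σ`. It cancels when the two half lines are combined.
  set B : ℝ → ℂ := fun r => Φ (arc κ σ (-1) r) - Φ ((σ * r : ℝ) : ℂ) with hB
  have hBc : Continuous B := (hΦc.comp (continuous_arc _ _ _)).sub (hΦc.comp (by fun_prop))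
  have hB0 : B 0 = Φ ⟨0, |κ|⟩ - Φ 0 := by simp [hB, arc_zero]
  have hlim : Tendsto B atTop (𝓝 0) := by
    set M := 24 / (ε / 24) ^ 4 * Real.exp (ε / 24) with hM
    have h1 : Tendsto (fun r : ℝ => K * M * (Real.exp (-(ε / 8 * r)) * r)) atTop (𝓝 0) := by
      have h2 := (Real.tendsto_pow_mul_exp_neg_atTop_nhds_zero 1).comp
        (tendsto_id.const_mul_atTop (show 0 < ε / 8 by positivity))
      have h3 := h2.const_mul (K * M * (8 / ε))
      rw [mul_zero] at h3
      refine h3.congr fun r => ?_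
      simp only [Function.comp_apply, id_eq, pow_one]
      field_simp
    refine squeeze_zero_norm' ?_ h1
    -- The vertical segment starts on the real axis, where `exp(-y Im l)` does not decay, so the
    -- Gaussian must do the work. For `r ≥ 4|κ|` the height is at most `3r/4`, hence `Re² - Im² ≥
    -- 7r²/16 ≥ r/4` once `r ≥ 1`. Half of `exp(-εr/4)` absorbs the polynomial, because `(ε/24) · 3
    -- = ε/8`.
    filter_upwards [eventually_ge_atTop (4 * |κ|), eventually_ge_atTop 1] with r hr4 hr1
    have hr0 : 0 < r := by linarith
    have hs := sqrt_le_abs_add κ r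
    have hs1 := abs_le_sqrt κ r
    rw [abs_of_pos hr0] at hs hs1
    have hbd : ∀ l ∈ segment ℝ ((σ * r : ℝ) : ℂ) (arc κ σ (-1) r),
        ‖F l‖ ≤ K * (M * Real.exp (-(ε / 8 * r))) := by
      intro l hl
      obtain ⟨a, b, ha, hb', hab, rfl⟩ := hl
      set l := a • ((σ * r : ℝ) : ℂ) + b • arc κ σ (-1) r with hl
      have hre : l.re = σ * r := by
        simp [hl]
        linear_combination (σ * r) * hab
      have him : l.im = b * (Real.sqrt (κ ^ 2 + 2 * r ^ 2) - r) := by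
        rw [hl, Complex.add_im, Complex.smul_im, Complex.smul_im, Complex.ofReal_im, arc_im]
        simp only [smul_eq_mul]
        ring
      have hre2 : l.re ^ 2 = r ^ 2 := by rw [hre, mul_pow, hσ2, one_mul]
      have hreabs : |l.re| = r := by rw [hre, abs_mul, hσ1, one_mul, abs_of_pos hr0]
      have hb1 : b ≤ 1 := by linarith
      have him0 : 0 ≤ l.im := by rw [him]; exact mul_nonneg hb' (by linarith)
      have him1 : l.im ≤ Real.sqrt (κ ^ 2 + 2 * r ^ 2) - r := by
        rw [him]; nlinarith
      have him2 : l.im ≤ 3 / 4 * r := by linarith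
      have h5 := hb l him0 (by rw [hre2, hreabs]; exact him1)
      have hn : ‖l‖ ≤ 2 * r := by
        refine (Complex.norm_le_abs_re_add_abs_im l).trans ?_
        rw [hreabs, abs_of_nonneg him0]
        linarith
      have h6 : (1 + ‖l‖ + |κ|) ^ 4 ≤ (1 + 3 * r) ^ 4 :=
        pow_le_pow_left₀ (by positivity) (by linarith) 4
      have h7 := pow_four_le_exp (c := ε / 24) (by positivity) (r := 3 * r) (by positivity)
      have h8 : Real.exp (-(y * l.im)) ≤ 1 := Real.exp_le_one_iff.2 (by nlinarith)
      have h9 : Real.exp (-(ε * (l.re ^ 2 - l.im ^ 2))) ≤ Real.exp (-(ε * (r / 4))) := by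
        have : r / 4 ≤ l.re ^ 2 - l.im ^ 2 := by
          rw [hre2]
          nlinarith
        gcongr
      calc _ ≤ K * (1 + ‖l‖ + |κ|) ^ 4 * Real.exp (-(y * l.im))
            * Real.exp (-(ε * (l.re ^ 2 - l.im ^ 2))) := h5
        _ ≤ K * (M * Real.exp (ε / 24 * (3 * r))) * 1 * Real.exp (-(ε * (r / 4))) := by
            gcongr
            exact h6.trans h7
        _ = K * (M * Real.exp (-(ε / 8 * r))) := by
            rw [mul_one, mul_assoc, mul_assoc, ← Real.exp_add]
            congr 3
            ring
    have h3 := (convex_segment (𝕜 := ℝ) ((σ * r : ℝ) : ℂ)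
      (arc κ σ (-1) r)).norm_image_sub_le_of_norm_hasDerivWithin_le (f := Φ) (f' := F)
      (fun z _ => (hΦ z).hasDerivWithinAt) hbd (left_mem_segment ℝ _ _)
      (right_mem_segment ℝ _ _)
    have h4 : ‖arc κ σ (-1) r - ((σ * r : ℝ) : ℂ)‖ ≤ r := by
      have e : arc κ σ (-1) r - ((σ * r : ℝ) : ℂ)
          = ((Real.sqrt (κ ^ 2 + 2 * r ^ 2) - r : ℝ) : ℂ) * Complex.I := by
        apply Complex.ext <;> simp
        ring
      rw [e, norm_mul, Complex.norm_I, mul_one, Complex.norm_real,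
        Real.norm_of_nonneg (by linarith)]
      linarith
    refine h3.trans ?_
    calc _ ≤ K * (M * Real.exp (-(ε / 8 * r))) * r := by gcongr
      _ = _ := by ring
  have key := integral_Ioi_of_hasDerivAt_of_tendsto hBc.continuousWithinAt
    (fun r hr => (hd₁ r hr).sub (hd₂ r)) (i₁.sub i₂) hlim
  rw [integral_sub i₁ i₂, integral_mul_const, hB0] at key
  unfold arcIntegral
  linear_combination key

/-- Deformation of the real line to the lower arcs. -/
theorem integral_eq_arcIntegral_lower {κ y ε K : ℝ} (hy : 0 < y)
    (hε : 0 < ε) (hK : 0 ≤ K) {F : ℂ → ℂ} (hF : Differentiable ℂ F)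
    (hb : ∀ l : ℂ, 0 ≤ l.im → l.im ≤ Real.sqrt (κ ^ 2 + 2 * l.re ^ 2) - |l.re| →
      ‖F l‖ ≤ K * (1 + ‖l‖ + |κ|) ^ 4 * Real.exp (-(y * l.im))
        * Real.exp (-(ε * (l.re ^ 2 - l.im ^ 2))))
    (hR : Integrable (fun r : ℝ => F r)) :
    ∫ r : ℝ, F r = -arcIntegral κ (-1) (-1) F + arcIntegral κ 1 (-1) F := by
  obtain ⟨Φ, hΦ⟩ := hF.isExactOn_univ
  have hΦ' : ∀ z, HasDerivAt Φ (F z) z := fun z => hΦ z (mem_univ z)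
  have hneg : Integrable (fun r : ℝ => F ((-1 * r : ℝ) : ℂ)) := by
    have := hR.comp_neg
    simpa using this
  have h1 := arcIntegral_lower_sub (σ := 1) (by simp) hy hε hK hF.continuous hΦ' hb
    (by simpa using hR.integrableOn)
  have h2 := arcIntegral_lower_sub (σ := -1) (by simp) hy hε hK hF.continuous hΦ' hb
    hneg.integrableOn
  have h3 : ∫ r in Ioi (0 : ℝ), F ((-1 * r : ℝ) : ℂ) = ∫ r in Iic (0 : ℝ), F r := by
    have := integral_comp_neg_Ioi (0 : ℝ) (fun r : ℝ => F (r : ℂ))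
    rw [neg_zero] at this
    rw [← this]
    simp
  have h4 : ∫ r : ℝ, F r = (∫ r in Iic (0 : ℝ), F r) + ∫ r in Ioi (0 : ℝ), F r :=
    (intervalIntegral.integral_Iic_add_Ioi hR.integrableOn hR.integrableOn).symm
  rw [h3] at h2
  simp only [one_mul, Complex.ofReal_one, Complex.ofReal_neg] at h1 h2
  rw [h4]
  linear_combination h2 - h1

theorem norm_exp_neg_mul_sq (ε : ℝ) (l : ℂ) :
    ‖Complex.exp (-(ε : ℂ) * l ^ 2)‖ = Real.exp (-(ε * (l.re ^ 2 - l.im ^ 2))) := by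
  rw [Complex.norm_exp]
  congr 1
  simp [pow_two]

/-- Removal of the Gaussian factor on a lower arc. -/
theorem tendsto_arcIntegral_gaussian {κ σ : ℝ} (hσ : σ ∈ ({1, -1} : Set ℝ)) {F : ℂ → ℂ}
    (hF : IntegrableOn (fun a => F (arc κ σ (-1) a) * deriv (arc κ σ (-1)) a) (Ioi 0)) :
    Tendsto (fun c : ℝ => arcIntegral κ σ (-1)
      (fun l => Complex.exp (-((c⁻¹ : ℝ) : ℂ) * l ^ 2) * F l)) atTop
      (𝓝 (arcIntegral κ σ (-1) F)) := by
  refine tendsto_integral_filter_of_dominated_convergence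
    (fun a => Real.exp (κ ^ 2) * ‖F (arc κ σ (-1) a) * deriv (arc κ σ (-1)) a‖) ?_ ?_
    (hF.norm.const_mul _) ?_
  · refine Eventually.of_forall fun c => ?_
    have h1 : Continuous fun a => Complex.exp (-((c⁻¹ : ℝ) : ℂ) * arc κ σ (-1) a ^ 2) := by
      have := continuous_arc κ σ (-1)
      fun_prop
    simp only [mul_assoc]
    exact h1.aestronglyMeasurable.mul hF.aestronglyMeasurable
  · filter_upwards [eventually_ge_atTop 1] with c hc
    filter_upwards [ae_restrict_mem measurableSet_Ioi] with a ha
    rw [mul_assoc, norm_mul, norm_exp_neg_mul_sq]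
    gcongr
    have h1 := arc_lower_sq_sub (κ := κ) hσ (le_of_lt ha)
    have h2 : 0 ≤ c⁻¹ := by positivity
    have h3 : c⁻¹ ≤ 1 := inv_le_one_of_one_le₀ hc
    nlinarith [sq_nonneg κ]
  · refine Eventually.of_forall fun a => ?_
    refine Tendsto.mul_const _ ?_
    have h : Tendsto (fun c : ℝ => Complex.exp (-((c⁻¹ : ℝ) : ℂ) * arc κ σ (-1) a ^ 2)
        * F (arc κ σ (-1) a)) atTop (𝓝 (Complex.exp (-((0 : ℝ) : ℂ) * arc κ σ (-1) a ^ 2)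
        * F (arc κ σ (-1) a))) :=
      Tendsto.mul_const _ (Tendsto.cexp (Tendsto.mul_const _ tendsto_inv_atTop_zero.ofReal.neg))
    simpa using h

/-! ### Fourier inversion with Gaussian regularisation -/

open scoped FourierTransform RealInnerProductSpace in
-- The Fourier transform is moved from `f` onto the Gaussian, turning the integral into convolution
-- with an approximate identity. Only continuity of `f` at `y` is needed, not integrability of its
-- transform.
theorem tendsto_integral_gaussian_mul_fourier {f : ℝ → ℂ} (hf : Integrable f) {y : ℝ}
    (hy : ContinuousAt f y) :
    Tendsto (fun c : ℝ => ∫ w : ℝ, Complex.exp (-(c : ℂ)⁻¹ * ‖w‖ ^ 2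
      + 2 * Real.pi * Complex.I * ⟪y, w⟫) • 𝓕 f w) atTop (𝓝 (f y)) := by
  refine (Real.tendsto_integral_gaussian_smul' hf hy).congr' ?_
  filter_upwards [Ioi_mem_atTop 0] with c (hc : 0 < c)
  have J : Integrable (fun w : ℝ => Complex.exp (-(c : ℂ)⁻¹ * ‖w‖ ^ 2
      + 2 * Real.pi * Complex.I * ⟪y, w⟫)) :=
    GaussianFourier.integrable_cexp_neg_mul_sq_norm_add (by simpa) _ _
  have h1 := VectorFourier.integral_fourierIntegral_smul_eq_flip (L := innerₗ ℝ)
    Real.continuous_fourierChar continuous_inner J hf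
  rw [flip_innerₗ] at h1
  refine Eq.trans ?_ h1
  congr 1 with w
  congr 1
  have := fourier_gaussian_innerProductSpace' (V := ℝ) (b := (c : ℂ)⁻¹) (by simpa) y w
  rw [show VectorFourier.fourierIntegral Real.fourierChar volume (innerₗ ℝ)
    (fun w : ℝ => Complex.exp (-(c : ℂ)⁻¹ * ‖w‖ ^ 2 + 2 * Real.pi * Complex.I * ⟪y, w⟫)) w
    = 𝓕 (fun w : ℝ => Complex.exp (-(c : ℂ)⁻¹ * ‖w‖ ^ 2
      + 2 * Real.pi * Complex.I * ⟪y, w⟫)) w from rfl, this,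
    div_inv_eq_mul, div_inv_eq_mul]
  congr 2
  ring

open scoped FourierTransform in
theorem fourier_eq_integral_exp (f : ℝ → ℂ) (w : ℝ) :
    𝓕 f w = ∫ s : ℝ, Complex.exp (-Complex.I * s * (2 * Real.pi * w : ℝ)) * f s := by
  rw [Real.fourier_eq']
  congr 1 with s
  rw [smul_eq_mul]
  congr 2
  simp
  ring

open scoped RealInnerProductSpace in
theorem tendsto_gaussian_inversion {f : ℝ → ℂ} (hf : Integrable f) {y : ℝ}
    (hy : ContinuousAt f y) :
    Tendsto (fun c : ℝ => ∫ l : ℝ, Complex.exp (-((c⁻¹ : ℝ) : ℂ) * (l : ℂ) ^ 2)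
      * (Complex.exp (Complex.I * l * y) * ∫ s : ℝ, Complex.exp (-Complex.I * s * l) * f s)) atTop
      (𝓝 (2 * Real.pi * f y)) := by
  have hpi := Real.pi_pos
  -- The substitution `l = 2πw` turns `exp(-l²/c)` into `exp(-4π²w²/c)`, so the Gaussian parameter
  -- becomes `c / (4π²)`.
  have h1 := (tendsto_integral_gaussian_mul_fourier hf hy).comp
    (tendsto_id.atTop_div_const (show 0 < 4 * Real.pi ^ 2 by positivity))
  have h2 := h1.const_mul (2 * Real.pi : ℂ)
  refine h2.congr fun c => ?_
  have h3 := Measure.integral_comp_mul_left (fun l : ℝ =>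
    Complex.exp (-((c⁻¹ : ℝ) : ℂ) * (l : ℂ) ^ 2)
      * (Complex.exp (Complex.I * l * y) * ∫ s : ℝ, Complex.exp (-Complex.I * s * l) * f s))
    (2 * Real.pi)
  have h4 : ∫ w : ℝ, Complex.exp (-((c / (4 * Real.pi ^ 2) : ℝ) : ℂ)⁻¹ * ‖w‖ ^ 2
      + 2 * Real.pi * Complex.I * ⟪y, w⟫) • FourierTransform.fourier f w
      = (2 * Real.pi : ℂ)⁻¹ * ∫ l : ℝ, Complex.exp (-((c⁻¹ : ℝ) : ℂ) * (l : ℂ) ^ 2)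
      * (Complex.exp (Complex.I * l * y) * ∫ s : ℝ, Complex.exp (-Complex.I * s * l) * f s) := by
    rw [abs_of_pos (by positivity), Complex.real_smul] at h3
    push_cast at h3
    push_cast
    rw [← h3]
    congr 1 with w
    rw [fourier_eq_integral_exp, smul_eq_mul, ← mul_assoc, ← Complex.exp_add]
    congr 2
    · have hw : ((‖w‖ : ℝ) : ℂ) ^ 2 = (w : ℂ) ^ 2 := by
        rw [← Complex.ofReal_pow, Real.norm_eq_abs, sq_abs, Complex.ofReal_pow]
      rw [hw]
      simp
      ring
    · congr 1 with s
      push_cast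
      ring
  simp only [Function.comp_apply, id_eq]
  rw [h4, ← mul_assoc, mul_inv_cancel₀ (by exact_mod_cast (by positivity)), one_mul]

open scoped FourierTransform in
/-- Fourier inversion on the line, without the normalisation of `𝓕`. -/
theorem fourier_inversion_line {f : ℝ → ℂ} (hf : Integrable f) (hc : Continuous f)
    (hfi : Integrable (fun κ : ℝ => ∫ s : ℝ, Complex.exp (-Complex.I * s * κ) * f s)) (x : ℝ) :
    2 * Real.pi * f x = ∫ κ : ℝ, Complex.exp (Complex.I * κ * x)
      * ∫ s : ℝ, Complex.exp (-Complex.I * s * κ) * f s := by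
  have hpi := Real.pi_pos
  have h1 : Integrable (𝓕 f) := by
    have := hfi.comp_mul_left' (R := 2 * Real.pi) (by positivity)
    exact this.congr (Eventually.of_forall fun w => (fourier_eq_integral_exp f w).symm)
  have h2 := congrFun (hc.fourierInv_fourier_eq hf h1) x
  rw [Real.fourierInv_eq'] at h2
  have h3 := Measure.integral_comp_mul_left (fun κ : ℝ => Complex.exp (Complex.I * κ * x)
      * ∫ s : ℝ, Complex.exp (-Complex.I * s * κ) * f s) (2 * Real.pi)
  rw [abs_of_pos (by positivity), Complex.real_smul] at h3
  rw [← h2]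
  have h4 : ∫ v : ℝ, Complex.exp ((2 * Real.pi * inner ℝ v x : ℝ) * Complex.I) • 𝓕 f v
      = ∫ w : ℝ, Complex.exp (Complex.I * (2 * Real.pi * w : ℝ) * x)
      * ∫ s : ℝ, Complex.exp (-Complex.I * s * (2 * Real.pi * w : ℝ)) * f s := by
    congr 1 with w
    rw [fourier_eq_integral_exp, smul_eq_mul]
    congr 2
    simp
    ring
  rw [h4, h3, ← mul_assoc]
  push_cast
  rw [mul_inv_cancel₀ (by exact_mod_cast (by positivity)), one_mul]

/-! ### Regularity and size of the transforms -/

theorem differentiable_integral_exp_mul {h : ℝ → ℂ} {t : ℝ} (ht : 0 ≤ t)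
    (hh : ContinuousOn h (Icc 0 t)) :
    Differentiable ℂ (fun η : ℂ => ∫ τ in (0 : ℝ)..t, Complex.exp (η * τ) * h τ) := by
  intro η₀
  obtain ⟨M, hM⟩ := isCompact_Icc.exists_bound_of_continuousOn hh
  have hsub : uIoc 0 t ⊆ Icc 0 t := by rw [uIoc_of_le ht]; exact Ioc_subset_Icc_self
  have hmeas : AEStronglyMeasurable h (volume.restrict (uIoc 0 t)) :=
    (hh.mono hsub).aestronglyMeasurable measurableSet_uIoc
  have key := intervalIntegral.hasDerivAt_integral_of_dominated_loc_of_deriv_le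
    (μ := volume) (a := 0) (b := t) (x₀ := η₀) (s := Metric.ball η₀ 1)
    (F := fun η τ => Complex.exp (η * τ) * h τ)
    (F' := fun η τ => Complex.exp (η * τ) * τ * h τ)
    (bound := fun _ => Real.exp ((‖η₀‖ + 1) * t) * t * M)
    (Metric.ball_mem_nhds _ one_pos)
    (Eventually.of_forall fun η => (Continuous.aestronglyMeasurable (by fun_prop)).mul hmeas)
    (by
      apply ContinuousOn.intervalIntegrable
      rw [uIcc_of_le ht]
      exact ContinuousOn.mul (by fun_prop) hh)
    ((Continuous.aestronglyMeasurable (by fun_prop)).mul hmeas)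
    (by
      refine Eventually.of_forall fun τ hτ η hη => ?_
      have hτ' := hsub hτ
      rw [norm_mul, norm_mul]
      have h1 : ‖Complex.exp (η * τ)‖ ≤ Real.exp ((‖η₀‖ + 1) * t) := by
        rw [Complex.norm_exp]
        apply Real.exp_le_exp.2
        refine (Complex.re_le_norm _).trans ?_
        rw [norm_mul, Complex.norm_real, Real.norm_of_nonneg hτ'.1]
        have h2 : ‖η‖ ≤ ‖η₀‖ + 1 := by
          have h3 := norm_sub_norm_le η η₀
          have h4 : ‖η - η₀‖ < 1 := mem_ball_iff_norm.1 hη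
          linarith
        exact mul_le_mul h2 hτ'.2 hτ'.1 (by positivity)
      have h2 : ‖(τ : ℂ)‖ ≤ t := by
        rw [Complex.norm_real, Real.norm_of_nonneg hτ'.1]; exact hτ'.2
      have h3 := hM τ hτ'
      exact mul_le_mul (mul_le_mul h1 h2 (norm_nonneg _) (Real.exp_pos _).le) h3 (norm_nonneg _)
        (by positivity))
    intervalIntegrable_const
    (by
      refine Eventually.of_forall fun τ _ η _ => ?_
      refine HasDerivAt.mul_const (HasDerivAt.cexp ?_) _
      simpa using (hasDerivAt_id η).mul_const (τ : ℂ))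
  exact key.2.differentiableAt

section

variable {T m : ℝ} {u : ℝ → ℝ → ℝ → ℂ}

theorem SmoothDecaying.differentiable_tTransform (hu : SmoothDecaying T m u) (hm : 1 < m)
    {j : ℕ} (hj : j ≤ 4) (κ : ℝ) {t : ℝ} (ht : t ∈ Ioo 0 T) :
    Differentiable ℂ (fun η => tTransform (trace u j) κ η t) :=
  differentiable_integral_exp_mul ht.1.le
    ((hu.continuousOn_fourierX_trace hm hj κ).mono (Icc_subset_Icc_right ht.2.le))

theorem SmoothDecaying.differentiable_boundaryTerm (hu : SmoothDecaying T m u) (hm : 1 < m)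
    (κ : ℝ) {t : ℝ} (ht : t ∈ Ioo 0 T) : Differentiable ℂ (fun l => boundaryTerm u κ l t) := by
  have h : ∀ j ≤ 4, Differentiable ℂ
      (fun l : ℂ => tTransform (trace u j) κ (((κ : ℂ) ^ 2 + l ^ 2) ^ 2) t) := fun j hj =>
    (hu.differentiable_tTransform hm hj κ ht).comp (by fun_prop)
  have h0 := h 0 (by norm_num)
  have h1 := h 1 (by norm_num)
  have h2 := h 2 (by norm_num)
  have h3 := h 3 (by norm_num)
  unfold boundaryTerm
  fun_prop

/-! ### Growth of the time transforms and of the exponential kernel. -/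

theorem SmoothDecaying.exists_norm_tTransform_le (hu : SmoothDecaying T m u) (hm : 1 < m)
    {t : ℝ} (ht : t ∈ Ioo 0 T) :
    ∃ M : ℝ, 0 ≤ M ∧ ∀ j ≤ 4, ∀ (κ : ℝ) (η : ℂ), 0 ≤ η.re →
      ‖tTransform (trace u j) κ η t‖ ≤ M * Real.exp (η.re * t) := by
  obtain ⟨M, hM0, hM⟩ := hu.exists_norm_fourierX_trace_le hm
  have ht0 := ht.1
  refine ⟨M * t, by positivity, fun j hj κ η hη => ?_⟩
  have h := intervalIntegral.norm_integral_le_of_norm_le_const (a := 0) (b := t)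
    (f := fun τ : ℝ => Complex.exp (η * τ) * fourierX (trace u j) κ τ)
    (C := Real.exp (η.re * t) * M) (fun τ hτ => by
      rw [uIoc_of_le ht.1.le] at hτ
      rw [norm_mul]
      refine mul_le_mul ?_ (hM j hj κ τ ⟨hτ.1.le, hτ.2.trans ht.2.le⟩) (norm_nonneg _)
        (Real.exp_pos _).le
      rw [Complex.norm_exp]
      apply Real.exp_le_exp.2
      simp
      exact mul_le_mul_of_nonneg_left hτ.2 hη)
  refine h.trans (le_of_eq ?_)
  rw [sub_zero, abs_of_pos ht.1]
  ring

theorem norm_E (κ : ℝ) (l : ℂ) (x y t : ℝ) :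
    ‖E κ l x y t‖ = Real.exp (-((((κ : ℂ) ^ 2 + l ^ 2) ^ 2).re * t)) * Real.exp (-(y * l.im)) := by
  unfold E
  rw [Complex.norm_exp, ← Real.exp_add]
  congr 1
  have : (-((κ : ℂ) ^ 2 + l ^ 2) ^ 2 * t + Complex.I * κ * x + Complex.I * l * y).re
      = -(((((κ : ℂ) ^ 2 + l ^ 2) ^ 2).re) * t) + -(y * l.im) := by
    rw [Complex.add_re, Complex.add_re, Complex.re_mul_ofReal, Complex.neg_re]
    simp
    ring
  exact this

/-- The time transforms grow like `exp(t Re η)` when `Re η ≥ 0`, exactly compensated by `E`. What is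
left is a cubic polynomial, bounded by a fourth power for uniformity with the other estimates. -/
theorem SmoothDecaying.exists_norm_boundaryTerm_le (hu : SmoothDecaying T m u) (hm : 1 < m)
    {t : ℝ} (ht : t ∈ Ioo 0 T) (x y : ℝ) :
    ∃ K : ℝ, 0 ≤ K ∧ ∀ (κ : ℝ) (l : ℂ), 0 ≤ (((κ : ℂ) ^ 2 + l ^ 2) ^ 2).re →
      ‖E κ l x y t * boundaryTerm u κ l t‖
        ≤ K * (1 + ‖l‖ + |κ|) ^ 4 * Real.exp (-(y * l.im)) := by
  obtain ⟨M, hM0, hM⟩ := hu.exists_norm_tTransform_le hm ht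
  refine ⟨3 * M, by positivity, fun κ l hre => ?_⟩
  set η : ℂ := ((κ : ℂ) ^ 2 + l ^ 2) ^ 2 with hη
  set X := Real.exp (η.re * t) with hX
  set N := 1 + ‖l‖ + |κ| with hN
  have hl0 := norm_nonneg l
  have hk0 := abs_nonneg κ
  have hN1 : 1 ≤ N := by linarith
  have hX0 : 0 < X := Real.exp_pos _
  have h0 := hM 0 (by norm_num) κ η hre
  have h1 := hM 1 (by norm_num) κ η hre
  have h2 := hM 2 (by norm_num) κ η hre
  have h3 := hM 3 (by norm_num) κ η hre
  have hb : ‖boundaryTerm u κ l t‖ ≤ M * X * (3 * N ^ 4) := by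
    unfold boundaryTerm
    rw [← hη]
    have e1 : ‖l ^ 2 + 2 * (κ : ℂ) ^ 2‖ ≤ 2 * N ^ 2 := by
      refine (norm_add_le _ _).trans ?_
      simp only [norm_mul, norm_pow, Complex.norm_real, Real.norm_eq_abs, Complex.norm_ofNat]
      nlinarith
    have e2 : ∀ a b : ℂ, ‖a‖ ≤ M * X → ‖b‖ ≤ M * X → ‖a + Complex.I * l * b‖ ≤ M * X * N := by
      intro a b ha hb
      refine (norm_add_le _ _).trans ?_
      rw [norm_mul, norm_mul, Complex.norm_I, one_mul]
      have : ‖l‖ * ‖b‖ ≤ ‖l‖ * (M * X) := mul_le_mul_of_nonneg_left hb hl0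
      have h5 : 0 ≤ M * X := by positivity
      nlinarith
    refine (norm_sub_le _ _).trans ?_
    rw [norm_mul]
    have e3 := e2 _ _ h3 h2
    have e4 := e2 _ _ h1 h0
    have e5 := mul_le_mul e1 e4 (norm_nonneg _) (by positivity)
    have hMX : 0 ≤ M * X := by positivity
    have e6 : N + 2 * N ^ 2 * N ≤ 3 * N ^ 4 := by
      have a1 : N ≤ N ^ 4 := le_self_pow₀ hN1 (by norm_num)
      have a2 : N ^ 3 ≤ N ^ 4 := pow_le_pow_right₀ hN1 (by norm_num)
      nlinarith
    nlinarith [mul_le_mul_of_nonneg_left e6 hMX]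
  rw [norm_mul, norm_E, ← hη]
  have hXX : Real.exp (-(η.re * t)) * X = 1 := by rw [hX, ← Real.exp_add]; simp
  calc _ ≤ Real.exp (-(η.re * t)) * Real.exp (-(y * l.im)) * (M * X * (3 * N ^ 4)) := by gcongr
    _ = (Real.exp (-(η.re * t)) * X) * (3 * M * N ^ 4 * Real.exp (-(y * l.im))) := by ring
    _ = _ := by rw [hXX, one_mul]

/-! ### Elimination of the unknown boundary values -/

/-- The part of the boundary term that depends on the solution at time `t`. -/
def remainder (u : ℝ → ℝ → ℝ → ℂ) (κ : ℝ) (l : ℂ) (t : ℝ) : ℂ :=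
  halfFourier (fun x y => u x y t) κ (-l)
    + 2 * l * ((halfFourier (fun x y => u x y t) κ (-l)
      - halfFourier (fun x y => u x y t) κ (-nu κ l)) / (nu κ l - l))

theorem symbol_nu (κ : ℝ) (l : ℂ) :
    ((κ : ℂ) ^ 2 + (-nu κ l) ^ 2) ^ 2 = ((κ : ℂ) ^ 2 + l ^ 2) ^ 2 := by
  rw [neg_pow_two, nu_sq]
  ring

theorem SolvesIBVP.halfFourier_initial {u₀ g₀ g₁ : ℝ → ℝ → ℂ} (hs : SolvesIBVP T u u₀ g₀ g₁)
    (κ : ℝ) (l : ℂ) : halfFourier u₀ κ l = halfFourier (fun x y => u x y 0) κ l := by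
  unfold halfFourier
  congr 1 with x
  refine setIntegral_congr_fun measurableSet_Ioi fun y hy => ?_
  simp only [hs.initial x y hy]

/-- The data are prescribed only for `y > 0` and `0 < t < T`. This suffices because the transforms
integrate over the open half line in `y` and over `(0, t]` with `t < T`. -/
theorem SolvesIBVP.G_eq {u₀ g₀ g₁ : ℝ → ℝ → ℂ} (hs : SolvesIBVP T u u₀ g₀ g₁) {t : ℝ}
    (ht : t ∈ Ioo 0 T) (κ : ℝ) (l : ℂ) :
    G u₀ g₀ g₁ κ l t = G (fun x y => u x y 0) (trace u 0) (trace u 1) κ l t := by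
  have h2 : ∀ (g g' : ℝ → ℝ → ℂ), (∀ x, ∀ τ ∈ Ioo 0 T, g' x τ = g x τ) → ∀ η,
      tTransform g κ η t = tTransform g' κ η t := by
    intro g g' h η
    unfold tTransform
    refine intervalIntegral.integral_congr_ae (Eventually.of_forall fun τ hτ => ?_)
    rw [uIoc_of_le ht.1.le] at hτ
    unfold fourierX
    congr 2 with x
    rw [h x τ ⟨hτ.1, hτ.2.trans_lt ht.2⟩]
  unfold G
  simp only [hs.halfFourier_initial]
  rw [h2 g₀ (trace u 0) hs.dirichlet, h2 g₁ (trace u 1) hs.neumann]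

theorem boundaryTerm_eq {u₀ g₀ g₁ : ℝ → ℝ → ℂ} (hu : SmoothDecaying T m u) (hm : 2 < m)
    (hs : SolvesIBVP T u u₀ g₀ g₁) {t : ℝ} (ht : t ∈ Ioo 0 T) (κ : ℝ) {l : ℂ}
    (hl : 0 ≤ l.im) (hre : l.re ≠ 0) :
    boundaryTerm u κ l t = G u₀ g₀ g₁ κ l t
      + Complex.exp (((κ : ℂ) ^ 2 + l ^ 2) ^ 2 * t) * remainder u κ l t := by
  have hne : nu κ l - l ≠ 0 := sub_ne_zero.2 (nu_ne_self hre)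
  have r1 := global_relation hu hm hs ht κ (l := -l) (by simpa using hl)
  have r2 := global_relation hu hm hs ht κ (l := -nu κ l) (by simpa using nu_im_nonneg κ l)
  rw [hs.G_eq ht]
  unfold boundaryTerm at r1 r2
  rw [symbol_nu] at r2
  rw [neg_pow_two] at r1 r2
  unfold boundaryTerm G remainder
  set η : ℂ := ((κ : ℂ) ^ 2 + l ^ 2) ^ 2
  set X := Complex.exp (η * t)
  set ν := nu κ l with hν
  have hν2 : l ^ 2 + 2 * (κ : ℂ) ^ 2 = -ν ^ 2 := by rw [hν, nu_sq]; ring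
  have hν3 : ν ^ 2 + 2 * (κ : ℂ) ^ 2 = -l ^ 2 := by rw [hν, nu_sq]; ring
  rw [hν2] at r1 ⊢
  rw [hν3] at r2
  field_simp
  -- The unknown traces enter at `-l` and `-ν` as `g₃ - il g₂` and `g₃ - iν g₂`. The weights `(ν +
  -- l)/(ν - l)` and `-2l/(ν - l)` combine these to `g₃ + il g₂`. The coefficients used are these
  -- weights times `-(ν - l)`.
  linear_combination (-(ν + l)) * r1 + 2 * l * r2

/-- Since `remainder` is written with a difference quotient of the transform, the Lipschitz bound
cancels `ν - l`, and the estimate does not deteriorate near `i|κ|`. -/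
theorem SmoothDecaying.exists_norm_remainder_le (hu : SmoothDecaying T m u) (hm : 3 < m)
    {t : ℝ} (ht : t ∈ Icc 0 T) :
    ∃ K : ℝ, 0 ≤ K ∧ ∀ (κ : ℝ) (l : ℂ), 0 ≤ l.im → l.re ≠ 0 →
      ‖remainder u κ l t‖ ≤ K * (1 + ‖l‖ + |κ|) ^ 4 := by
  obtain ⟨C, hC0, hC⟩ := hu.exists_isDecaying
  have hw : IsDecaying C m (fun x y => u x y t) := hC 0 0 (by norm_num) t ht
  set A := C * ∫ q : ℝ × ℝ, (1 + |q.1| + |q.2|) ^ (-m) with hA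
  set L := C * ∫ q : ℝ × ℝ, |q.2| * (1 + |q.1| + |q.2|) ^ (-m) with hL
  have hA0 : 0 ≤ A := mul_nonneg hC0 (integral_nonneg fun q => by
    simp only [Pi.zero_apply]; positivity)
  have hL0 : 0 ≤ L := mul_nonneg hC0 (integral_nonneg fun q => by
    simp only [Pi.zero_apply]; positivity)
  refine ⟨A + 2 * L, by positivity, fun κ l hl hre => ?_⟩
  have hne : 0 < ‖nu κ l - l‖ := norm_pos_iff.2 (sub_ne_zero.2 (nu_ne_self hre))
  have h1 := hw.norm_halfFourier_le (by linarith) κ (l := -l) (by simpa using hl)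
  have h2 := hw.norm_halfFourier_sub_le hm κ (l := -l) (l' := -nu κ l) (by simpa using hl)
    (by simpa using nu_im_nonneg κ l)
  rw [show -l - -nu κ l = nu κ l - l by ring] at h2
  unfold remainder
  refine (norm_add_le _ _).trans ?_
  rw [norm_mul, norm_div, norm_mul, Complex.norm_ofNat]
  have h3 := (div_le_iff₀ hne).2 h2
  have hN1 : 1 ≤ 1 + ‖l‖ + |κ| := by linarith [norm_nonneg l, abs_nonneg κ]
  have h4 : 1 + ‖l‖ + |κ| ≤ (1 + ‖l‖ + |κ|) ^ 4 := le_self_pow₀ hN1 (by norm_num)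
  have h5 : 2 * ‖l‖ * (‖halfFourier (fun x y => u x y t) κ (-l)
      - halfFourier (fun x y => u x y t) κ (-nu κ l)‖ / ‖nu κ l - l‖) ≤ 2 * ‖l‖ * L := by gcongr
  have h6 : ‖l‖ ≤ (1 + ‖l‖ + |κ|) ^ 4 := by linarith [abs_nonneg κ]
  nlinarith [mul_le_mul_of_nonneg_left h6 hL0, mul_le_mul_of_nonneg_left (hN1.trans h4) hA0]

theorem SmoothDecaying.differentiableOn_remainder (hu : SmoothDecaying T m u) (hm : 3 < m)
    {t : ℝ} (ht : t ∈ Icc 0 T) (κ : ℝ) :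
    DifferentiableOn ℂ (fun l => remainder u κ l t) {l | l.re ≠ 0 ∧ 0 < l.im} := by
  obtain ⟨C, hC0, hC⟩ := hu.exists_isDecaying
  have hw : IsDecaying C m (fun x y => u x y t) := hC 0 0 (by norm_num) t ht
  rintro l ⟨hre, him⟩
  have hcut : l ∉ cut κ := fun h => hre h.1
  have hν : DifferentiableAt ℂ (nu κ) l := (analyticOnNhd_nu κ l hcut).differentiableAt
  have d1 : DifferentiableAt ℂ (fun l => halfFourier (fun x y => u x y t) κ (-l)) l :=
    (hw.differentiableAt_halfFourier hm κ (l := -l) (by simpa using him)).comp l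
      differentiableAt_id.neg
  have d2 : DifferentiableAt ℂ (fun l => halfFourier (fun x y => u x y t) κ (-nu κ l)) l :=
    DifferentiableAt.comp (g := halfFourier (fun x y => u x y t) κ) (f := fun l => -nu κ l) l
      (hw.differentiableAt_halfFourier hm κ (by simpa using nu_im_pos hcut)) hν.fun_neg
  have d3 : DifferentiableAt ℂ (fun l => (halfFourier (fun x y => u x y t) κ (-l)
      - halfFourier (fun x y => u x y t) κ (-nu κ l)) / (nu κ l - l)) l :=
    (d1.sub d2).div (hν.sub differentiableAt_id) (sub_ne_zero.2 (nu_ne_self hre))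
  exact (d1.add ((differentiableAt_id.const_mul 2).mul d3)).differentiableWithinAt

/-! ### The representation for fixed tangential frequency -/

theorem differentiable_E (κ x y t : ℝ) : Differentiable ℂ (fun l => E κ l x y t) := by
  unfold E
  fun_prop

theorem norm_E_mul_exp (κ : ℝ) (l : ℂ) (x y t : ℝ) (z : ℂ) :
    ‖E κ l x y t * (Complex.exp (((κ : ℂ) ^ 2 + l ^ 2) ^ 2 * t) * z)‖
      = Real.exp (-(y * l.im)) * ‖z‖ := by
  rw [norm_mul, norm_mul, norm_E, Complex.norm_exp, Complex.re_mul_ofReal]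
  rw [← mul_assoc, mul_right_comm (Real.exp _), ← Real.exp_add]
  simp

theorem integrableOn_arc_of_bound {κ σ τ y K : ℝ} (hσ : σ ∈ ({1, -1} : Set ℝ))
    (hτ : τ ∈ ({1, -1} : Set ℝ)) (hy : 0 < y) (hK : 0 ≤ K) {F : ℂ → ℂ}
    (hF : ContinuousOn (fun a => F (arc κ σ τ a)) (Ioi 0))
    (hb : ∀ r > 0, ‖F (arc κ σ τ r)‖
      ≤ K * (1 + ‖arc κ σ τ r‖ + |κ|) ^ 4 * Real.exp (-(y * (arc κ σ τ r).im))) :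
    IntegrableOn (fun a => F (arc κ σ τ a) * deriv (arc κ σ τ) a) (Ioi 0) := by
  obtain ⟨C, hC0, hC⟩ := exists_poly_mul_exp_le hy
  refine integrableOn_arc (K := K * C) (c := y / 20) hσ hτ (by positivity) hF fun r hr => ?_
  have h2 := hC κ r (arc κ σ τ r) hr.le
    (by simp [abs_mul, abs_eq_one_of_mem hσ, abs_of_pos hr]) (le_arc_im hτ hr.le)
    (arc_im_le hτ hr.le)
  refine (hb r hr).trans ?_
  rw [mul_assoc, mul_assoc]
  refine mul_le_mul_of_nonneg_left (h2.trans ?_) hK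
  gcongr
  linarith [abs_nonneg κ]

theorem arcIntegral_add_of_eqOn {κ σ τ : ℝ} {F F₁ F₂ : ℂ → ℂ}
    (h : ∀ a > 0, F (arc κ σ τ a) = F₁ (arc κ σ τ a) + F₂ (arc κ σ τ a))
    (hF : IntegrableOn (fun a => F (arc κ σ τ a) * deriv (arc κ σ τ) a) (Ioi 0))
    (hF₂ : IntegrableOn (fun a => F₂ (arc κ σ τ a) * deriv (arc κ σ τ) a) (Ioi 0)) :
    arcIntegral κ σ τ F = arcIntegral κ σ τ F₁ + arcIntegral κ σ τ F₂ := by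
  rw [← sub_eq_iff_eq_add]
  unfold arcIntegral
  rw [← integral_sub hF hF₂]
  refine setIntegral_congr_fun measurableSet_Ioi fun a ha => ?_
  simp only [h a ha]
  ring

theorem arc_re_ne_zero {κ σ τ a : ℝ} (hσ : σ ∈ ({1, -1} : Set ℝ)) (ha : 0 < a) :
    (arc κ σ τ a).re ≠ 0 := by
  rw [arc_re]
  rcases hσ with rfl | rfl <;> simp [ne_of_gt ha]

/-- The unknown values of the solution do not contribute to the boundary integral. -/
theorem boundaryIntegral_eq {u₀ g₀ g₁ : ℝ → ℝ → ℂ} (hu : SmoothDecaying T m u) (hm : 3 < m)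
    (hs : SolvesIBVP T u u₀ g₀ g₁) {t : ℝ} (ht : t ∈ Ioo 0 T) (κ x : ℝ) {y : ℝ} (hy : 0 < y) :
    boundaryIntegral κ (fun l => E κ l x y t * boundaryTerm u κ l t)
      = boundaryIntegral κ (fun l => E κ l x y t * G u₀ g₀ g₁ κ l t) := by
  have ht' : t ∈ Icc 0 T := ⟨ht.1.le, ht.2.le⟩
  obtain ⟨K, hK0, hK⟩ := hu.exists_norm_boundaryTerm_le (by linarith) ht x y
  obtain ⟨K', hK'0, hK'⟩ := hu.exists_norm_remainder_le hm ht'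
  -- The product has no time exponential left, so it stays controlled inside `D_κ⁺`, where `Re η <
  -- 0` and the bound for `boundaryTerm` fails to apply.
  set F₂ : ℂ → ℂ := fun l => E κ l x y t *
    (Complex.exp (((κ : ℂ) ^ 2 + l ^ 2) ^ 2 * t) * remainder u κ l t) with hF₂
  have hF₂d : ∀ σ ∈ ({1, -1} : Set ℝ),
      DifferentiableOn ℂ F₂ {l | 0 < σ * l.re ∧ 0 < l.im} := fun σ _ => by
    have h1 := (hu.differentiableOn_remainder hm ht' κ).mono
      (show {l : ℂ | 0 < σ * l.re ∧ 0 < l.im} ⊆ {l | l.re ≠ 0 ∧ 0 < l.im} from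
        fun l hl => ⟨fun h => by simp [h] at hl, hl.2⟩)
    exact (differentiable_E κ x y t).differentiableOn.mul
      (DifferentiableOn.mul (Differentiable.differentiableOn (by fun_prop)) h1)
  have hF₂b : ∀ l : ℂ, l.re ≠ 0 → 0 ≤ l.im →
      ‖F₂ l‖ ≤ K' * (1 + ‖l‖ + |κ|) ^ 4 * Real.exp (-(y * l.im)) := fun l h1 h2 => by
    rw [hF₂, norm_E_mul_exp, mul_comm]
    exact mul_le_mul_of_nonneg_right (hK' κ l h2 h1) (Real.exp_pos _).le
  have him : ∀ {σ τ : ℝ}, τ ∈ ({1, -1} : Set ℝ) → ∀ r > 0, 0 < (arc κ σ τ r).im :=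
    fun hτ r hr => lt_of_lt_of_le (by have := abs_nonneg κ; linarith) (le_arc_im hτ hr.le)
  have hsplit : ∀ σ ∈ ({1, -1} : Set ℝ), ∀ τ ∈ ({1, -1} : Set ℝ),
      arcIntegral κ σ τ (fun l => E κ l x y t * boundaryTerm u κ l t)
        = arcIntegral κ σ τ (fun l => E κ l x y t * G u₀ g₀ g₁ κ l t) + arcIntegral κ σ τ F₂ := by
    intro σ hσ τ hτ
    refine arcIntegral_add_of_eqOn (fun a ha => ?_) ?_ ?_
    · simp only [hF₂]
      rw [boundaryTerm_eq hu (by linarith) hs ht κ (him hτ a ha).le (arc_re_ne_zero hσ ha)]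
      ring
    · refine integrableOn_arc_of_bound (F := fun l => E κ l x y t * boundaryTerm u κ l t)
        hσ hτ hy hK0 ?_ fun r _ => ?_
      · exact (((differentiable_E κ x y t).mul
          (hu.differentiable_boundaryTerm (by linarith) κ ht)).continuous.comp
          (continuous_arc κ σ τ)).continuousOn
      · exact hK κ _ (re_symbol_arc hσ hτ r).ge
    · refine integrableOn_arc_of_bound hσ hτ hy hK'0 ?_ fun r hr => ?_
      · refine (hF₂d σ hσ).continuousOn.comp (continuous_arc κ σ τ).continuousOn fun r hr => ?_
        refine ⟨?_, him hτ r hr⟩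
        rw [arc_re, ← mul_assoc, ← pow_two, sq_eq_one_of_mem hσ, one_mul]
        exact hr
      · exact hF₂b _ (arc_re_ne_zero hσ hr) (him hτ r hr).le
  have hcancel : ∀ σ ∈ ({1, -1} : Set ℝ), arcIntegral κ σ 1 F₂ = arcIntegral κ σ (-1) F₂ :=
    fun σ hσ => arcIntegral_component_eq hσ hy hK'0 (hF₂d σ hσ) fun l h1 h2 =>
      hF₂b l (fun h => by simp [h] at h1) h2.le
  unfold boundaryIntegral
  rw [hsplit 1 (by simp) 1 (by simp), hsplit 1 (by simp) (-1) (by simp),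
    hsplit (-1) (by simp) 1 (by simp), hsplit (-1) (by simp) (-1) (by simp),
    hcancel 1 (by simp), hcancel (-1) (by simp)]
  ring

/-! ### The integrand on the real line. -/

theorem E_real_mul_eq {u₀ g₀ g₁ : ℝ → ℝ → ℂ} (hu : SmoothDecaying T m u) (hm : 2 < m)
    (hs : SolvesIBVP T u u₀ g₀ g₁) {t : ℝ} (ht : t ∈ Ioo 0 T) (κ x y l : ℝ) :
    E κ l x y t * halfFourier (fun x y => u x y 0) κ l + E κ l x y t * boundaryTerm u κ l t
      = Complex.exp (Complex.I * κ * x) * (Complex.exp (Complex.I * l * y)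
        * halfFourier (fun x y => u x y t) κ l) := by
  have h := global_relation hu hm hs ht κ (l := l) (by simp)
  rw [← mul_add, ← h]
  unfold E
  rw [← mul_assoc, ← mul_assoc, ← Complex.exp_add, ← Complex.exp_add]
  congr 2
  ring

theorem norm_E_real_le {κ l x y t : ℝ} (ht : 0 ≤ t) : ‖E κ l x y t‖ ≤ 1 := by
  rw [norm_E]
  have : 0 ≤ (((κ : ℂ) ^ 2 + (l : ℂ) ^ 2) ^ 2).re := by
    norm_cast
    positivity
  simp
  positivity

theorem symbol_real_re (κ l : ℝ) :
    (((κ : ℂ) ^ 2 + (l : ℂ) ^ 2) ^ 2).re = (κ ^ 2 + l ^ 2) ^ 2 := by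
  norm_cast

theorem norm_E_real (κ l x y t : ℝ) : ‖E κ l x y t‖ = Real.exp (-((κ ^ 2 + l ^ 2) ^ 2 * t)) := by
  rw [norm_E, symbol_real_re]
  simp

/-- The inequality is `ρ² ≥ 2ρ - 1` with `ρ = κ² + l²`. It replaces the quartic exponential by a
product of Gaussians. -/
theorem norm_E_real_le_gaussian {t : ℝ} (ht : 0 < t) (κ l x y : ℝ) :
    ‖E κ l x y t‖ ≤ Real.exp t * (Real.exp (-(2 * t) * κ ^ 2) * Real.exp (-(2 * t) * l ^ 2)) := by
  rw [norm_E_real, ← Real.exp_add, ← Real.exp_add]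
  apply Real.exp_le_exp.2
  nlinarith [mul_nonneg ht.le (sq_nonneg (κ ^ 2 + l ^ 2 - 1))]

theorem IsDecaying.continuous_halfFourier_real {C : ℝ} {w : ℝ → ℝ → ℂ} (hw : IsDecaying C m w)
    (hm : 2 < m) : Continuous (fun p : ℝ × ℝ => halfFourier w p.1 (p.2 : ℂ)) := by
  have h : ∀ p : ℝ × ℝ, halfFourier w p.1 (p.2 : ℂ)
      = ∫ q in (univ : Set ℝ) ×ˢ Ioi (0 : ℝ),
        Complex.exp (-Complex.I * q.1 * p.1 - Complex.I * q.2 * p.2) * w q.1 q.2 := fun p =>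
    hw.halfFourier_eq hm p.1 (by simp)
  simp_rw [h]
  refine continuous_of_dominated (bound := fun q => C * (1 + |q.1| + |q.2|) ^ (-m))
    (fun p => (hw.integrable_prod hm p.1 (l := (p.2 : ℂ)) (by simp)).aestronglyMeasurable)
    (fun p => ?_) ((integrable_decay hm).const_mul C).integrableOn
    (Eventually.of_forall fun q => by fun_prop)
  filter_upwards [ae_restrict_mem (MeasurableSet.univ.prod measurableSet_Ioi)] with q hq
  have hq2 : 0 ≤ q.2 := le_of_lt hq.2
  rw [norm_mul, ← one_mul (C * _)]
  exact mul_le_mul (norm_exp_halfFourier_le p.1 q.1 hq2 (by simp)) (hw.bound _ _ hq2)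
    (norm_nonneg _) zero_le_one

theorem SmoothDecaying.integrable_E_mul_halfFourier (hu : SmoothDecaying T m u) (hm : 2 < m)
    {t : ℝ} (ht : t ∈ Ioo 0 T) (x y : ℝ) :
    Integrable (fun p : ℝ × ℝ => E p.1 p.2 x y t * halfFourier (fun x y => u x y 0) p.1 p.2) := by
  obtain ⟨C, hC0, hC⟩ := hu.exists_isDecaying
  have hw : IsDecaying C m (fun x y => u x y 0) :=
    hC 0 0 (by norm_num) 0 ⟨le_rfl, (ht.1.trans ht.2).le⟩
  set A := C * ∫ q : ℝ × ℝ, (1 + |q.1| + |q.2|) ^ (-m) with hA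
  have hA0 : 0 ≤ A := mul_nonneg hC0 (integral_nonneg fun q => by
    simp only [Pi.zero_apply]; positivity)
  have ht2 : 0 < 2 * t := by linarith [ht.1]
  have hg : Integrable (fun p : ℝ × ℝ => Real.exp (-(2 * t) * p.1 ^ 2)
      * Real.exp (-(2 * t) * p.2 ^ 2)) :=
    (integrable_exp_neg_mul_sq ht2).mul_prod (integrable_exp_neg_mul_sq ht2)
  refine ((hg.const_mul (Real.exp t)).mul_const A).mono'
    (Continuous.aestronglyMeasurable ?_) (Eventually.of_forall fun p => ?_)
  · have := hw.continuous_halfFourier_real hm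
    unfold E
    fun_prop
  · rw [norm_mul]
    exact mul_le_mul (norm_E_real_le_gaussian ht.1 _ _ _ _)
      (hw.norm_halfFourier_le hm p.1 (by simp)) (norm_nonneg _) (by positivity)

/-- The representation for fixed tangential frequency. -/
theorem representation_fixed_frequency {u₀ g₀ g₁ : ℝ → ℝ → ℂ} (hu : SmoothDecaying T m u)
    (hm : 3 < m) (hs : SolvesIBVP T u u₀ g₀ g₁) {t : ℝ} (ht : t ∈ Ioo 0 T) (κ x : ℝ) {y : ℝ}
    (hy : 0 < y) :
    2 * Real.pi * (Complex.exp (Complex.I * κ * x)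
        * ∫ s : ℝ, Complex.exp (-Complex.I * s * κ) * u s y t)
      = (∫ l : ℝ, E κ l x y t * halfFourier (fun x y => u x y 0) κ l)
        + boundaryIntegral κ (fun l => E κ l x y t * G u₀ g₀ g₁ κ l t) := by
  have ht' : t ∈ Icc 0 T := ⟨ht.1.le, ht.2.le⟩
  have hm2 : 2 < m := by linarith
  obtain ⟨C, hC0, hC⟩ := hu.exists_isDecaying
  have hw : IsDecaying C m (fun x y => u x y t) := hC 0 0 (by norm_num) t ht'
  have hw0 : IsDecaying C m (fun x y => u x y 0) :=
    hC 0 0 (by norm_num) 0 ⟨le_rfl, (ht.1.trans ht.2).le⟩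
  set v : ℝ → ℂ := fun s => ∫ r : ℝ, Complex.exp (-Complex.I * r * κ) * u r s t with hv
  -- Extension by zero may jump at the origin, so the transform of `f` need not be integrable in
  -- `l`.
  set f : ℝ → ℂ := indicator (Ioi 0) v with hf
  -- the Fourier transform of `f` is the half space transform
  have hfi : Integrable f := by
    rw [hf, integrable_indicator_iff measurableSet_Ioi]
    have h1 := hw.integrable_prod hm2 κ (l := 0) (by simp)
    rw [volume_restrict_halfPlane] at h1
    have h2 := h1.integral_prod_right
    refine h2.congr (Eventually.of_forall fun s => ?_)
    simp only [hv, mul_zero, sub_zero]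
  have hfc : ContinuousAt f y := by
    have hvc : ContinuousOn v (Ici 0) := by
      refine continuousOn_of_dominated (bound := fun x => C * (1 + |x|) ^ (-m)) ?_ ?_
        ((integrable_decay_line (by linarith)).const_mul C) ?_
      · intro s hs
        exact (hw.integrable_x (by linarith) κ hs).aestronglyMeasurable
      · refine fun s hs => Eventually.of_forall fun r => ?_
        rw [norm_mul, norm_exp_fourierX, one_mul]
        exact hw.bound_x (by linarith) r hs
      · exact Eventually.of_forall fun r => continuousOn_const.mul (hw.continuousOn_y r)
    have h1 : ContinuousAt v y := hvc.continuousAt (Ici_mem_nhds hy)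
    refine h1.congr ?_
    filter_upwards [Ioi_mem_nhds hy] with s hs
    rw [hf, indicator_of_mem hs]
  have hft : ∀ l : ℝ, ∫ s : ℝ, Complex.exp (-Complex.I * s * l) * f s
      = halfFourier (fun x y => u x y t) κ l := fun l => by
    rw [hw.halfFourier_eq_swap hm2 κ (by simp), ← integral_indicator measurableSet_Ioi]
    congr 1 with s
    by_cases hs : s ∈ Ioi (0 : ℝ)
    · rw [indicator_of_mem hs, hf, indicator_of_mem hs, hv, ← integral_const_mul]
      congr 1 with r
      rw [← mul_assoc, ← Complex.exp_add]
      congr 2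
      ring
    · rw [indicator_of_notMem hs, hf, indicator_of_notMem hs, mul_zero]
  have lim1 := (tendsto_gaussian_inversion hfi hfc).const_mul (Complex.exp (Complex.I * κ * x))
  simp only [hft] at lim1
  have hfy : f y = v y := indicator_of_mem (show y ∈ Ioi (0 : ℝ) from hy) v
  -- the pieces
  set F : ℂ → ℂ := fun l => E κ l x y t * boundaryTerm u κ l t with hF
  have hFd : Differentiable ℂ F :=
    (differentiable_E κ x y t).mul (hu.differentiable_boundaryTerm (by linarith) κ ht)
  obtain ⟨K, hK0, hK⟩ := hu.exists_norm_boundaryTerm_le (by linarith) ht x y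
  have ic : Continuous (fun l : ℝ => E κ l x y t * halfFourier (fun x y => u x y 0) κ l) := by
    have h1 : Continuous (fun l : ℝ => halfFourier (fun x y => u x y 0) κ (l : ℂ)) :=
      (hw0.continuous_halfFourier_real hm2).comp (f := fun l : ℝ => (κ, l)) (by fun_prop)
    unfold E
    fun_prop
  set A := C * ∫ q : ℝ × ℝ, (1 + |q.1| + |q.2|) ^ (-m) with hA
  have i0 : Integrable (fun l : ℝ => E κ l x y t * halfFourier (fun x y => u x y 0) κ l) := by
    have ht2 : 0 < 2 * t := by linarith [ht.1]
    have hg := (((integrable_exp_neg_mul_sq ht2).const_mul (Real.exp (-(2 * t) * κ ^ 2))).const_mul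
      (Real.exp t)).mul_const A
    refine hg.mono' ic.aestronglyMeasurable (Eventually.of_forall fun l => ?_)
    rw [norm_mul]
    exact mul_le_mul (norm_E_real_le_gaussian ht.1 _ _ _ _)
      (hw0.norm_halfFourier_le hm2 κ (by simp)) (norm_nonneg _) (by positivity)
  -- On the real axis the global relation expresses `F` through the transforms at times `0` and `t`,
  -- which are bounded. With the Gaussian factor it becomes integrable.
  have hFbound : ∀ l : ℝ, ‖F l‖ ≤ A + A := fun l => by
    have h1 := E_real_mul_eq hu hm2 hs ht κ x y l
    have h2 : F l = Complex.exp (Complex.I * κ * x) * (Complex.exp (Complex.I * l * y)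
        * halfFourier (fun x y => u x y t) κ l)
        - E κ l x y t * halfFourier (fun x y => u x y 0) κ l := by
      rw [← h1]; ring
    rw [h2]
    refine (norm_sub_le _ _).trans (add_le_add ?_ ?_)
    · rw [norm_mul, norm_mul, Complex.norm_exp, Complex.norm_exp]
      simpa using hw.norm_halfFourier_le hm2 κ (l := (l : ℂ)) (by simp)
    · rw [norm_mul]
      refine (mul_le_mul (norm_E_real_le ht.1.le) (hw0.norm_halfFourier_le hm2 κ (by simp))
        (norm_nonneg _) zero_le_one).trans (by rw [one_mul])
  have hFg : ∀ c > 0, Integrable (fun l : ℝ => Complex.exp (-((c⁻¹ : ℝ) : ℂ) * (l : ℂ) ^ 2)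
      * F l) := fun c hc => by
    have hg := (integrable_exp_neg_mul_sq (inv_pos.2 hc)).mul_const (A + A)
    have := hFd.continuous
    refine hg.mono' (Continuous.aestronglyMeasurable (by fun_prop))
      (Eventually.of_forall fun l => ?_)
    rw [norm_mul, norm_exp_neg_mul_sq]
    refine mul_le_mul (le_of_eq ?_) (hFbound l) (norm_nonneg _) (Real.exp_pos _).le
    simp
  have lim2 : Tendsto (fun c : ℝ => ∫ l : ℝ, Complex.exp (-((c⁻¹ : ℝ) : ℂ) * (l : ℂ) ^ 2)
      * (E κ l x y t * halfFourier (fun x y => u x y 0) κ l)) atTop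
      (𝓝 (∫ l : ℝ, E κ l x y t * halfFourier (fun x y => u x y 0) κ l)) := by
    refine (Real.tendsto_integral_cexp_sq_smul i0).congr fun c => ?_
    congr 1 with l
    rw [smul_eq_mul]
    congr 2
    rw [Real.norm_eq_abs, ← Complex.ofReal_pow, sq_abs]
    push_cast
    ring
  have iarc : ∀ σ ∈ ({1, -1} : Set ℝ),
      IntegrableOn (fun a => F (arc κ σ (-1) a) * deriv (arc κ σ (-1)) a) (Ioi 0) := by
    intro σ hσ
    refine integrableOn_arc_of_bound hσ (by simp) hy hK0
      (hFd.continuous.comp (continuous_arc κ σ (-1))).continuousOn fun r _ => ?_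
    exact hK κ _ (re_symbol_arc hσ (by simp) r).ge
  have lim3 : Tendsto (fun c : ℝ => ∫ l : ℝ, Complex.exp (-((c⁻¹ : ℝ) : ℂ) * (l : ℂ) ^ 2)
      * F l) atTop (𝓝 (-arcIntegral κ (-1) (-1) F + arcIntegral κ 1 (-1) F)) := by
    refine ((tendsto_arcIntegral_gaussian (by simp) (iarc (-1) (by simp))).neg.add
      (tendsto_arcIntegral_gaussian (by simp) (iarc 1 (by simp)))).congr' ?_
    filter_upwards [eventually_gt_atTop 0] with c hc
    refine (integral_eq_arcIntegral_lower
      (F := fun l => Complex.exp (-((c⁻¹ : ℝ) : ℂ) * l ^ 2) * F l)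
      hy (inv_pos.2 hc) hK0 ?_ (fun l hl0 hl1 => ?_) (hFg c hc)).symm
    · fun_prop
    · rw [norm_mul, norm_exp_neg_mul_sq, mul_comm]
      refine mul_le_mul_of_nonneg_right (hK κ l (re_symbol_nonneg hl0 ?_)) (Real.exp_pos _).le
      rw [abs_sub_comm]
      exact le_trans (by linarith) (le_abs_self _)
  -- The upper arcs carry opposite orientations in `∂D_κ⁺`, so equality of the two outward integrals
  -- lets them be added to the lower arcs for free.
  have hupper : arcIntegral κ 1 1 F = arcIntegral κ (-1) 1 F := by
    refine arcIntegral_upper_eq hy hK0 hFd fun l hl => hK κ l (re_symbol_nonneg ?_ ?_)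
    · exact le_trans (by positivity) hl
    · exact le_trans (by linarith) (le_abs_self _)
  have hsum : (fun c : ℝ => (∫ l : ℝ, Complex.exp (-((c⁻¹ : ℝ) : ℂ) * (l : ℂ) ^ 2)
      * (E κ l x y t * halfFourier (fun x y => u x y 0) κ l))
      + ∫ l : ℝ, Complex.exp (-((c⁻¹ : ℝ) : ℂ) * (l : ℂ) ^ 2) * F l) =ᶠ[atTop]
      (fun c : ℝ => Complex.exp (Complex.I * κ * x) * ∫ l : ℝ,
        Complex.exp (-((c⁻¹ : ℝ) : ℂ) * (l : ℂ) ^ 2) * (Complex.exp (Complex.I * l * y)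
          * halfFourier (fun x y => u x y t) κ l)) := by
    filter_upwards [eventually_gt_atTop 0] with c hc
    have i1 : Integrable (fun l : ℝ => Complex.exp (-((c⁻¹ : ℝ) : ℂ) * (l : ℂ) ^ 2)
        * (E κ l x y t * halfFourier (fun x y => u x y 0) κ l)) := by
      refine i0.bdd_mul (c := 1) (Continuous.aestronglyMeasurable (by fun_prop))
        (Eventually.of_forall fun l => ?_)
      rw [norm_exp_neg_mul_sq]
      simp
      positivity
    rw [← integral_add i1 (hFg c hc), ← integral_const_mul]
    congr 1 with l
    rw [← mul_add, hF, E_real_mul_eq hu hm2 hs ht κ x y l]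
    ring
  have huniq := tendsto_nhds_unique ((lim2.add lim3).congr' hsum) lim1
  rw [hfy] at huniq
  rw [← boundaryIntegral_eq hu hm hs ht κ x hy]
  unfold boundaryIntegral
  rw [← hF, hupper]
  linear_combination -huniq

/-! ### Measurability of the transforms -/

theorem stronglyMeasurable_halfFourier {w : ℝ → ℝ → ℂ}
    (hw : Measurable (fun q : ℝ × ℝ => w q.1 q.2)) :
    StronglyMeasurable (fun p : ℝ × ℂ => halfFourier w p.1 p.2) := by
  unfold halfFourier
  refine StronglyMeasurable.integral_prod_right (f := fun (p : ℝ × ℂ) (x : ℝ) =>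
    ∫ y in Ioi (0 : ℝ), Complex.exp (-Complex.I * x * p.1 - Complex.I * y * p.2) * w x y) ?_
  refine StronglyMeasurable.integral_prod_right (f := fun (p : (ℝ × ℂ) × ℝ) (y : ℝ) =>
    Complex.exp (-Complex.I * p.2 * p.1.1 - Complex.I * y * p.1.2) * w p.2 y) ?_
  refine Measurable.stronglyMeasurable ?_
  have h : Measurable (fun z : ((ℝ × ℂ) × ℝ) × ℝ => w z.1.2 z.2) :=
    hw.comp (f := fun z : ((ℝ × ℂ) × ℝ) × ℝ => (z.1.2, z.2)) (by fun_prop)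
  unfold Function.uncurry
  fun_prop

/-- Nothing is known about `w` outside the closed half plane. Replacing it by zero off the open half
plane gives a jointly measurable function with the same transform. -/
theorem IsDecaying.stronglyMeasurable_halfFourier {C : ℝ} {w : ℝ → ℝ → ℂ}
    (hw : IsDecaying C m w) : StronglyMeasurable (fun p : ℝ × ℂ => halfFourier w p.1 p.2) := by
  classical
  have hmeas := ContinuousOn.measurable_piecewise (s := (univ : Set ℝ) ×ˢ Ioi (0 : ℝ))
    (hw.continuousOn.mono (prod_mono le_rfl Ioi_subset_Ici_self))
    (continuousOn_const (c := (0 : ℂ))) (MeasurableSet.univ.prod measurableSet_Ioi)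
  have h := HalfSpaceHeat.stronglyMeasurable_halfFourier (w := fun x y =>
    ((univ : Set ℝ) ×ˢ Ioi (0 : ℝ)).piecewise (fun q : ℝ × ℝ => w q.1 q.2) (fun _ => 0) (x, y))
    hmeas
  convert! h using 2 with p
  unfold halfFourier
  congr 1 with x
  refine setIntegral_congr_fun measurableSet_Ioi fun y hy => ?_
  simp only
  rw [piecewise_eq_of_mem _ _ _ (show (x, y) ∈ (univ : Set ℝ) ×ˢ Ioi (0 : ℝ) from
    ⟨mem_univ _, hy⟩)]

theorem stronglyMeasurable_tTransform {g : ℝ → ℝ → ℂ}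
    (hg : Measurable (fun q : ℝ × ℝ => g q.1 q.2)) {t : ℝ} (ht : 0 ≤ t) :
    StronglyMeasurable (fun p : ℝ × ℂ => tTransform g p.1 p.2 t) := by
  unfold tTransform fourierX
  simp only [intervalIntegral.integral_of_le ht]
  refine StronglyMeasurable.integral_prod_right (f := fun (p : ℝ × ℂ) (τ : ℝ) =>
    Complex.exp (p.2 * τ) * ∫ x : ℝ, Complex.exp (-Complex.I * x * p.1) * g x τ) ?_
  unfold Function.uncurry
  refine StronglyMeasurable.mul (Measurable.stronglyMeasurable (by fun_prop)) ?_
  refine StronglyMeasurable.integral_prod_right (f := fun (p : (ℝ × ℂ) × ℝ) (x : ℝ) =>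
    Complex.exp (-Complex.I * x * p.1.1) * g x p.2) ?_
  refine Measurable.stronglyMeasurable ?_
  have h : Measurable (fun z : ((ℝ × ℂ) × ℝ) × ℝ => g z.2 z.1.2) :=
    hg.comp (f := fun z : ((ℝ × ℂ) × ℝ) × ℝ => (z.2, z.1.2)) (by fun_prop)
  unfold Function.uncurry
  fun_prop

theorem SmoothDecaying.stronglyMeasurable_tTransform (hu : SmoothDecaying T m u) {j : ℕ}
    (hj : j ≤ 4) {t : ℝ} (ht : t ∈ Ioo 0 T) :
    StronglyMeasurable (fun p : ℝ × ℂ => tTransform (trace u j) p.1 p.2 t) := by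
  classical
  have hc : ContinuousOn (fun q : ℝ × ℝ => trace u j q.1 q.2) (univ ×ˢ Icc 0 T) :=
    (hu.continuousOn 0 j (by omega)).comp (f := fun q : ℝ × ℝ => (q.1, 0, q.2)) (by fun_prop)
      (fun q hq => ⟨mem_univ _, self_mem_Ici, hq.2⟩)
  have hmeas := ContinuousOn.measurable_piecewise hc (continuousOn_const (c := (0 : ℂ)))
    (MeasurableSet.univ.prod measurableSet_Icc)
  have h := HalfSpaceHeat.stronglyMeasurable_tTransform (g := fun x τ =>
    ((univ : Set ℝ) ×ˢ Icc 0 T).piecewise (fun q : ℝ × ℝ => trace u j q.1 q.2) (fun _ => 0) (x, τ))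
    hmeas ht.1.le
  convert! h using 2 with p
  unfold tTransform
  refine intervalIntegral.integral_congr_ae (Eventually.of_forall fun τ hτ => ?_)
  rw [uIoc_of_le ht.1.le] at hτ
  unfold fourierX
  congr 2 with x
  beta_reduce
  rw [piecewise_eq_of_mem _ _ _ (show (x, τ) ∈ (univ : Set ℝ) ×ˢ Icc 0 T from
    ⟨mem_univ _, hτ.1.le, hτ.2.trans ht.2.le⟩)]

theorem SmoothDecaying.measurable_G (hu : SmoothDecaying T m u) {t : ℝ} (ht : t ∈ Ioo 0 T) :
    Measurable (fun p : ℝ × ℂ => G (fun x y => u x y 0) (trace u 0) (trace u 1) p.1 p.2 t) := by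
  obtain ⟨C, -, hC⟩ := hu.exists_isDecaying
  have hw : IsDecaying C m (fun x y => u x y 0) :=
    hC 0 0 (by norm_num) 0 ⟨le_rfl, (ht.1.trans ht.2).le⟩
  have hν := measurable_nu
  have h1 : Measurable (fun p : ℝ × ℂ => halfFourier (fun x y => u x y 0) p.1 (-p.2)) :=
    hw.stronglyMeasurable_halfFourier.measurable.comp (f := fun p : ℝ × ℂ => (p.1, -p.2))
      (by fun_prop)
  have h2 : Measurable (fun p : ℝ × ℂ => halfFourier (fun x y => u x y 0) p.1 (-nu p.1 p.2)) :=
    hw.stronglyMeasurable_halfFourier.measurable.comp (f := fun p : ℝ × ℂ => (p.1, -nu p.1 p.2))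
      (by fun_prop)
  have h3 : ∀ j ≤ 4, Measurable (fun p : ℝ × ℂ =>
      tTransform (trace u j) p.1 (((p.1 : ℂ) ^ 2 + p.2 ^ 2) ^ 2) t) := fun j hj =>
    (hu.stronglyMeasurable_tTransform hj ht).measurable.comp
      (f := fun p : ℝ × ℂ => (p.1, ((p.1 : ℂ) ^ 2 + p.2 ^ 2) ^ 2)) (by fun_prop)
  have h4 := h3 0 (by norm_num)
  have h5 := h3 1 (by norm_num)
  unfold G
  fun_prop

/-! ### Absolute convergence and the representation formula -/

theorem integrable_exp_neg_mul_abs {c : ℝ} (hc : 0 < c) :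
    Integrable (fun s : ℝ => Real.exp (-c * |s|)) := by
  have h1 : IntegrableOn (fun s : ℝ => Real.exp (-c * |s|)) (Ioi 0) :=
    (exp_neg_integrableOn_Ioi 0 hc).congr_fun
      (fun s hs => by rw [abs_of_pos (show 0 < s from hs)]) measurableSet_Ioi
  have h2 : IntegrableOn (fun s : ℝ => Real.exp (-c * |s|)) (Iic 0) :=
    (integrableOn_exp_mul_Iic hc 0).congr_fun
      (fun s hs => by rw [abs_of_nonpos (show s ≤ 0 from hs), neg_mul_neg]) measurableSet_Iic
  rw [← integrableOn_univ, ← Iic_union_Ioi (a := (0 : ℝ))]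
  exact h2.union h1

theorem boundaryIntegrable_E_mul_G {u₀ g₀ g₁ : ℝ → ℝ → ℂ} (hu : SmoothDecaying T m u)
    (hm : 3 < m) (hs : SolvesIBVP T u u₀ g₀ g₁) {t : ℝ} (ht : t ∈ Ioo 0 T) (x : ℝ) {y : ℝ}
    (hy : 0 < y) : BoundaryIntegrable (fun κ l => E κ l x y t * G u₀ g₀ g₁ κ l t) := by
  intro σ hσ τ hτ
  have ht' : t ∈ Icc 0 T := ⟨ht.1.le, ht.2.le⟩
  obtain ⟨K, hK0, hK⟩ := hu.exists_norm_boundaryTerm_le (by linarith) ht x y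
  obtain ⟨K', hK'0, hK'⟩ := hu.exists_norm_remainder_le hm ht'
  obtain ⟨C, hC0, hC⟩ := exists_poly_mul_exp_le hy
  have hy20 : 0 < y / 20 := by positivity
  have hdom : IntegrableOn (fun p : ℝ × ℝ => (K + K') * C * 4 * (Real.exp (-(y / 20) * |p.1|)
      * Real.exp (-(y / 20) * p.2))) (univ ×ˢ Ioi 0) := by
    unfold IntegrableOn
    rw [volume_restrict_halfPlane]
    refine Integrable.const_mul (Integrable.mul_prod
      (f := fun κ : ℝ => Real.exp (-(y / 20) * |κ|)) (g := fun a : ℝ => Real.exp (-(y / 20) * a))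
      ?_ (exp_neg_integrableOn_Ioi 0 hy20)) _
    exact integrable_exp_neg_mul_abs hy20
  refine hdom.mono' ?_ ?_
  · refine AEStronglyMeasurable.mul (Measurable.aestronglyMeasurable ?_)
      (aestronglyMeasurable_deriv_arc σ τ)
    have harc := measurable_arc σ τ
    have hG : Measurable (fun p : ℝ × ℝ => G (fun x y => u x y 0) (trace u 0) (trace u 1) p.1
        (arc p.1 σ τ p.2) t) :=
      (hu.measurable_G ht).comp (f := fun p : ℝ × ℝ => (p.1, arc p.1 σ τ p.2)) (by fun_prop)
    simp only [hs.G_eq ht]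
    unfold E
    fun_prop
  · filter_upwards [ae_restrict_mem (MeasurableSet.univ.prod measurableSet_Ioi)] with p hp
    obtain ⟨κ, a⟩ := p
    have ha : 0 < a := hp.2
    set l := arc κ σ τ a with hl
    have him := le_arc_im (κ := κ) (σ := σ) hτ ha.le
    rw [← hl] at him
    have him0 : 0 ≤ l.im := by linarith [abs_nonneg κ]
    have hre : l.re ≠ 0 := arc_re_ne_zero hσ ha
    have hb := boundaryTerm_eq hu (by linarith) hs ht κ him0 hre
    -- Estimating `G` as a difference avoids its individually singular terms at `ν = l`, since both
    -- `boundaryTerm` and `remainder` have uniform polynomial bounds after multiplication by `E` and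
    -- `E * exp(ηt)` respectively.
    have h1 : E κ l x y t * G u₀ g₀ g₁ κ l t = E κ l x y t * boundaryTerm u κ l t
        - E κ l x y t * (Complex.exp (((κ : ℂ) ^ 2 + l ^ 2) ^ 2 * t) * remainder u κ l t) := by
      rw [hb]; ring
    have h2 : ‖E κ l x y t * G u₀ g₀ g₁ κ l t‖
        ≤ (K + K') * ((1 + ‖l‖ + |κ|) ^ 4 * Real.exp (-(y * l.im))) := by
      rw [h1]
      refine (norm_sub_le _ _).trans ?_
      rw [norm_E_mul_exp]
      have h3 := hK κ l (by rw [hl, re_symbol_arc hσ hτ])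
      have h4 := mul_le_mul_of_nonneg_left (hK' κ l him0 hre) (Real.exp_pos (-(y * l.im))).le
      linarith
    have h5 := hC κ a l ha.le (by simp [hl, abs_mul, abs_eq_one_of_mem hσ, abs_of_pos ha]) him
      (arc_im_le hτ ha.le)
    rw [norm_mul]
    calc _ ≤ (K + K') * (C * Real.exp (-(y / 20 * (|κ| + a)))) * 4 :=
          mul_le_mul (h2.trans (mul_le_mul_of_nonneg_left h5 (by positivity)))
            (norm_deriv_arc_le hσ hτ ha) (norm_nonneg _) (by positivity)
      _ = (K + K') * C * 4 * (Real.exp (-(y / 20) * |κ|) * Real.exp (-(y / 20) * a)) := by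
          rw [← Real.exp_add, show -(y / 20) * |κ| + -(y / 20) * a = -(y / 20 * (|κ| + a)) by ring]
          ring

theorem BoundaryIntegrable.integrable_boundaryIntegral {F : ℝ → ℂ → ℂ}
    (hF : BoundaryIntegrable F) : Integrable (fun κ => boundaryIntegral κ (F κ)) := by
  have h : ∀ σ ∈ ({1, -1} : Set ℝ), ∀ τ ∈ ({1, -1} : Set ℝ),
      Integrable (fun κ => arcIntegral κ σ τ (F κ)) := fun σ hσ τ hτ => by
    have h1 := hF σ hσ τ hτ
    unfold IntegrableOn at h1
    rw [volume_restrict_halfPlane] at h1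
    exact h1.integral_prod_left
  exact ((h 1 (by simp) 1 (by simp)).neg.add (h 1 (by simp) (-1) (by simp))).add
    ((h (-1) (by simp) (-1) (by simp)).neg.add (h (-1) (by simp) 1 (by simp)))

theorem representation_formula {u₀ g₀ g₁ : ℝ → ℝ → ℂ} (hu : SmoothDecaying T m u)
    (hm : 3 < m) (hs : SolvesIBVP T u u₀ g₀ g₁) {t : ℝ} (ht : t ∈ Ioo 0 T) (x : ℝ) {y : ℝ}
    (hy : 0 < y) :
    u x y t = 1 / (2 * (Real.pi : ℂ)) ^ 2 *
        (∫ κ : ℝ, ∫ l : ℝ, E κ l x y t * halfFourier (fun x y => u x y 0) κ l) +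
      1 / (2 * (Real.pi : ℂ)) ^ 2 *
        (∫ κ : ℝ, boundaryIntegral κ (fun l => E κ l x y t * G u₀ g₀ g₁ κ l t)) := by
  have ht' : t ∈ Icc 0 T := ⟨ht.1.le, ht.2.le⟩
  obtain ⟨C, hC0, hC⟩ := hu.exists_isDecaying
  have hw : IsDecaying C m (fun x y => u x y t) := hC 0 0 (by norm_num) t ht'
  have hpi : (Real.pi : ℂ) ≠ 0 := by exact_mod_cast Real.pi_ne_zero
  have iA : Integrable (fun κ : ℝ =>
      ∫ l : ℝ, E κ l x y t * halfFourier (fun x y => u x y 0) κ l) := by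
    have h1 := hu.integrable_E_mul_halfFourier (by linarith) ht x y
    rw [Measure.volume_eq_prod] at h1
    exact h1.integral_prod_left
  have iB := (boundaryIntegrable_E_mul_G hu hm hs ht x hy).integrable_boundaryIntegral
  have hrep := fun κ : ℝ => representation_fixed_frequency hu hm hs ht κ x hy
  have iV : Integrable (fun κ : ℝ => Complex.exp (Complex.I * κ * x)
      * ∫ s : ℝ, Complex.exp (-Complex.I * s * κ) * u s y t) := by
    -- Integrability in `κ` of the tangential transform is a consequence of the formula at fixed
    -- frequency, whose right side has just been shown integrable. No further smoothness in `x` is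
    -- invoked.
    refine ((iA.add iB).const_mul (2 * Real.pi : ℂ)⁻¹).congr (Eventually.of_forall fun κ => ?_)
    simp only [Pi.add_apply]
    rw [← hrep κ, ← mul_assoc, inv_mul_cancel₀ (by simp [hpi]), one_mul]
  have iV' : Integrable (fun κ : ℝ => ∫ s : ℝ, Complex.exp (-Complex.I * s * κ) * u s y t) := by
    have h1 := iV.bdd_mul (f := fun κ : ℝ => Complex.exp (-(Complex.I * κ * x))) (c := 1)
      (Continuous.aestronglyMeasurable (by fun_prop)) (Eventually.of_forall fun κ => by
        rw [Complex.norm_exp]; simp)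
    refine h1.congr (Eventually.of_forall fun κ => ?_)
    simp only
    rw [← mul_assoc, ← Complex.exp_add]
    simp
  have hint : Integrable (fun s => u s y t) := by
    simpa using hw.integrable_x (by linarith) 0 hy.le
  have hinv := fourier_inversion_line hint (hw.continuous_x hy.le) iV' x
  have hsum : (2 * Real.pi : ℂ) * ∫ κ : ℝ, Complex.exp (Complex.I * κ * x)
      * ∫ s : ℝ, Complex.exp (-Complex.I * s * κ) * u s y t
      = (∫ κ : ℝ, ∫ l : ℝ, E κ l x y t * halfFourier (fun x y => u x y 0) κ l)
        + ∫ κ : ℝ, boundaryIntegral κ (fun l => E κ l x y t * G u₀ g₀ g₁ κ l t) := by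
    rw [← integral_const_mul, ← integral_add iA iB]
    congr 1 with κ
    exact hrep κ
  rw [← hinv] at hsum
  rw [← mul_add, ← hsum]
  field_simp

end

end HalfSpaceHeat

end

open HalfSpaceHeat
theorem mainTheorem4 :
    -- analyticity of the invariance map
    (∀ κ : ℝ, AnalyticOnNhd ℂ (nu κ) (cut κ)ᶜ) ∧
    (∀ κ : ℝ, κ ≠ 0 →
      (∃ δ > 0, Disjoint (Metric.thickening δ (closure (Dplus κ))) (cut κ)) ∧
      AnalyticOnNhd ℂ (nu κ) (closure (Dplus κ))) ∧
    AnalyticOnNhd ℂ (nu 0) (closure (Dplus 0) \ {0}) ∧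
    -- the representation formula
    ∀ (T m : ℝ) (_ : 3 < m) (u : ℝ → ℝ → ℝ → ℂ) (u₀ g₀ g₁ : ℝ → ℝ → ℂ),
      SmoothDecaying T m u → SolvesIBVP T u u₀ g₀ g₁ →
      ∀ (x : ℝ), ∀ y ∈ Set.Ioi (0 : ℝ), ∀ t ∈ Set.Ioo 0 T,
        MeasureTheory.Integrable
          (fun p : ℝ × ℝ => E p.1 p.2 x y t * halfFourier u₀ p.1 p.2) ∧
        BoundaryIntegrable (fun κ l => E κ l x y t * G u₀ g₀ g₁ κ l t) ∧
        u x y t =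
          1 / (2 * (Real.pi : ℂ)) ^ 2 *
            (∫ κ : ℝ, ∫ l : ℝ, E κ l x y t * halfFourier u₀ κ l) +
          1 / (2 * (Real.pi : ℂ)) ^ 2 *
            (∫ κ : ℝ, boundaryIntegral κ (fun l => E κ l x y t * G u₀ g₀ g₁ κ l t)) := by
  refine ⟨analyticOnNhd_nu, fun κ hκ => ?_,
    (analyticOnNhd_nu 0).mono closure_Dplus_diff_subset_compl_cut, ?_⟩
  · have hδ : 0 < |κ| / 20 := by have := abs_pos.2 hκ; positivity
    have hdisj := disjoint_thickening_cut hκ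
    refine ⟨⟨|κ| / 20, hδ, hdisj⟩, (analyticOnNhd_nu κ).mono fun l hl => ?_⟩
    exact Set.disjoint_left.1 hdisj (Metric.self_subset_thickening hδ _ hl)
  · intro T m hm u u₀ g₀ g₁ hu hs x y hy t ht
    refine ⟨?_, boundaryIntegrable_E_mul_G hu hm hs ht x hy, ?_⟩
    · simp only [hs.halfFourier_initial]
      exact hu.integrable_E_mul_halfFourier (by linarith) ht x y
    · simp only [hs.halfFourier_initial]
      exact representation_formula hu hm hs ht x hy
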